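/- Let $H:\mathbb R\to\mathbb R$ be a $C^\infty$ double-well potential: there are $P_-<0<P_+$ such that $H$ is strictly decreasing on $(-\infty,P_-]$ and on $[0,P_+]$ and strictly increasing on $[P_-,0]$ and on $[P_+,\infty)$; $H(0)=0$; $H''(0)=-2\pi\omega_0^2<0$ and $H''(P_\pm)=2\pi\omega_\pm^2>0$ with $\omega_0,\omega_\pm>0$; the barriers $h_\pm:=-H(P_\pm)>0$ satisfy $h_-\le h_+$ (the case of an even $H$ is included); and $H$ grows at least quadratically at infinity in the sense that there are $c,R>0$ with $H(p)\ge c\,p^2$ and $|H'(p)|\ge c$ for all $|p|\ge R$. For $\nu>0$ set $\tau:=\omega_0\omega_-e^{-h_- /\nu^2}$, $\gamma(p):=e^{-H(p)/\nu^2}$, $J_-:=(-\infty,0)$, $J_+:=(0,\infty)$ and $$\mu_\pm:=\int_{J_\pm}\gamma\,dp,\qquad \eta:=\int_{P_-}^{P_+}\frac{dp}{\gamma(p)},\qquad \kappa:=\frac{\mu_-}{\mu_+},\qquad \theta:=\frac{\tau\mu_-\eta}{\nu^2}-1,\qquad \gamma_\pm:=\mu_\pm^{-1}\gamma\,\chi_{J_\pm}.$$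 Let $\psi:\mathbb R\to\mathbb R$ be the continuous function with $\psi(P_-)=0$, $\psi'=1/(\eta\gamma)$ on $(P_-,P_+)$ and $\psi'=0$ outside $[P_-,P_+]$. A solution is a function $\varrho\ge0$ on $[0,\infty)\times\mathbb R$ with $\int_{\mathbb R}\varrho(t,p)\,dp=1$ for all $t\ge0$, which is of class $C^2$ on $(0,\infty)\times\mathbb R$, satisfies there $$\tau\,\partial_t\varrho=\partial_p\big(\nu^2\partial_p\varrho+H'(p)\varrho\big),$$ and for which $\varrho(t,\cdot)\to\varrho(0,\cdot)$ in $L^1(\mathbb R)$ as $t\downarrow0$. For a solution let $$m_\pm(t):=\int_{J_\pm}\varrho\,dp,\quad \widetilde m_-(t):=\int_{\mathbb R}(1-\psi)\varrho\,dp,\quad \widetilde m_+(t):=\int_{\mathbb R}\psi\varrho\,dp,\quad \overline m_\pm(t):=\frac{\varrho(t,P_\pm)}{\gamma_\pm(P_\pm)},$$ $$\mathcal D(t):=\int_{\mathbb R}\frac{\big(\partial_p\varrho+\nu^{-2}H'\varrho\big)^2}{\varrho}\,dp\in[0,\infty],\qquad \mathcal E(t):=\int_{\mathbb R}\big(\nu^2\varrho\ln\varrho+H\varrho\big)\,dp\in(-\infty,\infty],$$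 where the integrand of $\mathcal D$ is read as $0$ where $\varrho=0$. Then there are constants $C>0$ and $\nu_0>0$, which depend only on $H$, such that for every $0<\nu<\nu_0$ and, in (2)–(4), every solution $\varrho$: (1) (Elementary asymptotics) for both choices of the sign, $$|\theta|+\Big|\eta\frac{\omega_0}{\nu}-1\Big|+\Big|\mu_\pm\frac{\omega_\pm}{\nu}e^{-h_\pm/\nu^2}-1\Big|+\Big|\kappa\frac{\omega_-}{\omega_+}e^{(h_+-h_-)/\nu^2}-1\Big|\le C\nu^2;$$ (2) (Effective dynamics) $\widetilde m_\pm$ is differentiable at every $t>0$, and $$\pm(1+\theta)\frac{d}{dt}\widetilde m_\pm(t)=\overline m_-(t)-\kappa\,\overline m_+(t);$$ (3) (Dissipation bounds error) for both choices of the sign and every $t>0$, and also for $t=0$ if $\varrho(0,\cdot)\in C^1(\mathbb R)$, $$|\widetilde m_\pm(t)-m_\pm(t)|+|\overline m_\pm(t)-m_\pm(t)|\le C\big(\tau^{-1/2}\nu^2\mathcal D(t)+\tau^{1/2}\nu^{-2}\big);$$ (4) (Energy balance) if $\mathcal E(0)<\infty$, then $$\int_0^\infty\mathcal D(t)\,dt\le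 C\tau\nu^{-4}\big(C+\mathcal E(0)\big).$$ -/

import Mathlib

open MeasureTheory Set Filter Topology
open scoped ContDiff ENNReal

/-- Labels of the two wells (phases) of a double-well potential. -/
inductive Well where
  | minus
  | plus

/-- The sign `±1` that belongs to the index `±`. -/
def Well.sign : Well → ℝ
  | .minus => -1
  | .plus => 1

/-- The phases `J₋ = (-∞, 0)` and `J₊ = (0, ∞)`. -/
def Well.phase : Well → Set ℝ
  | .minus => Iio 0
  | .plus => Ioi 0

/-- A smooth, nondegenerate double-well potential `H` on the real line, with local minima
`P₋ < 0 < P₊`, with the local maximum normalized by `H 0 = 0`, with barriers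
`h₋ = -H P₋ ≤ h₊ = -H P₊`, and with at least quadratic growth at infinity. -/
structure DoubleWell where
  /-- the potential -/
  H : ℝ → ℝ
  /-- the positions of the two local minima -/
  P : Well → ℝ
  smooth : ContDiff ℝ ∞ H
  P_minus_neg : P .minus < 0
  P_plus_pos : 0 < P .plus
  /- The shape of a double well: `P₋` and `P₊` are the only local minima and `0` is the only
  local maximum. -/
  anti_left : StrictAntiOn H (Iic (P .minus))
  mono_left : StrictMonoOn H (Icc (P .minus) 0)
  anti_right : StrictAntiOn H (Icc 0 (P .plus))
  mono_right : StrictMonoOn H (Ici (P .plus))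
  H_zero : H 0 = 0
  nondegenerate_zero : deriv (deriv H) 0 < 0
  nondegenerate_P : ∀ s, 0 < deriv (deriv H) (P s)
  barrier_le : -H (P .minus) ≤ -H (P .plus)
  /- At least quadratic growth at infinity. The slope condition excludes that `H` stays almost
  constant on arbitrarily long intervals far out; both conditions hold as soon as
  `H' p / p` is bounded below by a positive constant for large `|p|`. -/
  growth : ∃ c > 0, ∃ R : ℝ, ∀ p : ℝ, R ≤ |p| → c * p ^ 2 ≤ H p ∧ c ≤ |deriv H p|

noncomputable section

namespace DoubleWell

variable (W : DoubleWell)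

/-- The barriers `h₋` and `h₊`. -/
def h (s : Well) : ℝ := -W.H (W.P s)

/-- `ω₀`, determined by `H''(0) = -2π ω₀²`. -/
def omegaZero : ℝ := Real.sqrt (-deriv (deriv W.H) 0 / (2 * Real.pi))

/-- `ω₋` and `ω₊`, determined by `H''(P±) = 2π ω±²`. -/
def omega (s : Well) : ℝ := Real.sqrt (deriv (deriv W.H) (W.P s) / (2 * Real.pi))

/-- Kramers' time scale `τ = ω₀ ω₋ exp(-h₋ / ν²)`. -/
def tau (ν : ℝ) : ℝ := W.omegaZero * W.omega .minus * Real.exp (-W.h .minus / ν ^ 2)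

/-- The Gibbs function `γ(p) = exp(-H(p) / ν²)`. -/
def gibbs (ν p : ℝ) : ℝ := Real.exp (-W.H p / ν ^ 2)

/-- `μ±`, the integral of `γ` over `J±`. -/
def mu (ν : ℝ) (s : Well) : ℝ := ∫ p in s.phase, W.gibbs ν p

/-- `η`, the integral of `1 / γ` over `(P₋, P₊)`. -/
def eta (ν : ℝ) : ℝ := ∫ p in Ioo (W.P .minus) (W.P .plus), 1 / W.gibbs ν p

/-- `κ = μ₋ / μ₊`. -/
def kappa (ν : ℝ) : ℝ := W.mu ν .minus / W.mu ν .plus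

/-- `θ = τ μ₋ η / ν² - 1`. -/
def theta (ν : ℝ) : ℝ := W.tau ν * W.mu ν .minus * W.eta ν / ν ^ 2 - 1

/-- The normalized restriction `γ±` of `γ` to `J±`. -/
def gibbsLoc (ν : ℝ) (s : Well) (p : ℝ) : ℝ :=
  s.phase.indicator (fun q => (W.mu ν s)⁻¹ * W.gibbs ν q) p

/-- The moment weight `ψ`: it vanishes at `P₋`, and its derivative is `1 / (η γ)` on
`(P₋, P₊)` and zero elsewhere. -/
def psi (ν p : ℝ) : ℝ :=
  ∫ q in (W.P .minus)..p,
    (Ioo (W.P .minus) (W.P .plus)).indicator (fun r => 1 / (W.eta ν * W.gibbs ν r)) q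

/-- The weights `1 - ψ` and `ψ` of the two substitute masses. -/
def weight (ν : ℝ) : Well → ℝ → ℝ
  | .minus, p => 1 - W.psi ν p
  | .plus, p => W.psi ν p

/-- Solutions of `τ ∂ₜρ = ∂ₚ(ν² ∂ₚρ + H'(p) ρ)` on `(0, ∞) × ℝ`: nonnegative, of unit mass,
classical for positive times, and attaining the initial datum `ρ 0` in `L¹(ℝ)`. -/
structure IsSolution (ν : ℝ) (ρ : ℝ → ℝ → ℝ) : Prop where
  nonneg : ∀ t, 0 ≤ t → ∀ p, 0 ≤ ρ t p
  integrable : ∀ t, 0 ≤ t → Integrable (ρ t)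
  mass_one : ∀ t, 0 ≤ t → ∫ p, ρ t p = 1
  regular : ContDiffOn ℝ 2 (Function.uncurry ρ) (Ioi 0 ×ˢ univ)
  equation : ∀ t, 0 < t → ∀ p,
    W.tau ν * deriv (fun s => ρ s p) t
      = deriv (fun q => ν ^ 2 * deriv (ρ t) q + deriv W.H q * ρ t q) p
  initial : Tendsto (fun t => ∫ p, |ρ t p - ρ 0 p|) (𝓝[>] 0) (𝓝 0)

/-- The partial masses `m±(t)`. -/
def mass (ρ : ℝ → ℝ → ℝ) (s : Well) (t : ℝ) : ℝ := ∫ p in s.phase, ρ t p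

/-- The squared relative densities `w±² = ρ / γ±` on `J±`. -/
def wSq (ν : ℝ) (ρ : ℝ → ℝ → ℝ) (s : Well) (t p : ℝ) : ℝ := ρ t p / W.gibbsLoc ν s p

/-- The substitute masses `m̄±(t) = w±(t, P±)²`. -/
def massBar (ν : ℝ) (ρ : ℝ → ℝ → ℝ) (s : Well) (t : ℝ) : ℝ := W.wSq ν ρ s t (W.P s)

/-- The substitute masses `m̃₋(t) = ∫ (1 - ψ) ρ dp` and `m̃₊(t) = ∫ ψ ρ dp`. -/
def massTilde (ν : ℝ) (ρ : ℝ → ℝ → ℝ) (s : Well) (t : ℝ) : ℝ :=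
  ∫ p, W.weight ν s p * ρ t p

/-- The Wasserstein dissipation `𝓓(t)` with values in `[0, ∞]`; at zeros of `ρ t` the integrand
is `0`, in accordance with `∂ₚρ = 0` there. -/
def dissipation (ν : ℝ) (ρ : ℝ → ℝ → ℝ) (t : ℝ) : ℝ≥0∞ :=
  ∫⁻ p, ENNReal.ofReal ((deriv (ρ t) p + deriv W.H p * ρ t p / ν ^ 2) ^ 2 / ρ t p)

/-- The integrand of the energy. -/
def energyDensity (ν : ℝ) (ρ : ℝ → ℝ → ℝ) (t p : ℝ) : ℝ :=
  ν ^ 2 * ρ t p * Real.log (ρ t p) + W.H p * ρ t p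

/-- The energy `𝓔(t)`. The negative part of its integrand is always integrable, so it is finite
if and only if the integrand is integrable, and it is `+∞` otherwise; this real number is
its value in the finite case. -/
def energy (ν : ℝ) (ρ : ℝ → ℝ → ℝ) (t : ℝ) : ℝ := ∫ p, W.energyDensity ν ρ t p

end DoubleWell

end

/-! ### Laplace's method with a relative error of second order -/

/-! Asymptotics. The integrals `μ±` and `η` are Laplace integrals. After scaling by `ν` around the
critical point, the exponent is Gaussian plus a cubic term of order `ν` plus `O(ν²)`. The cubic
contribution is odd and integrates to zero, so the relative error is `O(ν²)`
(`laplace_second_order`). The quantities `1 + θ` and `κ`, suitably normalized, are a product and a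
quotient of such integrals.

Dynamics. The relative density `u = ρ / γ` satisfies `σ γ ∂ₜu = ∂ₚ(γ ∂ₚu)` with `σ = τ / ν²`. Since
`γ ψ'` equals `1 / η` between the minima and `0` outside, testing with `ψ` leaves exactly the
difference of `u` at the two minima, divided by `η`. The difficulty lies at infinity, where no decay
of `ρ` is assumed. It is resolved by testing the equation with a cutoff of radius `2L`: the mass is
conserved and `p H'(p)` is bounded below, so the time integral of `∫ |p H'| ρ` over `[-L, L]` is
`o(L²)` (`tendsto_bulk_flux`). This is precisely what makes all cutoff errors vanish
(`tendsto_cutoff_error`).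

Error bound. Seen from a minimum, the mass of `γ` beyond `q` is at most `K γ(q)`
(`exists_tail_bound`). Integration by parts and Young's inequality then bound `m̄± - m±` by `D / k +
k K²` for every `k > 0`; the choice `k = τ^(1/2) / ν²` gives the two terms of the claim. For `m̃± -
m±`, the defect of the weight times `γ` is `O(1 / η)`, and `u` is bounded up to the barrier by `2
u(P±) + η D`. The remaining factor `1 / (η μ±)` is `O(τ / ν²)`, for the plus well because `h₋ ≤ h₊`.

Energy. The dissipation is the entropy production relative to the normalized Gibbs measure. The
entropy is regularized so that its derivative is bounded, which permits cutoffs and the passage to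
the initial time in `L¹`; Fatou's lemma removes the regularization (`lintegral_dissipation_le`).
Finally, `ν² log Z` is bounded by the Laplace asymptotics. -/

lemma abs_exp_neg_sub_one_add_le {y : ℝ} (hy : 0 ≤ y) :
    |Real.exp (-y) - 1 + y| ≤ y ^ 2 / 2 := by
  have h1 := Real.add_one_le_exp (-y)
  have h2 := Real.quadratic_le_exp_of_nonneg hy
  rw [abs_of_nonneg (by linarith)]
  have h3 : Real.exp (-y) * Real.exp y = 1 := by rw [← Real.exp_add]; simp
  have h4 : 0 < Real.exp (-y) := Real.exp_pos _
  have h5 : Real.exp (-y) * (1 + y + y ^ 2 / 2) ≤ 1 := by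
    exact (mul_le_mul_of_nonneg_left h2 h4.le).trans h3.le
  have h6 : (1 - y + y ^ 2 / 2) * (1 + y + y ^ 2 / 2) = 1 + y ^ 4 / 4 := by ring
  have h7 : 0 < 1 + y + y ^ 2 / 2 := by positivity
  have h8 : Real.exp (-y) ≤ 1 - y + y ^ 2 / 2 := by
    refine le_of_mul_le_mul_right ?_ h7
    rw [h6]; nlinarith [pow_nonneg hy 4]
  linarith

lemma abs_exp_sub_one_sub_le {y : ℝ} (hy : 0 ≤ y) :
    |Real.exp y - 1 - y| ≤ y ^ 2 / 2 * Real.exp y := by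
  have h := abs_exp_neg_sub_one_add_le hy
  have h1 := Real.add_one_le_exp y
  have h3 : Real.exp (-y) * Real.exp y = 1 := by rw [← Real.exp_add]; simp
  have h4 := Real.exp_pos y
  rw [abs_of_nonneg (by linarith)]
  -- The function vanishes at `0`, so its monotonicity is the claim; the derivative is nonnegative
  -- because `exp (-x) ≥ 1 - x`.
  have hmono : MonotoneOn (fun x : ℝ => (x ^ 2 / 2 - 1) * Real.exp x + 1 + x) (Ici 0) := by
    refine monotoneOn_of_deriv_nonneg (convex_Ici 0) (by fun_prop) (by fun_prop) ?_
    intro x hx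
    have hx0 : 0 < x := by simpa using hx
    have hd : HasDerivAt (fun x : ℝ => (x ^ 2 / 2 - 1) * Real.exp x + 1 + x)
        ((2 * x / 2) * Real.exp x + (x ^ 2 / 2 - 1) * Real.exp x + 1) x := by
      have := ((((hasDerivAt_pow 2 x).div_const 2).sub_const 1).mul (Real.hasDerivAt_exp x)).add_const 1
        |>.add (hasDerivAt_id x)
      convert! this using 1
      simp
    rw [hd.deriv]
    have h1 := Real.add_one_le_exp (-x)
    have h3 : Real.exp (-x) * Real.exp x = 1 := by rw [← Real.exp_add]; simp
    have h4 := Real.exp_pos x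
    nlinarith [mul_le_mul_of_nonneg_right h1 h4.le, sq_nonneg x, mul_pos hx0 h4]
  have := hmono self_mem_Ici (mem_Ici.2 hy) hy
  simp at this
  linarith

/-- Linearization of the exponential at `-B`, with a remainder that keeps exponential decay through
any common lower bound `m`, whichever of `A` and `B` is larger. In Laplace's method `A` is the
rescaled exponent, `B` its quadratic part and `m` a common quadratic minorant. -/
lemma abs_exp_neg_sub_exp_neg_mul_le {A B m : ℝ} (hA : m ≤ A) (hB : m ≤ B) :
    |Real.exp (-A) - Real.exp (-B) * (1 - (A - B))| ≤ (A - B) ^ 2 / 2 * Real.exp (-m) := by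
  have key : Real.exp (-A) - Real.exp (-B) * (1 - (A - B))
      = Real.exp (-B) * (Real.exp (-(A - B)) - 1 + (A - B)) := by
    have : Real.exp (-A) = Real.exp (-B) * Real.exp (-(A - B)) := by
      rw [← Real.exp_add]; congr 1; ring
    rw [this]; ring
  rw [key, abs_mul, abs_of_pos (Real.exp_pos _)]
  rcases le_total 0 (A - B) with h | h
  · have := abs_exp_neg_sub_one_add_le h
    have h2 : Real.exp (-B) ≤ Real.exp (-m) := Real.exp_le_exp.2 (by linarith)
    calc _ ≤ Real.exp (-m) * ((A - B) ^ 2 / 2) := by gcongr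
      _ = _ := by ring
  · have h0 : 0 ≤ -(A - B) := by linarith
    have := abs_exp_sub_one_sub_le h0
    rw [sub_neg_eq_add] at this
    have h2 : Real.exp (-B) * Real.exp (-(A - B)) ≤ Real.exp (-m) := by
      rw [← Real.exp_add]; exact Real.exp_le_exp.2 (by linarith)
    calc _ ≤ Real.exp (-B) * ((-(A - B)) ^ 2 / 2 * Real.exp (-(A - B))) := by gcongr
      _ = (A - B) ^ 2 / 2 * (Real.exp (-B) * Real.exp (-(A - B))) := by ring
      _ ≤ _ := by gcongr

lemma integrable_pow_mul_exp_neg_mul_sq {c : ℝ} (hc : 0 < c) (n : ℕ) :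
    Integrable fun z : ℝ => z ^ n * Real.exp (-(c * z ^ 2)) := by
  have := integrable_rpow_mul_exp_neg_mul_sq hc (s := (n : ℝ))
    (by have : (0 : ℝ) ≤ n := n.cast_nonneg
        linarith)
  simpa [Real.rpow_natCast] using this

/-- Third order Taylor expansion at a critical point. -/
lemma exists_taylor_three_bound {f : ℝ → ℝ} (hf : ContDiff ℝ ∞ f) {x₀ : ℝ} (h0 : f x₀ = 0)
    (h1 : deriv f x₀ = 0) :
    ∃ a K δ : ℝ, 0 ≤ K ∧ 0 < δ ∧ ∀ y, |y| < δ →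
      |f (x₀ + y) - deriv (deriv f) x₀ / 2 * y ^ 2 - a * y ^ 3| ≤ K * y ^ 4 := by
  have ht := taylor_isLittleO_univ (x₀ := x₀) (n := 4) (f := f)
    (contDiff_infty.1 hf 4)
  have hb := ht.bound (c := 1) one_pos
  rw [Metric.eventually_nhds_iff] at hb
  obtain ⟨δ, hδ, hb⟩ := hb
  have e2 : iteratedDeriv 2 f x₀ = deriv (deriv f) x₀ := by
    simp [iteratedDeriv_succ, iteratedDeriv_zero]
  -- `K` absorbs the fourth Taylor coefficient together with the little-o remainder, which is at
  -- most `|y|⁴` near `x₀`.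
  refine ⟨iteratedDeriv 3 f x₀ / 6, 1 + |iteratedDeriv 4 f x₀ / 24|, δ, by positivity, hδ, ?_⟩
  intro y hy
  have := hb (y := x₀ + y) (by simpa [Real.dist_eq] using hy)
  rw [taylor_within_apply] at this
  simp [Finset.sum_range_succ, iteratedDerivWithin_univ, h0, h1, e2, iteratedDeriv_zero,
    iteratedDeriv_one, Nat.factorial] at this
  have h4 : |y| ^ 4 = y ^ 4 := by
    rw [← abs_pow]; exact abs_of_nonneg (by positivity)
  rw [h4] at this
  have hy4 : 0 ≤ y ^ 4 := by positivity
  have hsplit : f (x₀ + y) - deriv (deriv f) x₀ / 2 * y ^ 2 - iteratedDeriv 3 f x₀ / 6 * y ^ 3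
      = (f (x₀ + y) - (2⁻¹ * y ^ 2 * deriv (deriv f) x₀ + (3 * 2 : ℝ)⁻¹ * y ^ 3 * iteratedDeriv 3 f x₀
        + (4 * (3 * 2) : ℝ)⁻¹ * y ^ 4 * iteratedDeriv 4 f x₀)) + iteratedDeriv 4 f x₀ / 24 * y ^ 4 := by
    ring
  rw [hsplit]
  refine (abs_add_le _ _).trans ?_
  rw [abs_mul, abs_of_nonneg hy4, add_mul, one_mul]
  gcongr
  refine le_trans (le_of_eq ?_) this
  congr 1
  ring

/-- With `x = x₀ + ν z` the integrand is compared pointwise with `exp (-b z²) (1 - a ν z³)`, where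
`b = π om²`. The cubic correction is odd, so it improves the pointwise error to order `ν²` without
changing the value `1 / om` of the Gaussian integral. -/
theorem laplace_second_order {f : ℝ → ℝ} (hf : ContDiff ℝ ∞ f) {x₀ om c : ℝ} (h0 : f x₀ = 0)
    (h1 : deriv f x₀ = 0) (hom : 0 < om) (h2 : deriv (deriv f) x₀ = 2 * Real.pi * om ^ 2)
    {S : Set ℝ} (hS : MeasurableSet S) (hSx : S ∈ 𝓝 x₀) (hc : 0 < c)
    (hlow : ∀ x ∈ S, c * (x - x₀) ^ 2 ≤ f x) :
    ∃ C > 0, ∀ ν : ℝ, 0 < ν → ν ≤ 1 →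
      |(∫ x in S, Real.exp (-f x / ν ^ 2)) * (om / ν) - 1| ≤ C * ν ^ 2 := by
  obtain ⟨a, K, δ₀, hK, hδ₀, hT⟩ := exists_taylor_three_bound hf h0 h1
  obtain ⟨δ₁, hδ₁, hball⟩ := Metric.mem_nhds_iff.1 hSx
  set b : ℝ := Real.pi * om ^ 2 with hb
  have hbpos : 0 < b := by have := Real.pi_pos; positivity
  have hb2 : deriv (deriv f) x₀ / 2 = b := by rw [h2, hb]; ring
  rw [hb2] at hT
  set m := min c b with hm
  have hmpos : 0 < m := lt_min hc hbpos
  obtain ⟨δ, hδ, hδle0, hδle1, hδ1⟩ : ∃ δ > 0, δ < δ₀ ∧ δ < δ₁ ∧ δ ≤ 1 := by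
    refine ⟨min (min (δ₀ / 2) (δ₁ / 2)) 1, by positivity, ?_, ?_, min_le_right _ _⟩
    · have : min (min (δ₀ / 2) (δ₁ / 2)) 1 ≤ δ₀ / 2 := (min_le_left _ _).trans (min_le_left _ _)
      linarith
    · have : min (min (δ₀ / 2) (δ₁ / 2)) 1 ≤ δ₁ / 2 := (min_le_left _ _).trans (min_le_right _ _)
      linarith
  -- The first two terms serve the region `|ν z| ≤ δ`, where the Taylor expansion is available; the
  -- last two serve its complement.
  set C₁ := K + (|a| + K) ^ 2 + 2 / δ ^ 4 + |a| / δ with hC₁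
  have hC₁pos : 0 < C₁ := by positivity
  -- The power `z⁴` comes from the Taylor remainder, and `z⁶` from the square of the deviation of
  -- the exponent from its quadratic part.
  set w : ℝ → ℝ := fun z => (z ^ 4 + z ^ 6) * Real.exp (-(m * z ^ 2)) with hw
  have hwint : Integrable w := by
    have := (integrable_pow_mul_exp_neg_mul_sq hmpos 4).add (integrable_pow_mul_exp_neg_mul_sq hmpos 6)
    refine this.congr (ae_of_all _ fun z => ?_)
    simp only [hw, Pi.add_apply]; ring
  have hw0 : ∀ z, 0 ≤ w z := fun z => by simp only [hw]; positivity
  have hIw : 0 ≤ ∫ z, w z := integral_nonneg hw0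
  refine ⟨C₁ * (∫ z, w z) * om + 1, by positivity, fun ν hν hν1 => ?_⟩
  set F : ℝ → ℝ := fun z => S.indicator (fun x => Real.exp (-f x / ν ^ 2)) (x₀ + ν * z) with hF
  set G : ℝ → ℝ := fun z => Real.exp (-(b * z ^ 2)) * (1 - a * ν * z ^ 3) with hG
  have hint : ∫ x in S, Real.exp (-f x / ν ^ 2) = ν * ∫ z, F z := by
    rw [← integral_indicator hS, ← integral_add_left_eq_self _ x₀]
    have := Measure.integral_comp_mul_left
      (fun y => S.indicator (fun x => Real.exp (-f x / ν ^ 2)) (x₀ + y)) ν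
    rw [hF, this, abs_of_pos (by positivity), smul_eq_mul]
    field_simp
  have hGint : Integrable G := by
    have := (integrable_pow_mul_exp_neg_mul_sq hbpos 0).sub
      ((integrable_pow_mul_exp_neg_mul_sq hbpos 3).const_mul (a * ν))
    refine this.congr (ae_of_all _ fun z => ?_)
    simp only [hG, Pi.sub_apply]; ring
  have hGval : ∫ z, G z = 1 / om := by
    have e : ∀ z, G z = Real.exp (-b * z ^ 2) - (a * ν) * (z ^ 3 * Real.exp (-(b * z ^ 2))) := by
      intro z; simp only [hG, neg_mul]; ring
    have hodd : ∫ z : ℝ, z ^ 3 * Real.exp (-(b * z ^ 2)) = 0 := by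
      have := integral_neg_eq_self (fun z : ℝ => z ^ 3 * Real.exp (-(b * z ^ 2))) volume
      have e3 : ∀ z : ℝ, (-z) ^ 3 * Real.exp (-(b * (-z) ^ 2)) = -(z ^ 3 * Real.exp (-(b * z ^ 2))) := by
        intro z; rw [neg_sq]; ring
      simp_rw [e3, integral_neg] at this
      linarith
    simp_rw [e]
    rw [integral_sub, integral_const_mul, hodd, integral_gaussian]
    · rw [hb, show Real.pi / (Real.pi * om ^ 2) = (1 / om) ^ 2 by
        have := Real.pi_ne_zero; field_simp, Real.sqrt_sq (by positivity)]
      simp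
    · simpa using integrable_pow_mul_exp_neg_mul_sq hbpos 0
    · exact (integrable_pow_mul_exp_neg_mul_sq hbpos 3).const_mul _
  have hpt : ∀ z, |F z - G z| ≤ C₁ * ν ^ 2 * w z := by
    intro z
    have hexpm : Real.exp (-(b * z ^ 2)) ≤ Real.exp (-(m * z ^ 2)) :=
      Real.exp_le_exp.2 (neg_le_neg (mul_le_mul_of_nonneg_right (min_le_right _ _) (sq_nonneg z)))
    have hlowA : ∀ x, x = x₀ + ν * z → x ∈ S → m * z ^ 2 ≤ f x / ν ^ 2 := by
      intro x hx hxS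
      rw [le_div_iff₀ (by positivity)]
      refine le_trans ?_ (hlow x hxS)
      rw [hx]
      calc m * z ^ 2 * ν ^ 2 ≤ c * z ^ 2 * ν ^ 2 := by gcongr; exact min_le_left _ _
        _ = _ := by ring
    rcases le_or_gt |ν * z| δ with hz | hz
    · have hxS : x₀ + ν * z ∈ S := hball (by
        rw [Metric.mem_ball, Real.dist_eq]; simpa using hz.trans_lt hδle1)
      have hA := hlowA _ rfl hxS
      have hFz : F z = Real.exp (-(f (x₀ + ν * z) / ν ^ 2)) := by
        simp only [hF, indicator_of_mem hxS, neg_div]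
      set A := f (x₀ + ν * z) / ν ^ 2 with hAdef
      have hB : m * z ^ 2 ≤ b * z ^ 2 := by gcongr; exact min_le_right _ _
      have htay := hT (ν * z) (hz.trans_lt hδle0)
      have hAB : |A - b * z ^ 2 - a * ν * z ^ 3| ≤ K * ν ^ 2 * z ^ 4 := by
        have e : A - b * z ^ 2 - a * ν * z ^ 3
            = (f (x₀ + ν * z) - b * (ν * z) ^ 2 - a * (ν * z) ^ 3) / ν ^ 2 := by
          rw [hAdef]; field_simp
        rw [e, abs_div, abs_of_pos (show (0 : ℝ) < ν ^ 2 by positivity), div_le_iff₀ (by positivity)]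
        refine htay.trans (le_of_eq ?_); ring
      have hAB2 : (A - b * z ^ 2) ^ 2 ≤ (|a| + K) ^ 2 * (ν ^ 2 * z ^ 6) := by
        have h3 : |A - b * z ^ 2| ≤ (|a| + K) * (ν * |z| ^ 3) := by
          have : A - b * z ^ 2 = (A - b * z ^ 2 - a * ν * z ^ 3) + a * ν * z ^ 3 := by ring
          rw [this]
          refine (abs_add_le _ _).trans ?_
          have h5 : |a * ν * z ^ 3| = |a| * (ν * |z| ^ 3) := by
            rw [abs_mul, abs_mul, abs_of_pos hν, abs_pow]; ring
          have h6 : K * ν ^ 2 * z ^ 4 ≤ K * (ν * |z| ^ 3) := by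
            have h7 : ν * |z| ≤ 1 := by
              rw [abs_mul, abs_of_pos hν] at hz; linarith
            have h8 : z ^ 4 = |z| ^ 4 := by
              rw [← abs_pow]; exact (abs_of_nonneg (by positivity)).symm
            calc K * ν ^ 2 * z ^ 4 = K * (ν * |z| ^ 3) * (ν * |z|) := by rw [h8]; ring
              _ ≤ K * (ν * |z| ^ 3) * 1 := by gcongr
              _ = _ := by ring
          rw [h5]; linarith
        calc (A - b * z ^ 2) ^ 2 = |A - b * z ^ 2| ^ 2 := (sq_abs _).symm
          _ ≤ ((|a| + K) * (ν * |z| ^ 3)) ^ 2 := by gcongr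
          _ = (|a| + K) ^ 2 * (ν ^ 2 * (|z| ^ 2) ^ 3) := by ring
          _ = _ := by rw [sq_abs]; ring
      have hmain := abs_exp_neg_sub_exp_neg_mul_le hA hB
      have hdec : F z - G z = (Real.exp (-A) - Real.exp (-(b * z ^ 2)) * (1 - (A - b * z ^ 2)))
          - Real.exp (-(b * z ^ 2)) * (A - b * z ^ 2 - a * ν * z ^ 3) := by
        rw [hFz]; simp only [hG]; ring
      rw [hdec]
      refine (abs_sub _ _).trans ?_
      rw [abs_mul, abs_of_pos (Real.exp_pos _)]
      set E := Real.exp (-(m * z ^ 2)) with hE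
      have hE0 : 0 < E := Real.exp_pos _
      calc _ ≤ (|a| + K) ^ 2 * (ν ^ 2 * z ^ 6) / 2 * E + E * (K * ν ^ 2 * z ^ 4) := by
            refine add_le_add (hmain.trans (by gcongr)) ?_
            gcongr
        _ ≤ (|a| + K) ^ 2 * (ν ^ 2 * (z ^ 4 + z ^ 6)) * E + E * (K * ν ^ 2 * (z ^ 4 + z ^ 6)) := by
            have e4 : 0 ≤ z ^ 4 := by positivity
            have e6 : 0 ≤ z ^ 6 := by positivity
            refine add_le_add ?_ ?_
            · have : (|a| + K) ^ 2 * (ν ^ 2 * z ^ 6) / 2 ≤ (|a| + K) ^ 2 * (ν ^ 2 * z ^ 6) :=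
                half_le_self (by positivity)
              refine mul_le_mul_of_nonneg_right (this.trans ?_) hE0.le
              gcongr; linarith
            · gcongr; linarith
        _ = (K + (|a| + K) ^ 2) * ν ^ 2 * w z := by simp only [hw, hE]; ring
        _ ≤ _ := by
            have := hw0 z
            gcongr
            rw [hC₁]
            have : 0 ≤ 2 / δ ^ 4 := by positivity
            have : 0 ≤ |a| / δ := by positivity
            linarith
    · have hνz : |ν * z| = ν * |z| := by rw [abs_mul, abs_of_pos hν]
      rw [hνz] at hz
      have hz4 : |z| ^ 4 = z ^ 4 := by
        rw [← abs_pow]; exact abs_of_nonneg (by positivity)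
      -- Far from the minimum no expansion is needed: `ν |z| > δ` turns constants into multiples of
      -- `ν² z⁴`, and both integrands are bounded separately.
      have hone : 1 ≤ ν ^ 2 * z ^ 4 / δ ^ 4 := by
        rw [le_div_iff₀ (by positivity), one_mul]
        calc δ ^ 4 ≤ (ν * |z|) ^ 4 := by gcongr
          _ = ν ^ 2 * (ν ^ 2 * z ^ 4) := by rw [mul_pow, hz4]; ring
          _ ≤ 1 * (ν ^ 2 * z ^ 4) := by gcongr; exact pow_le_one₀ hν.le hν1
          _ = _ := by ring
      have hcub : |a| * ν * |z| ^ 3 ≤ |a| / δ * ν ^ 2 * z ^ 4 := by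
        rw [← hz4, div_mul_eq_mul_div, div_mul_eq_mul_div, le_div_iff₀ hδ]
        calc |a| * ν * |z| ^ 3 * δ ≤ |a| * ν * |z| ^ 3 * (ν * |z|) := by gcongr
          _ = _ := by ring
      set E := Real.exp (-(m * z ^ 2)) with hE
      have hE0 : 0 < E := Real.exp_pos _
      have hFz : |F z| ≤ E := by
        simp only [hF]
        by_cases hxS : x₀ + ν * z ∈ S
        · rw [indicator_of_mem hxS, abs_of_pos (Real.exp_pos _), hE, neg_div]
          exact Real.exp_le_exp.2 (neg_le_neg (hlowA _ rfl hxS))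
        · rw [indicator_of_notMem hxS]; simpa using hE0.le
      have hGz : |G z| ≤ E * (1 + |a| * ν * |z| ^ 3) := by
        simp only [hG]
        rw [abs_mul, abs_of_pos (Real.exp_pos _)]
        gcongr
        refine (abs_sub _ _).trans ?_
        rw [abs_one, abs_mul, abs_mul, abs_of_pos hν, abs_pow]
      refine (abs_sub _ _).trans ?_
      calc |F z| + |G z| ≤ E * (2 * 1 + |a| * ν * |z| ^ 3) := by linarith
        _ ≤ E * (2 * (ν ^ 2 * z ^ 4 / δ ^ 4) + |a| / δ * ν ^ 2 * z ^ 4) := by gcongr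
        _ = (2 / δ ^ 4 + |a| / δ) * ν ^ 2 * (z ^ 4 * E) := by ring
        _ ≤ C₁ * ν ^ 2 * w z := by
            have e6 : 0 ≤ z ^ 6 := by positivity
            simp only [hw]
            gcongr
            · rw [hC₁]
              have : 0 ≤ (|a| + K) ^ 2 := by positivity
              linarith
            · linarith
  have hFmeas : AEStronglyMeasurable F := by
    have : Measurable (S.indicator (fun x => Real.exp (-f x / ν ^ 2))) := by
      refine Measurable.indicator ?_ hS
      have := hf.continuous
      fun_prop
    exact (this.comp (by fun_prop : Measurable fun z : ℝ => x₀ + ν * z)).aestronglyMeasurable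
  have hDint : Integrable (fun z => F z - G z) := by
    refine (hwint.const_mul (C₁ * ν ^ 2)).mono' (hFmeas.sub hGint.1) (ae_of_all _ hpt)
  have hdiff : |∫ z, F z - G z| ≤ C₁ * ν ^ 2 * ∫ z, w z := by
    rw [← integral_const_mul]
    exact norm_integral_le_of_norm_le (hwint.const_mul _)
      (ae_of_all _ (show ∀ z, ‖F z - G z‖ ≤ C₁ * ν ^ 2 * w z from hpt))
  have hFint : Integrable F := by
    refine (hDint.add hGint).congr (ae_of_all _ fun z => ?_)
    simp
  rw [integral_sub hFint hGint, hGval] at hdiff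
  rw [hint]
  have e : ν * (∫ z, F z) * (om / ν) - 1 = ((∫ z, F z) - 1 / om) * om := by field_simp
  rw [e, abs_mul, abs_of_pos hom]
  calc _ ≤ C₁ * ν ^ 2 * (∫ z, w z) * om := by gcongr
    _ = C₁ * (∫ z, w z) * om * ν ^ 2 := by ring
    _ ≤ _ := by gcongr; linarith

/-- A function that is positive away from a nondegenerate zero and grows quadratically is
bounded below by a multiple of the square of the distance. -/
lemma exists_quadratic_lower_bound {f : ℝ → ℝ} (hf : ContDiff ℝ ∞ f) {x₀ : ℝ} (h0 : f x₀ = 0)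
    (h1 : deriv f x₀ = 0) (h2 : 0 < deriv (deriv f) x₀) {S : Set ℝ} (hS : IsClosed S)
    (hpos : ∀ x ∈ S, x ≠ x₀ → 0 < f x) {c₀ R : ℝ} (hc₀ : 0 < c₀)
    (hR : ∀ x ∈ S, R ≤ |x - x₀| → c₀ * (x - x₀) ^ 2 ≤ f x) :
    ∃ c > 0, ∀ x ∈ S, c * (x - x₀) ^ 2 ≤ f x := by
  obtain ⟨a, K, δ₀, hK, hδ₀, hT⟩ := exists_taylor_three_bound hf h0 h1
  set b := deriv (deriv f) x₀ / 2 with hb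
  have hbpos : 0 < b := by positivity
  -- The last entry lets the cubic and quartic terms consume at most half of `b y²`.
  set δ := min (min (δ₀ / 2) 1) (b / (2 * (|a| + K + 1))) with hδ
  have hδpos : 0 < δ := by positivity
  have hδ0 : δ < δ₀ := by
    have : δ ≤ δ₀ / 2 := (min_le_left _ _).trans (min_le_left _ _)
    linarith
  have hδ1 : δ ≤ 1 := (min_le_left _ _).trans (min_le_right _ _)
  have hδb : (|a| + K) * δ ≤ b / 2 := by
    have : δ ≤ b / (2 * (|a| + K + 1)) := min_le_right _ _
    rw [le_div_iff₀ (by positivity)] at this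
    nlinarith
  have hnear : ∀ x, |x - x₀| ≤ δ → b / 2 * (x - x₀) ^ 2 ≤ f x := by
    intro x hx
    have h := hT (x - x₀) (hx.trans_lt hδ0)
    rw [add_sub_cancel] at h
    set y := x - x₀
    have hy4 : y ^ 4 = |y| ^ 4 := by
      rw [← abs_pow]; exact (abs_of_nonneg (by positivity)).symm
    have hy3 : |a * y ^ 3| = |a| * |y| ^ 3 := by rw [abs_mul, abs_pow]
    have hya : -(|a| * |y| ^ 3) ≤ a * y ^ 3 := by rw [← hy3]; exact neg_abs_le _
    have h' := (abs_le.1 h).1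
    have hy2 : y ^ 2 = |y| ^ 2 := (sq_abs y).symm
    have h5 : |a| * |y| ^ 3 + K * y ^ 4 ≤ b / 2 * y ^ 2 := by
      rw [hy4, hy2]
      have h6 : K * |y| ^ 4 ≤ K * |y| ^ 3 := by
        gcongr K * ?_
        exact pow_le_pow_of_le_one (abs_nonneg _) (hx.trans hδ1) (by norm_num)
      calc |a| * |y| ^ 3 + K * |y| ^ 4 ≤ (|a| + K) * |y| * |y| ^ 2 := by linarith
        _ ≤ (|a| + K) * δ * |y| ^ 2 := by gcongr
        _ ≤ _ := by gcongr
    linarith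
  set R' := max R 1 with hR'
  have hR'1 : 1 ≤ R' := le_max_right _ _
  -- In the intermediate annulus `f` has a positive minimum by compactness, and `(x - x₀)² ≤ R'²`
  -- there.
  have hcomp : IsCompact (S ∩ {x | δ ≤ |x - x₀|} ∩ Metric.closedBall x₀ R') := by
    refine IsCompact.inter_left (isCompact_closedBall _ _) (hS.inter ?_)
    exact isClosed_le continuous_const (by fun_prop)
  obtain ⟨m, hm, hmle⟩ : ∃ m > 0, ∀ x ∈ S ∩ {x | δ ≤ |x - x₀|} ∩ Metric.closedBall x₀ R', m ≤ f x := by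
    rcases (S ∩ {x | δ ≤ |x - x₀|} ∩ Metric.closedBall x₀ R').eq_empty_or_nonempty with he | hne
    · exact ⟨1, one_pos, by simp [he]⟩
    · obtain ⟨x, hx, hmin⟩ := hcomp.exists_isMinOn hne hf.continuous.continuousOn
      refine ⟨f x, hpos x hx.1.1 ?_, fun y hy => hmin hy⟩
      rintro rfl
      have := hx.1.2
      simp at this
      linarith
  refine ⟨min (min (b / 2) c₀) (m / R' ^ 2), by positivity, fun x hx => ?_⟩
  have hsq := sq_nonneg (x - x₀)
  rcases le_or_gt |x - x₀| δ with h | h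
  · refine le_trans ?_ (hnear x h)
    gcongr
    exact (min_le_left _ _).trans (min_le_left _ _)
  · rcases le_or_gt |x - x₀| R' with h' | h'
    · refine le_trans ?_ (hmle x ⟨⟨hx, h.le⟩, by rw [Metric.mem_closedBall, Real.dist_eq]; exact h'⟩)
      calc _ ≤ m / R' ^ 2 * R' ^ 2 := by
            rw [← sq_abs (x - x₀)]
            gcongr
            exact min_le_right _ _
        _ = m := by field_simp
    · refine le_trans ?_ (hR x hx ((le_max_left _ _).trans h'.le))
      gcongr
      exact (min_le_left _ _).trans (min_le_right _ _)

/-! ### Elementary properties of double-well potentials -/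

namespace DoubleWell

variable (W : DoubleWell)

lemma differentiable_H : Differentiable ℝ W.H := W.smooth.differentiable (by simp)

lemma contDiff_deriv_H : ContDiff ℝ ∞ (deriv W.H) := by
  have := W.smooth
  rw [contDiff_infty_iff_deriv] at this
  exact this.2

lemma continuous_deriv_H : Continuous (deriv W.H) := W.contDiff_deriv_H.continuous

lemma hasDerivAt_H (p : ℝ) : HasDerivAt W.H (deriv W.H p) p := (W.differentiable_H p).hasDerivAt

lemma lt_H_of_ne (s : Well) {p : ℝ} (hp : p ∈ closure s.phase) (hne : p ≠ W.P s) :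
    W.H (W.P s) < W.H p := by
  cases s with
  | minus =>
    have hp' : p ≤ 0 := by simpa [Well.phase] using hp
    rcases lt_or_gt_of_ne hne with h | h
    · exact W.anti_left (mem_Iic.2 h.le) (mem_Iic.2 le_rfl) h
    · exact W.mono_left ⟨le_rfl, W.P_minus_neg.le⟩ ⟨h.le, hp'⟩ h
  | plus =>
    have hp' : 0 ≤ p := by simpa [Well.phase] using hp
    rcases lt_or_gt_of_ne hne with h | h
    · exact W.anti_right ⟨hp', h.le⟩ ⟨W.P_plus_pos.le, le_rfl⟩ h
    · exact W.mono_right (mem_Ici.2 le_rfl) (mem_Ici.2 h.le) h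

lemma P_mem_phase (s : Well) : W.P s ∈ s.phase := by
  cases s with
  | minus => exact W.P_minus_neg
  | plus => exact W.P_plus_pos

lemma isOpen_phase (s : Well) : IsOpen s.phase := by
  cases s with
  | minus => exact isOpen_Iio
  | plus => exact isOpen_Ioi

lemma measurableSet_phase (s : Well) : MeasurableSet s.phase := (isOpen_phase s).measurableSet

lemma phase_mem_nhds (s : Well) : s.phase ∈ 𝓝 (W.P s) := (isOpen_phase s).mem_nhds (W.P_mem_phase s)

lemma deriv_H_P (s : Well) : deriv W.H (W.P s) = 0 := by
  refine IsLocalMin.deriv_eq_zero ?_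
  filter_upwards [W.phase_mem_nhds s] with p hp
  by_cases h : p = W.P s
  · rw [h]
  · exact (W.lt_H_of_ne s (subset_closure hp) h).le

lemma H_neg {p : ℝ} (hp : p ∈ Icc (W.P .minus) (W.P .plus)) (hne : p ≠ 0) : W.H p < 0 := by
  rw [← W.H_zero]
  rcases lt_or_gt_of_ne hne with h | h
  · exact W.mono_left ⟨hp.1, h.le⟩ ⟨W.P_minus_neg.le, le_rfl⟩ h
  · exact W.anti_right ⟨le_rfl, W.P_plus_pos.le⟩ ⟨h.le, hp.2⟩ h

lemma deriv_H_zero : deriv W.H 0 = 0 := by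
  refine IsLocalMax.deriv_eq_zero ?_
  filter_upwards [Icc_mem_nhds W.P_minus_neg W.P_plus_pos] with p hp
  by_cases h : p = 0
  · rw [h]
  · rw [W.H_zero]; exact (W.H_neg hp h).le

lemma h_pos (s : Well) : 0 < W.h s := by
  have : W.H (W.P s) < W.H 0 := by
    refine W.lt_H_of_ne s ?_ ?_
    · cases s <;> simp [Well.phase]
    · cases s
      · exact W.P_minus_neg.ne'
      · exact W.P_plus_pos.ne
  rw [W.H_zero] at this
  simpa [h] using this

lemma omega_pos (s : Well) : 0 < W.omega s := by
  have := W.nondegenerate_P s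
  have := Real.pi_pos
  exact Real.sqrt_pos.2 (by positivity)

lemma omegaZero_pos : 0 < W.omegaZero := by
  have := neg_pos.2 W.nondegenerate_zero
  have := Real.pi_pos
  exact Real.sqrt_pos.2 (by positivity)

lemma deriv_deriv_H_P (s : Well) : deriv (deriv W.H) (W.P s) = 2 * Real.pi * W.omega s ^ 2 := by
  have := W.nondegenerate_P s
  have := Real.pi_pos
  rw [omega, Real.sq_sqrt (by positivity)]
  field_simp

lemma deriv_deriv_H_zero : -deriv (deriv W.H) 0 = 2 * Real.pi * W.omegaZero ^ 2 := by
  have := neg_pos.2 W.nondegenerate_zero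
  have := Real.pi_pos
  rw [omegaZero, Real.sq_sqrt (by positivity)]
  field_simp

lemma tau_pos (ν : ℝ) : 0 < W.tau ν := by
  have := W.omegaZero_pos
  have := W.omega_pos .minus
  unfold tau; positivity

lemma gibbs_pos (ν p : ℝ) : 0 < W.gibbs ν p := Real.exp_pos _

lemma continuous_gibbs (ν : ℝ) : Continuous (W.gibbs ν) := by
  have := W.smooth.continuous
  unfold gibbs; fun_prop

lemma exists_well_lower_bound (s : Well) :
    ∃ c > 0, ∀ p ∈ closure s.phase, c * (p - W.P s) ^ 2 ≤ W.H p + W.h s := by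
  obtain ⟨c₀, hc₀, R, hR⟩ := W.growth
  have hf : ContDiff ℝ ∞ (fun p => W.H p + W.h s) := W.smooth.add contDiff_const
  have hd : deriv (fun p => W.H p + W.h s) = deriv W.H := by ext p; simp
  refine exists_quadratic_lower_bound (R := max R (|W.P s| + 1)) hf (by simp [h]) ?_ ?_ isClosed_closure ?_ hc₀ ?_
  · rw [hd]; exact W.deriv_H_P s
  · rw [hd]; exact W.nondegenerate_P s
  · intro p hp hne
    have := W.lt_H_of_ne s hp hne
    simp only [h]; linarith
  · intro p hp hle
    -- A point of the closed phase farther from the minimum than `|P s|` lies on the outer side of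
    -- it, so the growth of `H`, stated relative to `0`, can be used relative to `P s`.
    have habs : |p - W.P s| ≤ |p| := by
      have h1 : |W.P s| + 1 ≤ |p - W.P s| := (le_max_right _ _).trans hle
      cases s with
      | minus =>
        have hp' : p ≤ 0 := by simpa [Well.phase] using hp
        have := W.P_minus_neg
        rw [abs_of_neg this] at h1
        rw [abs_of_nonpos hp']
        rcases le_total p (W.P .minus) with h2 | h2
        · rw [abs_of_nonpos (by linarith)]; linarith
        · rw [abs_of_nonneg (by linarith)] at h1 ⊢; linarith
      | plus =>
        have hp' : 0 ≤ p := by simpa [Well.phase] using hp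
        have := W.P_plus_pos
        rw [abs_of_pos this] at h1
        rw [abs_of_nonneg hp']
        rcases le_total p (W.P .plus) with h2 | h2
        · rw [abs_of_nonpos (by linarith)] at h1 ⊢; linarith
        · rw [abs_of_nonneg (by linarith)]; linarith
    have h2 := (hR p (((le_max_left _ _).trans hle).trans habs)).1
    have h3 : (p - W.P s) ^ 2 ≤ p ^ 2 := sq_le_sq.2 habs
    have := W.h_pos s
    nlinarith

lemma gibbs_eq (ν : ℝ) (s : Well) (p : ℝ) :
    W.gibbs ν p = Real.exp (W.h s / ν ^ 2) * Real.exp (-(W.H p + W.h s) / ν ^ 2) := by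
  rw [gibbs, ← Real.exp_add]; congr 1; ring

lemma integrableOn_gibbs {ν : ℝ} (hν : 0 < ν) (s : Well) :
    IntegrableOn (W.gibbs ν) (closure s.phase) := by
  obtain ⟨c, hc, hlow⟩ := W.exists_well_lower_bound s
  have hg : Integrable (fun p : ℝ => Real.exp (W.h s / ν ^ 2)
      * Real.exp (-(c / ν ^ 2) * (p - W.P s) ^ 2)) :=
    ((integrable_exp_neg_mul_sq (b := c / ν ^ 2) (by positivity)).comp_sub_right (W.P s)).const_mul _
  refine Integrable.mono' hg.integrableOn (W.continuous_gibbs ν).aestronglyMeasurable ?_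
  refine (ae_restrict_iff' isClosed_closure.measurableSet).2 (ae_of_all _ fun p hp => ?_)
  rw [Real.norm_eq_abs, abs_of_pos (W.gibbs_pos ν p), W.gibbs_eq ν s]
  gcongr
  have := hlow p hp
  rw [neg_mul, neg_div, neg_le_neg_iff, div_mul_eq_mul_div]
  gcongr

lemma integrable_gibbs {ν : ℝ} (hν : 0 < ν) : Integrable (W.gibbs ν) := by
  have h1 := W.integrableOn_gibbs hν .minus
  have h2 := W.integrableOn_gibbs hν .plus
  simp only [Well.phase, closure_Iio, closure_Ioi] at h1 h2
  rw [← integrableOn_univ, ← Iic_union_Ici (a := (0 : ℝ))]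
  exact h1.union h2

lemma mu_pos {ν : ℝ} (hν : 0 < ν) (s : Well) : 0 < W.mu ν s := by
  have h1 := (W.integrable_gibbs hν).integrableOn (s := s.phase)
  rw [mu, setIntegral_pos_iff_support_of_nonneg_ae (ae_of_all _ fun p => (W.gibbs_pos ν p).le) h1]
  have : Function.support (W.gibbs ν) = univ := by
    ext p; simpa using (W.gibbs_pos ν p).ne'
  rw [this, univ_inter]
  exact (isOpen_phase s).measure_pos _ ⟨_, W.P_mem_phase s⟩

lemma P_minus_lt_P_plus : W.P .minus < W.P .plus := W.P_minus_neg.trans W.P_plus_pos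

lemma eta_eq (ν : ℝ) : W.eta ν = ∫ p in (W.P .minus)..(W.P .plus), 1 / W.gibbs ν p := by
  rw [eta, intervalIntegral.integral_of_le W.P_minus_lt_P_plus.le, integral_Ioc_eq_integral_Ioo]

lemma continuous_inv_gibbs (ν : ℝ) : Continuous fun p => 1 / W.gibbs ν p :=
  continuous_const.div (W.continuous_gibbs ν) fun p => (W.gibbs_pos ν p).ne'

lemma eta_pos (ν : ℝ) : 0 < W.eta ν := by
  rw [eta_eq]
  refine intervalIntegral.intervalIntegral_pos_of_pos ?_ ?_ W.P_minus_lt_P_plus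
  · exact (W.continuous_inv_gibbs ν).intervalIntegrable _ _
  · intro p; have := W.gibbs_pos ν p; positivity

/-! ### The elementary asymptotics -/

/-- Laplace's method for `H + h s`, which vanishes at its minimum over the phase; the factor `exp (h
s / ν²)` is split off. -/
lemma exists_mu_asymp (s : Well) : ∃ C > 0, ∀ ν : ℝ, 0 < ν → ν ≤ 1 →
    |W.mu ν s * (W.omega s / ν) * Real.exp (-W.h s / ν ^ 2) - 1| ≤ C * ν ^ 2 := by
  obtain ⟨c, hc, hlow⟩ := W.exists_well_lower_bound s
  have hf : ContDiff ℝ ∞ (fun p => W.H p + W.h s) := W.smooth.add contDiff_const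
  have hd : deriv (fun p => W.H p + W.h s) = deriv W.H := by ext p; simp
  obtain ⟨C, hC, hL⟩ := laplace_second_order hf (x₀ := W.P s) (by simp [h])
    (by rw [hd]; exact W.deriv_H_P s) (W.omega_pos s) (by rw [hd]; exact W.deriv_deriv_H_P s)
    (measurableSet_phase s) (W.phase_mem_nhds s) hc (fun p hp => hlow p (subset_closure hp))
  refine ⟨C, hC, fun ν hν hν1 => ?_⟩
  convert hL ν hν hν1 using 3
  have : W.mu ν s = Real.exp (W.h s / ν ^ 2)
      * ∫ p in s.phase, Real.exp (-(W.H p + W.h s) / ν ^ 2) := by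
    rw [mu, ← integral_const_mul]
    simp_rw [← W.gibbs_eq]
  rw [this]
  have e : Real.exp (W.h s / ν ^ 2) * Real.exp (-W.h s / ν ^ 2) = 1 := by
    rw [← Real.exp_add, ← add_div]; simp
  linear_combination (∫ p in s.phase, Real.exp (-(W.H p + W.h s) / ν ^ 2)) * (W.omega s / ν) * e

lemma exists_eta_asymp : ∃ C > 0, ∀ ν : ℝ, 0 < ν → ν ≤ 1 →
    |W.eta ν * (W.omegaZero / ν) - 1| ≤ C * ν ^ 2 := by
  have hf : ContDiff ℝ ∞ (fun p => -W.H p) := W.smooth.neg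
  have hd : deriv (fun p => -W.H p) = fun p => -deriv W.H p := by ext p; simp
  have hd2 : deriv (deriv (fun p => -W.H p)) 0 = -deriv (deriv W.H) 0 := by rw [hd]; simp
  have h0 : deriv (fun p => -W.H p) 0 = 0 := by rw [hd]; simp [W.deriv_H_zero]
  -- `R` is larger than the distance of any point of the interval from `0`, so the growth condition
  -- is vacuous.
  obtain ⟨c, hc, hlow⟩ := exists_quadratic_lower_bound (S := Icc (W.P .minus) (W.P .plus))
    (R := max (W.P .plus) (-W.P .minus) + 1) (c₀ := 1)
    hf (by simp [W.H_zero]) h0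
    (by rw [hd2]; exact neg_pos.2 W.nondegenerate_zero) isClosed_Icc
    (fun p hp hne => neg_pos.2 (W.H_neg hp hne)) one_pos
    (by
      intro p hp hle
      have : |p - 0| ≤ max (W.P .plus) (-W.P .minus) := by
        rw [sub_zero, abs_le]
        constructor
        · have := le_max_right (W.P .plus) (-W.P .minus)
          linarith [hp.1]
        · exact hp.2.trans (le_max_left _ _)
      linarith)
  obtain ⟨C, hC, hL⟩ := laplace_second_order hf (x₀ := 0) (by simp [W.H_zero]) h0 W.omegaZero_pos
    (by rw [hd2]; exact W.deriv_deriv_H_zero)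
    (S := Ioo (W.P .minus) (W.P .plus)) measurableSet_Ioo
    (Ioo_mem_nhds W.P_minus_neg W.P_plus_pos) hc (fun p hp => hlow p (Ioo_subset_Icc_self hp))
  refine ⟨C, hC, fun ν hν hν1 => ?_⟩
  convert hL ν hν hν1 using 5
  rw [eta]
  congr 1
  ext p
  rw [gibbs, one_div, ← Real.exp_neg]
  congr 1; ring

/-- The prefactors of `τ` are exactly those that normalize the Laplace integrals `μ₋` and `η`. -/
lemma one_add_theta_eq {ν : ℝ} (hν : 0 < ν) : 1 + W.theta ν
    = (W.mu ν .minus * (W.omega .minus / ν) * Real.exp (-W.h .minus / ν ^ 2))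
      * (W.eta ν * (W.omegaZero / ν)) := by
  rw [theta, tau]; field_simp; ring

lemma kappa_eq {ν : ℝ} (hν : 0 < ν) :
    W.kappa ν * (W.omega .minus / W.omega .plus) * Real.exp ((W.h .plus - W.h .minus) / ν ^ 2)
      = (W.mu ν .minus * (W.omega .minus / ν) * Real.exp (-W.h .minus / ν ^ 2))
        / (W.mu ν .plus * (W.omega .plus / ν) * Real.exp (-W.h .plus / ν ^ 2)) := by
  have h1 := (W.mu_pos hν .plus).ne'
  have h2 := (W.omega_pos .plus).ne'
  have e : Real.exp ((W.h .plus - W.h .minus) / ν ^ 2)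
      = Real.exp (-W.h .minus / ν ^ 2) / Real.exp (-W.h .plus / ν ^ 2) := by
    rw [← Real.exp_sub]; congr 1; ring
  rw [e, kappa]
  field_simp

/-- The extra conditions on `ν₀` make every single error at most `1 / 2`, which later bounds `1 + θ`
from below and `κ` and `μ±` from above. -/
theorem exists_elementary_asymptotics : ∃ C > 0, ∃ ν₀ > 0, ν₀ ≤ 1 ∧ C * ν₀ ^ 2 ≤ 1 / 2 ∧
    ∀ ν : ℝ, 0 < ν → ν < ν₀ → ∀ s : Well,
      |W.theta ν| + |W.eta ν * (W.omegaZero / ν) - 1|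
          + |W.mu ν s * (W.omega s / ν) * Real.exp (-W.h s / ν ^ 2) - 1|
          + |W.kappa ν * (W.omega .minus / W.omega .plus)
              * Real.exp ((W.h .plus - W.h .minus) / ν ^ 2) - 1|
          ≤ C * ν ^ 2 := by
  obtain ⟨C₁, hC₁, h1⟩ := W.exists_mu_asymp .minus
  obtain ⟨C₂, hC₂, h2⟩ := W.exists_mu_asymp .plus
  obtain ⟨C₃, hC₃, h3⟩ := W.exists_eta_asymp
  -- The four summands need at most `4 C₁ + 3 C₂ + 3 C₃`. The factor `6` also keeps the errors of
  -- `A` and `B` below `1 / 12`, hence `|A| ≤ 2` and `B ≥ 1 / 2`.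
  set C := 6 * (C₁ + C₂ + C₃) with hC
  have hCpos : 0 < C := by positivity
  set ν₀ := 1 / (C + 2) with hν₀
  have hν₀pos : 0 < ν₀ := by positivity
  have hν₀1 : ν₀ ≤ 1 := by rw [hν₀, div_le_one (by positivity)]; linarith
  have hCν₀ : C * ν₀ ^ 2 ≤ 1 / 2 := by
    rw [hν₀, div_pow, one_pow, mul_one_div, div_le_iff₀ (by positivity)]
    nlinarith
  refine ⟨C, hCpos, ν₀, hν₀pos, hν₀1, hCν₀, ?_⟩
  intro ν hν hνν s
  have hν1 : ν ≤ 1 := hνν.le.trans hν₀1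
  have hCν : C * ν ^ 2 ≤ 1 / 2 := by
    refine le_trans ?_ hCν₀; gcongr
  have a1 := h1 ν hν hν1
  have a2 := h2 ν hν hν1
  have a3 := h3 ν hν hν1
  have ht : W.theta ν = (1 + W.theta ν) - 1 := by ring
  rw [ht, W.one_add_theta_eq hν, W.kappa_eq hν]
  set A := W.mu ν .minus * (W.omega .minus / ν) * Real.exp (-W.h .minus / ν ^ 2) with hA
  set B := W.mu ν .plus * (W.omega .plus / ν) * Real.exp (-W.h .plus / ν ^ 2) with hB
  set E := W.eta ν * (W.omegaZero / ν) with hE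
  have hν2 : 0 < ν ^ 2 := by positivity
  have c1 : C₁ * ν ^ 2 ≤ 1 / 12 := by nlinarith
  have c2 : C₂ * ν ^ 2 ≤ 1 / 12 := by nlinarith
  have hthe : |A * E - 1| ≤ 2 * C₃ * ν ^ 2 + C₁ * ν ^ 2 := by
    have : A * E - 1 = A * (E - 1) + (A - 1) := by ring
    rw [this]
    refine (abs_add_le _ _).trans (add_le_add ?_ a1)
    rw [abs_mul]
    have hA2 : |A| ≤ 2 := by
      have := abs_le.1 (a1.trans c1)
      rw [abs_le]; constructor <;> linarith
    calc |A| * |E - 1| ≤ 2 * (C₃ * ν ^ 2) := by gcongr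
      _ = _ := by ring
  have hkap : |A / B - 1| ≤ 2 * (C₁ * ν ^ 2 + C₂ * ν ^ 2) := by
    have hB2 : 1 / 2 ≤ B := by
      have := abs_le.1 (a2.trans c2)
      linarith
    have hB0 : 0 < B := by linarith
    have : A / B - 1 = ((A - 1) - (B - 1)) / B := by field_simp; ring
    rw [this, abs_div, abs_of_pos hB0, div_le_iff₀ hB0]
    have h4 := (abs_sub (A - 1) (B - 1)).trans (add_le_add a1 a2)
    have : 0 ≤ C₁ * ν ^ 2 + C₂ * ν ^ 2 := by positivity
    nlinarith
  have hs : |W.mu ν s * (W.omega s / ν) * Real.exp (-W.h s / ν ^ 2) - 1|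
      ≤ C₁ * ν ^ 2 + C₂ * ν ^ 2 := by
    have : 0 ≤ C₁ * ν ^ 2 := by positivity
    have : 0 ≤ C₂ * ν ^ 2 := by positivity
    cases s
    · exact a1.trans (by linarith)
    · exact a2.trans (by linarith)
  have e : C * ν ^ 2 = 6 * (C₁ * ν ^ 2 + C₂ * ν ^ 2 + C₃ * ν ^ 2) := by rw [hC]; ring
  rw [e]
  have : 0 ≤ C₁ * ν ^ 2 := by positivity
  have : 0 ≤ C₂ * ν ^ 2 := by positivity
  have : 0 ≤ C₃ * ν ^ 2 := by positivity
  linarith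

end DoubleWell

/-! ### Calculus on the half space of positive times -/

/-- The half space `(0, ∞) × ℝ`. -/
def positiveTimes : Set (ℝ × ℝ) := Ioi 0 ×ˢ univ

lemma isOpen_positiveTimes : IsOpen positiveTimes := isOpen_Ioi.prod isOpen_univ

section PositiveTimes

variable {F : ℝ → ℝ → ℝ}

/-- Freezing the time variable below `s` produces a globally continuous function, as needed for
integrals depending on a parameter. -/
lemma ContinuousOn.continuous_delayed (hF : ContinuousOn (Function.uncurry F) positiveTimes)
    {s : ℝ} (hs : 0 < s) : Continuous (Function.uncurry fun r p => F (max r s) p) := by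
  have h : Continuous fun x : ℝ × ℝ => (max x.1 s, x.2) := by fun_prop
  exact hF.comp_continuous h fun x => ⟨lt_max_of_lt_right hs, mem_univ _⟩

lemma ContinuousOn.continuous_slice (hF : ContinuousOn (Function.uncurry F) positiveTimes)
    {t : ℝ} (ht : 0 < t) : Continuous (F t) :=
  hF.comp_continuous (f := fun p => (t, p)) (by fun_prop) fun _ => ⟨ht, mem_univ _⟩

lemma ContinuousOn.continuousOn_time (hF : ContinuousOn (Function.uncurry F) positiveTimes)
    (p : ℝ) : ContinuousOn (fun t => F t p) (Ioi 0) :=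
  hF.comp (f := fun t => (t, p)) (by fun_prop) fun _ ht => ⟨ht, mem_univ _⟩

lemma ContinuousOn.continuousOn_intervalIntegral
    (hF : ContinuousOn (Function.uncurry F) positiveTimes) (a b : ℝ) :
    ContinuousOn (fun r => ∫ p in a..b, F r p) (Ioi 0) := by
  intro r hr
  have hr' : 0 < r := hr
  have hc := intervalIntegral.continuous_parametric_intervalIntegral_of_continuous'
    (μ := volume) (hF.continuous_delayed (half_pos hr')) a b
  refine ContinuousAt.continuousWithinAt (hc.continuousAt.congr ?_)
  filter_upwards [Ioi_mem_nhds (half_lt_self hr')] with x hx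
  rw [max_eq_left (le_of_lt hx)]

lemma uIcc_subset_Ioi {s t : ℝ} (hs : 0 < s) (ht : 0 < t) : uIcc s t ⊆ Ioi 0 :=
  fun _ hx => lt_of_lt_of_le (lt_min hs ht) hx.1

lemma ContinuousOn.intervalIntegrable_Ioi {f : ℝ → ℝ} (hf : ContinuousOn f (Ioi 0)) {s t : ℝ}
    (hs : 0 < s) (ht : 0 < t) : IntervalIntegrable f volume s t :=
  (hf.mono (uIcc_subset_Ioi hs ht)).intervalIntegrable

/-- The fundamental theorem in time for each `p`, followed by Fubini on a compact rectangle; no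
differentiation under the integral is required. -/
lemma integral_sub_eq_integral_integral_deriv {f : ℝ → ℝ → ℝ}
    (hf : ContinuousOn (Function.uncurry f) positiveTimes)
    (hF : ContinuousOn (Function.uncurry F) positiveTimes)
    (hd : ∀ r, 0 < r → ∀ p, HasDerivAt (fun x => f x p) (F r p) r)
    {s t : ℝ} (hs : 0 < s) (ht : 0 < t) (a b : ℝ) :
    (∫ p in a..b, f t p) - ∫ p in a..b, f s p = ∫ r in s..t, ∫ p in a..b, F r p := by
  rw [← intervalIntegral.integral_sub
    ((hf.continuous_slice ht).intervalIntegrable _ _) ((hf.continuous_slice hs).intervalIntegrable _ _)]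
  have h1 : ∀ p, f t p - f s p = ∫ r in s..t, F r p := fun p =>
    (intervalIntegral.integral_eq_sub_of_hasDerivAt
      (fun r hr => hd r (uIcc_subset_Ioi hs ht hr) p)
      ((hF.continuousOn_time p).intervalIntegrable_Ioi hs ht)).symm
  simp_rw [h1]
  rw [intervalIntegral_intervalIntegral_swap]
  have hK : IntegrableOn (Function.uncurry F) (uIcc s t ×ˢ uIcc a b) :=
    (hF.mono (prod_mono (uIcc_subset_Ioi hs ht) (subset_univ _))).integrableOn_compact
      (isCompact_uIcc.prod isCompact_uIcc)
  exact (hK.mono_set (prod_mono uIoc_subset_uIcc uIoc_subset_uIcc)).swap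

lemma ContinuousOn.uncurry_mul {G : ℝ → ℝ → ℝ}
    (hF : ContinuousOn (Function.uncurry F) positiveTimes)
    (hG : ContinuousOn (Function.uncurry G) positiveTimes) :
    ContinuousOn (Function.uncurry fun r p => F r p * G r p) positiveTimes :=
  hF.mul hG

lemma ContinuousOn.uncurry_pow (hF : ContinuousOn (Function.uncurry F) positiveTimes) (n : ℕ) :
    ContinuousOn (Function.uncurry fun r p => F r p ^ n) positiveTimes :=
  hF.pow n

end PositiveTimes

/-! ### Renormalized solutions of the Fokker--Planck equation -/

/-- A nonnegative classical solution `u` of `σ γ ∂ₜu = ∂ₚ(γ ∂ₚu)` for positive times, where `γ₁`,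
`ut` and `up` are the derivatives `γ'`, `∂ₜu` and `∂ₚu`. -/
structure GibbsFlow (σ : ℝ) (γ γ₁ : ℝ → ℝ) (u ut up : ℝ → ℝ → ℝ) : Prop where
  hasDerivAt_weight : ∀ p, HasDerivAt γ (γ₁ p) p
  continuous_deriv_weight : Continuous γ₁
  nonneg : ∀ t, 0 < t → ∀ p, 0 ≤ u t p
  hasDerivAt_time : ∀ t, 0 < t → ∀ p, HasDerivAt (fun x => u x p) (ut t p) t
  hasDerivAt_space : ∀ t, 0 < t → ∀ p, HasDerivAt (u t) (up t p) p
  equation : ∀ t, 0 < t → ∀ p, HasDerivAt (fun q => γ q * up t q) (σ * γ p * ut t p) p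
  continuousOn : ContinuousOn (Function.uncurry u) positiveTimes
  continuousOn_time : ContinuousOn (Function.uncurry ut) positiveTimes
  continuousOn_space : ContinuousOn (Function.uncurry up) positiveTimes

/-- A twice continuously differentiable function on `[0, ∞)` with its first two derivatives. -/
structure Renormalization (Φ Φ₁ Φ₂ : ℝ → ℝ) : Prop where
  hasDerivAt : ∀ v, 0 ≤ v → HasDerivAt Φ (Φ₁ v) v
  hasDerivAt_deriv : ∀ v, 0 ≤ v → HasDerivAt Φ₁ (Φ₂ v) v
  continuousOn : ContinuousOn Φ₂ (Ici 0)

/-- This choice turns the general balance into the linear one for the mass. -/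
lemma Renormalization.id : Renormalization (fun v => v) (fun _ => 1) (fun _ => 0) :=
  ⟨fun v _ => hasDerivAt_id v, fun v _ => hasDerivAt_const v 1, continuousOn_const⟩

namespace GibbsFlow

variable {σ : ℝ} {γ γ₁ : ℝ → ℝ} {u ut up : ℝ → ℝ → ℝ} {Φ Φ₁ Φ₂ g g₁ g₂ : ℝ → ℝ}

lemma continuous_weight (h : GibbsFlow σ γ γ₁ u ut up) : Continuous γ :=
  continuous_iff_continuousAt.2 fun p => (h.hasDerivAt_weight p).continuousAt

lemma continuousOn_comp (h : GibbsFlow σ γ γ₁ u ut up) {Ψ : ℝ → ℝ} (hΨ : ContinuousOn Ψ (Ici 0)) :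
    ContinuousOn (Function.uncurry fun t p => Ψ (u t p)) positiveTimes :=
  hΨ.comp h.continuousOn fun x hx => h.nonneg x.1 hx.1 x.2

lemma continuousOn_weighted {v : ℝ → ℝ → ℝ} {f : ℝ → ℝ} (hf : Continuous f)
    (hv : ContinuousOn (Function.uncurry v) positiveTimes) :
    ContinuousOn (Function.uncurry fun t p => f p * v t p) positiveTimes :=
  (hf.comp continuous_snd).continuousOn.mul hv

/-- The balance of `∫ g γ Φ(u)` over a compact interval. -/
theorem local_identity (h : GibbsFlow σ γ γ₁ u ut up) (hΦ : Renormalization Φ Φ₁ Φ₂)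
    (hg : ∀ p, HasDerivAt g (g₁ p) p) (hg₁ : ∀ p, HasDerivAt g₁ (g₂ p) p) (hg₂ : Continuous g₂)
    {s t : ℝ} (hs : 0 < s) (ht : 0 < t) (a b : ℝ) :
    σ * ((∫ p in a..b, g p * γ p * Φ (u t p)) - ∫ p in a..b, g p * γ p * Φ (u s p))
      = ∫ r in s..t,
        ((g b * Φ₁ (u r b) * (γ b * up r b) - g₁ b * γ b * Φ (u r b))
          - (g a * Φ₁ (u r a) * (γ a * up r a) - g₁ a * γ a * Φ (u r a))
          + (∫ p in a..b, (g₂ p * γ p + g₁ p * γ₁ p) * Φ (u r p))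
          - ∫ p in a..b, g p * (Φ₂ (u r p) * (γ p * up r p ^ 2))) := by
  have cg : Continuous g := continuous_iff_continuousAt.2 fun p => (hg p).continuousAt
  have cg₁ : Continuous g₁ := continuous_iff_continuousAt.2 fun p => (hg₁ p).continuousAt
  have cγ := h.continuous_weight
  have cγ₁ := h.continuous_deriv_weight
  have cΦ : ContinuousOn Φ (Ici 0) := fun v hv => (hΦ.hasDerivAt v hv).continuousAt.continuousWithinAt
  have cΦ₁ : ContinuousOn Φ₁ (Ici 0) :=
    fun v hv => (hΦ.hasDerivAt_deriv v hv).continuousAt.continuousWithinAt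
  have cut : ContinuousOn (Function.uncurry fun r p => g p * γ p * (Φ₁ (u r p) * ut r p)) positiveTimes :=
    continuousOn_weighted (f := fun p => g p * γ p) (cg.mul cγ) ((h.continuousOn_comp cΦ₁).mul h.continuousOn_time)
  rw [integral_sub_eq_integral_integral_deriv (F := fun r p => g p * γ p * (Φ₁ (u r p) * ut r p))
    (f := fun r p => g p * γ p * Φ (u r p))
    (continuousOn_weighted (f := fun p => g p * γ p) (cg.mul cγ) (h.continuousOn_comp cΦ)) cut
    (fun r hr p => ((hΦ.hasDerivAt _ (h.nonneg r hr p)).comp r (h.hasDerivAt_time r hr p)).const_mul _)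
    hs ht, ← intervalIntegral.integral_const_mul]
  refine intervalIntegral.integral_congr fun r hr => ?_
  have hr0 : 0 < r := uIcc_subset_Ioi hs ht hr
  have c0 := (continuousOn_weighted (f := fun p => g₂ p * γ p + g₁ p * γ₁ p)
    ((hg₂.mul cγ).add (cg₁.mul cγ₁))
    (h.continuousOn_comp cΦ)).continuous_slice hr0
  have c1 := (continuousOn_weighted (v := fun r p => Φ₂ (u r p) * (γ p * up r p ^ 2)) cg ((h.continuousOn_comp hΦ.continuousOn).uncurry_mul
    (continuousOn_weighted (v := fun r p => up r p ^ 2) cγ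
      (h.continuousOn_space.uncurry_pow 2)))).continuous_slice hr0
  have c2 := cut.continuous_slice hr0
  -- The two terms `g' Φ'(u) γ ∂ₚu` cancel, so integrating this derivative exchanges the time
  -- derivative for boundary terms, the generator applied to `g`, and the dissipation.
  have hder : ∀ p, HasDerivAt
      (fun p => g p * Φ₁ (u r p) * (γ p * up r p) - g₁ p * γ p * Φ (u r p))
      (g p * (Φ₂ (u r p) * (γ p * up r p ^ 2)) + σ * (g p * γ p * (Φ₁ (u r p) * ut r p))
        - (g₂ p * γ p + g₁ p * γ₁ p) * Φ (u r p)) p := by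
    intro p
    have hu := h.hasDerivAt_space r hr0 p
    have d1 := (hΦ.hasDerivAt_deriv _ (h.nonneg r hr0 p)).comp p hu
    have d0 := (hΦ.hasDerivAt _ (h.nonneg r hr0 p)).comp p hu
    have := (((hg p).mul d1).mul (h.equation r hr0 p)).sub
      (((hg₁ p).mul (h.hasDerivAt_weight p)).mul d0)
    convert! this using 1
    simp only [Function.comp_apply, Pi.mul_apply]
    ring
  have hftc := intervalIntegral.integral_eq_sub_of_hasDerivAt (a := a) (b := b) (fun p _ => hder p)
    (((c1.add (c2.const_mul σ)).sub c0).intervalIntegrable _ _)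
  have c12 : Continuous fun p => g p * (Φ₂ (u r p) * (γ p * up r p ^ 2))
      + σ * (g p * γ p * (Φ₁ (u r p) * ut r p)) := c1.add (c2.const_mul σ)
  have hsplit : (∫ p in a..b, (g p * (Φ₂ (u r p) * (γ p * up r p ^ 2))
        + σ * (g p * γ p * (Φ₁ (u r p) * ut r p)) - (g₂ p * γ p + g₁ p * γ₁ p) * Φ (u r p)))
      = (∫ p in a..b, g p * (Φ₂ (u r p) * (γ p * up r p ^ 2)))
        + σ * (∫ p in a..b, g p * γ p * (Φ₁ (u r p) * ut r p))
        - ∫ p in a..b, (g₂ p * γ p + g₁ p * γ₁ p) * Φ (u r p) := by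
    rw [intervalIntegral.integral_sub (c12.intervalIntegrable _ _)
      (c0.intervalIntegrable _ _), intervalIntegral.integral_add (c1.intervalIntegrable _ _)
      ((c2.const_mul σ).intervalIntegrable _ _), intervalIntegral.integral_const_mul]
  rw [hsplit] at hftc
  linarith

end GibbsFlow

/-! ### Polynomial cutoffs -/

/-- The cutoff `(1 - ((p - c) / M)²)²`, to be used on `[c - M, c + M]`. -/
noncomputable def cutoff (c M p : ℝ) : ℝ := (1 - ((p - c) / M) ^ 2) ^ 2

/-- The derivative of `cutoff`. -/
noncomputable def cutoffDeriv (c M p : ℝ) : ℝ := -(4 / M ^ 2) * ((p - c) * (1 - ((p - c) / M) ^ 2))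

/-- The second derivative of `cutoff`. -/
noncomputable def cutoffDeriv₂ (c M p : ℝ) : ℝ := -(4 / M ^ 2) * (1 - 3 * ((p - c) / M) ^ 2)

section Cutoff

variable {c M p : ℝ}

lemma hasDerivAt_cutoff (c M p : ℝ) : HasDerivAt (cutoff c M) (cutoffDeriv c M p) p := by
  have h1 : HasDerivAt (fun p => (p - c) / M) (1 / M) p := ((hasDerivAt_id p).sub_const c).div_const M
  have := (((h1.pow 2).const_sub 1).pow 2)
  convert! this using 1
  simp only [cutoffDeriv, Pi.pow_apply]; push_cast; ring

lemma hasDerivAt_cutoffDeriv (c M p : ℝ) :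
    HasDerivAt (cutoffDeriv c M) (cutoffDeriv₂ c M p) p := by
  have h1 : HasDerivAt (fun p => (p - c) / M) (1 / M) p := ((hasDerivAt_id p).sub_const c).div_const M
  have := ((((hasDerivAt_id p).sub_const c).mul ((h1.pow 2).const_sub 1)).const_mul (-(4 / M ^ 2)))
  convert! this using 1
  simp only [cutoffDeriv₂, Pi.pow_apply, id]; push_cast; ring

lemma continuous_cutoff (c M : ℝ) : Continuous (cutoff c M) := by unfold cutoff; fun_prop

lemma continuous_cutoffDeriv₂ (c M : ℝ) : Continuous (cutoffDeriv₂ c M) := by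
  unfold cutoffDeriv₂; fun_prop

lemma sq_div_le_one (hM : 0 < M) (hp : p ∈ Icc (c - M) (c + M)) : ((p - c) / M) ^ 2 ≤ 1 := by
  rw [sq_le_one_iff_abs_le_one, abs_div, abs_of_pos hM, div_le_one hM, abs_le]
  constructor <;> linarith [hp.1, hp.2]

lemma cutoff_nonneg : 0 ≤ cutoff c M p := sq_nonneg _

lemma cutoff_le_one (hM : 0 < M) (hp : p ∈ Icc (c - M) (c + M)) : cutoff c M p ≤ 1 := by
  have := sq_div_le_one hM hp
  have := sq_nonneg ((p - c) / M)
  rw [cutoff, sq_le_one_iff_abs_le_one, abs_le]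
  constructor <;> linarith

lemma abs_cutoffDeriv_le (hM : 0 < M) (hp : p ∈ Icc (c - M) (c + M)) :
    |cutoffDeriv c M p| ≤ 4 / M ^ 2 * |p - c| := by
  have := sq_div_le_one hM hp
  have := sq_nonneg ((p - c) / M)
  rw [cutoffDeriv, abs_mul, abs_neg, abs_of_pos (by positivity : 0 < 4 / M ^ 2), abs_mul]
  have h1 : |1 - ((p - c) / M) ^ 2| ≤ 1 := by rw [abs_le]; constructor <;> linarith
  calc _ ≤ 4 / M ^ 2 * (|p - c| * 1) := by gcongr
    _ = _ := by ring

lemma abs_cutoffDeriv₂_le (hM : 0 < M) (hp : p ∈ Icc (c - M) (c + M)) :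
    |cutoffDeriv₂ c M p| ≤ 8 / M ^ 2 := by
  have := sq_div_le_one hM hp
  have := sq_nonneg ((p - c) / M)
  rw [cutoffDeriv₂, abs_mul, abs_neg, abs_of_pos (by positivity : 0 < 4 / M ^ 2)]
  have h1 : |1 - 3 * ((p - c) / M) ^ 2| ≤ 2 := by rw [abs_le]; constructor <;> linarith
  calc _ ≤ 4 / M ^ 2 * 2 := by gcongr
    _ = _ := by ring

lemma cutoff_self (c M : ℝ) : cutoff c M c = 1 := by simp [cutoff]

lemma cutoffDeriv_self (c M : ℝ) : cutoffDeriv c M c = 0 := by simp [cutoffDeriv]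

lemma cutoff_add (hM : 0 < M) : cutoff c M (c + M) = 0 := by simp [cutoff, hM.ne']

lemma cutoff_sub (hM : 0 < M) : cutoff c M (c - M) = 0 := by simp [cutoff, hM.ne']

lemma cutoffDeriv_add (hM : 0 < M) : cutoffDeriv c M (c + M) = 0 := by simp [cutoffDeriv, hM.ne']

lemma cutoffDeriv_sub (hM : 0 < M) : cutoffDeriv c M (c - M) = 0 := by
  simp [cutoffDeriv, hM.ne']

lemma tendsto_cutoff (c p : ℝ) : Tendsto (fun M => cutoff c M p) atTop (𝓝 1) := by
  have h : Tendsto (fun M : ℝ => (p - c) / M) atTop (𝓝 0) := tendsto_id.const_div_atTop _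
  simpa [cutoff] using (((h.pow 2).const_sub 1).pow 2)

/-- Dominated convergence. The indicator is essential, because the polynomial cutoff is unbounded
outside its interval. -/
lemma tendsto_setIntegral_cutoff_mul {f : ℝ → ℝ} {S : Set ℝ} (hf : IntegrableOn f S) (c : ℝ) :
    Tendsto (fun M => ∫ p in S, (Icc (c - M) (c + M)).indicator (fun p => cutoff c M p * f p) p)
      atTop (𝓝 (∫ p in S, f p)) := by
  refine tendsto_integral_filter_of_dominated_convergence (fun p => |f p|) ?_ ?_ hf.abs ?_
  · refine Eventually.of_forall fun M => ?_
    exact (((continuous_cutoff c M).aestronglyMeasurable).mul hf.1).indicator measurableSet_Icc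
  · filter_upwards [eventually_gt_atTop 0] with M hM
    refine ae_of_all _ fun p => ?_
    by_cases hp : p ∈ Icc (c - M) (c + M)
    · rw [indicator_of_mem hp, norm_mul, Real.norm_eq_abs, Real.norm_eq_abs, abs_of_nonneg cutoff_nonneg]
      exact mul_le_of_le_one_left (abs_nonneg _) (cutoff_le_one hM hp)
    · rw [indicator_of_notMem hp]; simp
  · refine ae_of_all _ fun p => ?_
    have := (tendsto_cutoff c p).mul_const (f p)
    rw [one_mul] at this
    refine this.congr' ?_
    filter_upwards [eventually_ge_atTop |p - c|] with M hM
    rw [indicator_of_mem]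
    have := abs_le.1 hM
    constructor <;> linarith

lemma tendsto_intervalIntegral_cutoff_mul {f : ℝ → ℝ} (hf : Integrable f) (c : ℝ) :
    Tendsto (fun M => ∫ p in (c - M)..(c + M), cutoff c M p * f p) atTop (𝓝 (∫ p, f p)) := by
  have := tendsto_setIntegral_cutoff_mul (S := univ) hf.integrableOn c
  rw [setIntegral_univ] at this
  refine this.congr' ?_
  filter_upwards [eventually_gt_atTop 0] with M hM
  rw [setIntegral_univ, integral_indicator measurableSet_Icc, integral_Icc_eq_integral_Ioc,
    intervalIntegral.integral_of_le (by linarith)]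

lemma tendsto_intervalIntegral_cutoff_mul_Ioi {f : ℝ → ℝ} {c : ℝ} (hf : IntegrableOn f (Ioi c)) :
    Tendsto (fun M => ∫ p in c..(c + M), cutoff c M p * f p) atTop (𝓝 (∫ p in Ioi c, f p)) := by
  refine (tendsto_setIntegral_cutoff_mul hf c).congr' ?_
  filter_upwards [eventually_gt_atTop 0] with M hM
  rw [setIntegral_indicator measurableSet_Icc, intervalIntegral.integral_of_le (by linarith)]
  congr 2
  ext p
  simp only [mem_inter_iff, mem_Ioi, mem_Icc, mem_Ioc]
  constructor
  · rintro ⟨h1, h2, h3⟩; exact ⟨h1, h3⟩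
  · rintro ⟨h1, h3⟩; exact ⟨h1, by linarith, h3⟩

end Cutoff

namespace DoubleWell

variable (W : DoubleWell)

/-! ### Solutions as Gibbs flows -/

/-- The relative density of `ρ` with respect to `z γ`. -/
noncomputable def relDensity (ν z : ℝ) (ρ : ℝ → ℝ → ℝ) (t p : ℝ) : ℝ := ρ t p / (z * W.gibbs ν p)

/-- The time derivative of `relDensity`. -/
noncomputable def relDensityTime (ν z : ℝ) (ρ : ℝ → ℝ → ℝ) (t p : ℝ) : ℝ :=
  deriv (fun s => ρ s p) t / (z * W.gibbs ν p)

/-- The space derivative of `relDensity`. -/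
noncomputable def relDensitySpace (ν z : ℝ) (ρ : ℝ → ℝ → ℝ) (t p : ℝ) : ℝ :=
  (deriv (ρ t) p + deriv W.H p * ρ t p / ν ^ 2) / (z * W.gibbs ν p)

variable {W} {ν z : ℝ} {ρ : ℝ → ℝ → ℝ}

lemma hasDerivAt_gibbs (ν p : ℝ) :
    HasDerivAt (W.gibbs ν) (-(deriv W.H p / ν ^ 2) * W.gibbs ν p) p := by
  have := (((W.hasDerivAt_H p).neg).div_const (ν ^ 2)).exp
  convert! this using 1
  simp only [gibbs, Pi.neg_apply]; ring

lemma mul_gibbs_mul_relDensity (hz : 0 < z) (t p : ℝ) :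
    z * W.gibbs ν p * W.relDensity ν z ρ t p = ρ t p := by
  have := (W.gibbs_pos ν p).ne'
  rw [relDensity]; field_simp

lemma hasDerivAt_div_gibbs (hz : 0 < z) {f : ℝ → ℝ} {p : ℝ} (hf : DifferentiableAt ℝ f p) :
    HasDerivAt (fun q => f q / (z * W.gibbs ν q))
      ((deriv f p + deriv W.H p * f p / ν ^ 2) / (z * W.gibbs ν p)) p := by
  have hγ := (W.gibbs_pos ν p).ne'
  have h1 := (hasDerivAt_gibbs (W := W) ν p).const_mul z
  have := hf.hasDerivAt.div h1 (by positivity)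
  convert! this using 1
  field_simp
  ring

namespace IsSolution

lemma differentiableAt_uncurry (h : W.IsSolution ν ρ) {t : ℝ} (ht : 0 < t) (p : ℝ) :
    DifferentiableAt ℝ (Function.uncurry ρ) (t, p) :=
  (h.regular.differentiableOn (by norm_num)).differentiableAt
    (isOpen_positiveTimes.mem_nhds ⟨ht, mem_univ _⟩)

lemma hasDerivAt_space (h : W.IsSolution ν ρ) {t : ℝ} (ht : 0 < t) (p : ℝ) :
    HasDerivAt (ρ t) (fderiv ℝ (Function.uncurry ρ) (t, p) (0, 1)) p :=
  (h.differentiableAt_uncurry ht p).hasFDerivAt.comp_hasDerivAt p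
    ((hasDerivAt_const p t).prodMk (hasDerivAt_id p))

lemma hasDerivAt_time (h : W.IsSolution ν ρ) {t : ℝ} (ht : 0 < t) (p : ℝ) :
    HasDerivAt (fun s => ρ s p) (fderiv ℝ (Function.uncurry ρ) (t, p) (1, 0)) t :=
  (h.differentiableAt_uncurry ht p).hasFDerivAt.comp_hasDerivAt (f := fun s => (s, p)) t
    ((hasDerivAt_id t).prodMk (hasDerivAt_const t p))

lemma continuousOn_fderiv (h : W.IsSolution ν ρ) :
    ContinuousOn (fderiv ℝ (Function.uncurry ρ)) positiveTimes :=
  h.regular.continuousOn_fderiv_of_isOpen isOpen_positiveTimes (by norm_num)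

lemma contDiff_slice (h : W.IsSolution ν ρ) {t : ℝ} (ht : 0 < t) : ContDiff ℝ 2 (ρ t) := by
  rw [← contDiffOn_univ]
  exact h.regular.comp (f := fun p => (t, p)) (contDiff_const.prodMk contDiff_id).contDiffOn
    fun _ _ => ⟨ht, mem_univ _⟩

lemma continuousOn_uncurry (h : W.IsSolution ν ρ) :
    ContinuousOn (Function.uncurry ρ) positiveTimes := h.regular.continuousOn

lemma continuousOn_deriv_time (h : W.IsSolution ν ρ) :
    ContinuousOn (Function.uncurry fun t p => deriv (fun s => ρ s p) t) positiveTimes :=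
  (h.continuousOn_fderiv.clm_apply continuousOn_const).congr
    fun x hx => (h.hasDerivAt_time hx.1 x.2).deriv

lemma continuousOn_deriv_space (h : W.IsSolution ν ρ) :
    ContinuousOn (Function.uncurry fun t p => deriv (ρ t) p) positiveTimes :=
  (h.continuousOn_fderiv.clm_apply continuousOn_const).congr
    fun x hx => (h.hasDerivAt_space hx.1 x.2).deriv

/-- Division by `z γ` puts the Fokker--Planck equation into divergence form. The choice `z = 1`
serves the mass balances, and `z = 1 / Z` the relative entropy. -/
theorem gibbsFlow (h : W.IsSolution ν ρ) (hν : 0 < ν) (hz : 0 < z) :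
    GibbsFlow (W.tau ν / ν ^ 2) (fun p => z * W.gibbs ν p)
      (fun p => z * (-(deriv W.H p / ν ^ 2) * W.gibbs ν p))
      (W.relDensity ν z ρ) (W.relDensityTime ν z ρ) (W.relDensitySpace ν z ρ) := by
  have hγ0 : ∀ p, z * W.gibbs ν p ≠ 0 := fun p => (mul_pos hz (W.gibbs_pos ν p)).ne'
  have cγ := W.continuous_gibbs ν
  have cH := W.continuous_deriv_H
  have cdiv : ∀ v : ℝ → ℝ → ℝ, ContinuousOn (Function.uncurry v) positiveTimes →
      ContinuousOn (Function.uncurry fun t p => v t p / (z * W.gibbs ν p)) positiveTimes := by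
    intro v hv
    exact hv.div (by fun_prop) fun x _ => hγ0 x.2
  refine ⟨fun p => (hasDerivAt_gibbs ν p).const_mul z, by fun_prop, ?_, ?_, ?_, ?_, ?_, ?_, ?_⟩
  · intro t ht p
    have := h.nonneg t ht.le p
    have := W.gibbs_pos ν p
    unfold relDensity; positivity
  · intro t ht p
    exact (h.hasDerivAt_time ht p).differentiableAt.hasDerivAt.div_const _
  · intro t ht p
    exact hasDerivAt_div_gibbs hz (h.hasDerivAt_space ht p).differentiableAt
  · intro t ht p
    have hd : DifferentiableAt ℝ (fun q => ν ^ 2 * deriv (ρ t) q + deriv W.H q * ρ t q) p := by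
      have h1 : ContDiff ℝ 1 (deriv (ρ t)) :=
        ((contDiff_succ_iff_deriv (n := 1)).1 (by exact_mod_cast h.contDiff_slice ht)).2.2
      have h2 : Differentiable ℝ (deriv (ρ t)) := h1.differentiable (by norm_num)
      have h3 : Differentiable ℝ (deriv W.H) := W.contDiff_deriv_H.differentiable (by simp)
      have h4 := (h.hasDerivAt_space ht p).differentiableAt
      exact ((h2 p).const_mul _).add ((h3 p).mul h4)
    have h5 := hd.hasDerivAt
    rw [← h.equation t ht p] at h5
    have h6 := h5.const_mul (1 / ν ^ 2)
    convert! h6 using 1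
    · ext q
      have := hγ0 q
      simp only [relDensitySpace]
      rw [mul_div_cancel₀ _ this]
      field_simp
    · have := (W.gibbs_pos ν p).ne'
      simp only [relDensityTime]
      field_simp
  · exact cdiv _ h.continuousOn_uncurry
  · exact cdiv _ h.continuousOn_deriv_time
  · refine cdiv _ ?_
    refine h.continuousOn_deriv_space.add (f := Function.uncurry fun t p => deriv (ρ t) p) ?_
    refine ContinuousOn.div_const (ContinuousOn.mul (f := fun x : ℝ × ℝ => deriv W.H x.2) ?_ h.continuousOn_uncurry) _
    exact (cH.comp continuous_snd).continuousOn

end IsSolution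

end DoubleWell

/-! ### Balances tested with cutoffs. -/

namespace GibbsFlow

variable {σ : ℝ} {γ γ₁ : ℝ → ℝ} {u ut up : ℝ → ℝ → ℝ} {Φ Φ₁ Φ₂ : ℝ → ℝ}

/-- The cutoff has double zeros at both ends of the interval, so every boundary term drops out. -/
lemma cutoff_identity (h : GibbsFlow σ γ γ₁ u ut up) (hΦ : Renormalization Φ Φ₁ Φ₂)
    {s t : ℝ} (hs : 0 < s) (ht : 0 < t) (c : ℝ) {M : ℝ} (hM : 0 < M) :
    σ * ((∫ p in (c - M)..(c + M), cutoff c M p * γ p * Φ (u t p))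
        - ∫ p in (c - M)..(c + M), cutoff c M p * γ p * Φ (u s p))
      = ∫ r in s..t,
        ((∫ p in (c - M)..(c + M), (cutoffDeriv₂ c M p * γ p + cutoffDeriv c M p * γ₁ p) * Φ (u r p))
          - ∫ p in (c - M)..(c + M), cutoff c M p * (Φ₂ (u r p) * (γ p * up r p ^ 2))) := by
  have := h.local_identity hΦ (hasDerivAt_cutoff c M) (hasDerivAt_cutoffDeriv c M)
    (continuous_cutoffDeriv₂ c M) hs ht (c - M) (c + M)
  simpa only [cutoff_add hM, cutoff_sub hM, cutoffDeriv_add hM, cutoffDeriv_sub hM, zero_mul,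
    sub_zero, zero_add] using this

/-- At its centre the cutoff has value `1` and slope `0`, so only the flux through `c` remains of
the boundary terms. -/
lemma cutoff_identity_right (h : GibbsFlow σ γ γ₁ u ut up)
    {s t : ℝ} (hs : 0 < s) (ht : 0 < t) (c : ℝ) {M : ℝ} (hM : 0 < M) :
    σ * ((∫ p in c..(c + M), cutoff c M p * γ p * u t p)
        - ∫ p in c..(c + M), cutoff c M p * γ p * u s p)
      = ∫ r in s..t, (-(γ c * up r c) +
          ∫ p in c..(c + M), (cutoffDeriv₂ c M p * γ p + cutoffDeriv c M p * γ₁ p) * u r p) := by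
  have := h.local_identity .id (hasDerivAt_cutoff c M) (hasDerivAt_cutoffDeriv c M)
    (continuous_cutoffDeriv₂ c M) hs ht c (c + M)
  simpa only [cutoff_add hM, cutoffDeriv_add hM, cutoff_self, cutoffDeriv_self, zero_mul,
    sub_zero, one_mul, mul_zero, intervalIntegral.integral_zero, zero_sub] using this

end GibbsFlow

namespace DoubleWell

variable {W : DoubleWell} {ν z : ℝ} {ρ : ℝ → ℝ → ℝ}

/-! ### There is no flux at infinity -/

/-- The drift points inwards outside `[P₋, P₊]`, where `p H'(p) ≥ 0`; the interval itself is compact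
and accounts for `B`. -/
lemma exists_mul_deriv_H_lower_bound (W : DoubleWell) :
    ∃ B, 0 ≤ B ∧ ∀ p, |p * deriv W.H p| - B ≤ p * deriv W.H p := by
  have hc : Continuous fun p => p * deriv W.H p := continuous_id.mul W.continuous_deriv_H
  obtain ⟨B, hB⟩ := (isCompact_Icc (a := W.P .minus) (b := W.P .plus)).exists_bound_of_continuousOn
    hc.continuousOn
  refine ⟨2 * max B 0, by positivity, fun p => ?_⟩
  have hB0 : 0 ≤ max B 0 := le_max_right _ _
  by_cases hp : p ∈ Icc (W.P .minus) (W.P .plus)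
  · have h1 : |p * deriv W.H p| ≤ max B 0 := (hB p hp).trans (le_max_left _ _)
    have := neg_abs_le (p * deriv W.H p)
    linarith
  · have : 0 ≤ p * deriv W.H p := by
      rw [mem_Icc, not_and_or, not_le, not_le] at hp
      rcases hp with hp | hp
      · refine mul_nonneg_of_nonpos_of_nonpos (hp.trans W.P_minus_neg).le ?_
        have := W.anti_left.antitoneOn.derivWithin_nonpos (x := p)
        rwa [derivWithin_of_mem_nhds (Iic_mem_nhds hp)] at this
      · refine mul_nonneg (W.P_plus_pos.trans hp).le ?_
        have := W.mono_right.monotoneOn.derivWithin_nonneg (x := p)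
        rwa [derivWithin_of_mem_nhds (Ici_mem_nhds hp)] at this
    rw [abs_of_nonneg this]; linarith

variable (W ν) in
/-- The backward generator `∂ₚ² - ν⁻² H' ∂ₚ` applied to the cutoff. -/
noncomputable def cutoffGen (c M p : ℝ) : ℝ :=
  cutoffDeriv₂ c M p - cutoffDeriv c M p * (deriv W.H p / ν ^ 2)

lemma continuous_cutoffGen (c M : ℝ) : Continuous (W.cutoffGen ν c M) := by
  have := W.continuous_deriv_H
  unfold cutoffGen cutoffDeriv₂ cutoffDeriv; fun_prop

lemma cutoffGen_mul (c M p : ℝ) :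
    cutoffDeriv₂ c M p * (z * W.gibbs ν p)
      + cutoffDeriv c M p * (z * (-(deriv W.H p / ν ^ 2) * W.gibbs ν p))
      = W.cutoffGen ν c M p * (z * W.gibbs ν p) := by
  rw [cutoffGen]; ring

namespace IsSolution

lemma intervalIntegral_le_one (h : W.IsSolution ν ρ) {t a b : ℝ} (ht : 0 ≤ t) (hab : a ≤ b) :
    ∫ p in a..b, ρ t p ≤ 1 := by
  rw [intervalIntegral.integral_of_le hab, ← h.mass_one t ht]
  exact setIntegral_le_integral (h.integrable t ht) (ae_of_all _ (h.nonneg t ht))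

lemma cutoff_balance (h : W.IsSolution ν ρ) (hν : 0 < ν) {s t : ℝ} (hs : 0 < s) (ht : 0 < t)
    (c : ℝ) {M : ℝ} (hM : 0 < M) :
    W.tau ν / ν ^ 2 * ((∫ p in (c - M)..(c + M), cutoff c M p * ρ t p)
        - ∫ p in (c - M)..(c + M), cutoff c M p * ρ s p)
      = ∫ r in s..t, ∫ p in (c - M)..(c + M), W.cutoffGen ν c M p * ρ r p := by
  have := (h.gibbsFlow hν one_pos).cutoff_identity .id hs ht c hM
  simpa only [cutoffGen_mul, mul_assoc (W.cutoffGen _ _ _ _), mul_assoc (cutoff _ _ _),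
    mul_gibbs_mul_relDensity one_pos, zero_mul, mul_zero, intervalIntegral.integral_zero,
    sub_zero] using this

lemma continuousOn_mul (h : W.IsSolution ν ρ) {f : ℝ → ℝ} (hf : Continuous f) :
    ContinuousOn (Function.uncurry fun r p => f p * ρ r p) positiveTimes :=
  GibbsFlow.continuousOn_weighted hf h.continuousOn_uncurry

/-- The flux in the bulk is negligible against the square of the radius. -/
theorem tendsto_bulk_flux (h : W.IsSolution ν ρ) (hν : 0 < ν) {s t : ℝ} (hs : 0 < s) (hst : s ≤ t) :
    Tendsto (fun L => (∫ r in s..t, ∫ p in (-L)..L, |p * deriv W.H p| * ρ r p) / L ^ 2)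
      atTop (𝓝 0) := by
  obtain ⟨B, hB0, hB⟩ := W.exists_mul_deriv_H_lower_bound
  have ht : 0 < t := hs.trans_le hst
  have cH : Continuous fun p => |p * deriv W.H p| := (continuous_id.mul W.continuous_deriv_H).abs
  have h2L : Tendsto (fun L : ℝ => 2 * L) atTop atTop := tendsto_id.const_mul_atTop two_pos
  -- `D L` is the change of the cut-off mass. Both integrals tend to the total mass `1`, so it
  -- vanishes in the limit; by the cutoff balance it equals the time integral of the generator
  -- tested against `ρ`.
  set D : ℝ → ℝ := fun L => W.tau ν / ν ^ 2 * ((∫ p in (0 - 2 * L)..(0 + 2 * L), cutoff 0 (2 * L) p * ρ t p)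
        - ∫ p in (0 - 2 * L)..(0 + 2 * L), cutoff 0 (2 * L) p * ρ s p) with hD
  have hDlim : Tendsto D atTop (𝓝 0) := by
    have h1 := ((tendsto_intervalIntegral_cutoff_mul (h.integrable t ht.le) 0).sub
      (tendsto_intervalIntegral_cutoff_mul (h.integrable s hs.le) 0)).const_mul (W.tau ν / ν ^ 2)
    rw [h.mass_one t ht.le, h.mass_one s hs.le, sub_self, mul_zero] at h1
    exact h1.comp h2L
  have hinv : Tendsto (fun L : ℝ => (t - s) * (2 + B / ν ^ 2) / L ^ 2) atTop (𝓝 0) :=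
    (tendsto_pow_atTop two_ne_zero).const_div_atTop _
  have hlim : Tendsto (fun L => 4 * ν ^ 2 / 3 * (D L + (t - s) * (2 + B / ν ^ 2) / L ^ 2)) atTop (𝓝 0) := by
    simpa using (hDlim.add hinv).const_mul (4 * ν ^ 2 / 3)
  refine tendsto_of_tendsto_of_tendsto_of_le_of_le' tendsto_const_nhds hlim ?_ ?_
  · filter_upwards [eventually_gt_atTop 0] with L hL
    refine div_nonneg (intervalIntegral.integral_nonneg hst fun r hr => ?_) (by positivity)
    refine intervalIntegral.integral_nonneg (by linarith) fun p _ => ?_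
    exact mul_nonneg (abs_nonneg _) (h.nonneg r (hs.le.trans hr.1) p)
  · filter_upwards [eventually_gt_atTop 0] with L hL
    have hM : 0 < 2 * L := by positivity
    have hbal := h.cutoff_balance hν hs ht 0 hM
    -- For a cutoff of radius `2L` the drift part of the generator is `(1 - (p / 2L)²) p H' / (ν²
    -- L²)`. The bracket is at least `3 / 4` on `[-L, L]`; elsewhere `p H'` is bounded below by `|p
    -- H'| - B`. The second derivative costs `2 / L²`.
    have hr : ∀ r ∈ Icc s t, 3 / (4 * ν ^ 2 * L ^ 2) * (∫ p in (-L)..L, |p * deriv W.H p| * ρ r p)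
          - (2 + B / ν ^ 2) / L ^ 2
        ≤ ∫ p in (0 - 2 * L)..(0 + 2 * L), W.cutoffGen ν 0 (2 * L) p * ρ r p := by
      intro r hr
      have hr0 : 0 < r := hs.trans_le hr.1
      have cρ : Continuous (ρ r) := h.continuousOn_uncurry.continuous_slice hr0
      have hρ := h.nonneg r hr0.le
      have e1 : (3 / (4 * ν ^ 2 * L ^ 2) * (∫ p in (-L)..L, |p * deriv W.H p| * ρ r p))
          ≤ ∫ p in (0 - 2 * L)..(0 + 2 * L),
            1 / (ν ^ 2 * L ^ 2) * (1 - (p / (2 * L)) ^ 2) * (|p * deriv W.H p| * ρ r p) := by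
        rw [← intervalIntegral.integral_const_mul]
        calc _ ≤ ∫ p in (-L)..L, 1 / (ν ^ 2 * L ^ 2) * (1 - (p / (2 * L)) ^ 2) * (|p * deriv W.H p| * ρ r p) := by
              refine intervalIntegral.integral_mono_on (by linarith)
                (Continuous.intervalIntegrable (by fun_prop) _ _)
                (Continuous.intervalIntegrable (by fun_prop) _ _) fun p hp => ?_
              refine mul_le_mul_of_nonneg_right ?_ (mul_nonneg (abs_nonneg _) (hρ p))
              have : (p / (2 * L)) ^ 2 ≤ 1 / 4 := by
                rw [div_pow, div_le_iff₀ (by positivity)]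
                nlinarith [hp.1, hp.2]
              calc 3 / (4 * ν ^ 2 * L ^ 2) = 1 / (ν ^ 2 * L ^ 2) * (1 - 1 / 4) := by field_simp; norm_num
                _ ≤ _ := by gcongr
          _ ≤ _ := by
              refine intervalIntegral.integral_mono_interval (by linarith) (by linarith) (by linarith) ?_
                (Continuous.intervalIntegrable (by fun_prop) _ _)
              refine (ae_restrict_iff' measurableSet_Ioc).2 (ae_of_all _ fun p hp => ?_)
              have := sq_div_le_one (c := 0) hM ⟨hp.1.le, hp.2⟩
              rw [sub_zero] at this
              have : 0 ≤ 1 - (p / (2 * L)) ^ 2 := by linarith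
              have := hρ p
              simp only [Pi.zero_apply]
              positivity
      have e2 : (2 + B / ν ^ 2) / L ^ 2 * (∫ p in (0 - 2 * L)..(0 + 2 * L), ρ r p)
          ≤ (2 + B / ν ^ 2) / L ^ 2 := by
        refine mul_le_of_le_one_right (by positivity) (h.intervalIntegral_le_one hr0.le (by linarith))
      rw [← intervalIntegral.integral_const_mul] at e2
      refine (sub_le_sub e1 e2).trans ?_
      rw [← intervalIntegral.integral_sub (Continuous.intervalIntegrable (by fun_prop) _ _)
        (Continuous.intervalIntegrable (by fun_prop) _ _)]
      refine intervalIntegral.integral_mono_on (by linarith)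
        (Continuous.intervalIntegrable (by fun_prop) _ _)
        (((continuous_cutoffGen _ _).mul cρ).intervalIntegrable _ _) fun p hp => ?_
      rw [← mul_assoc, ← sub_mul]
      refine mul_le_mul_of_nonneg_right ?_ (hρ p)
      have h1 := sq_div_le_one (c := 0) hM hp
      have h2 := abs_cutoffDeriv₂_le (c := 0) hM hp
      have h3 := (abs_le.1 h2).1
      simp only [cutoffGen, cutoffDeriv, sub_zero] at h1 h3 ⊢
      have h5 := mul_le_mul_of_nonneg_left (hB p) (sub_nonneg.2 h1)
      have h6 : (1 - (p / (2 * L)) ^ 2) * B ≤ B := mul_le_of_le_one_left hB0 (by linarith [sq_nonneg (p / (2 * L))])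
      have h7 : (1 - (p / (2 * L)) ^ 2) * |p * deriv W.H p| - B
          ≤ (1 - (p / (2 * L)) ^ 2) * (p * deriv W.H p) := by linarith
      have h8 : 0 < 1 / (ν ^ 2 * L ^ 2) := by positivity
      have h9 := mul_le_mul_of_nonneg_left h7 h8.le
      have e4 : 8 / (2 * L) ^ 2 = 2 / L ^ 2 := by field_simp; norm_num
      rw [e4] at h3
      have e5 : -(4 / (2 * L) ^ 2) * (p * (1 - (p / (2 * L)) ^ 2)) * (deriv W.H p / ν ^ 2)
          = - (1 / (ν ^ 2 * L ^ 2) * ((1 - (p / (2 * L)) ^ 2) * (p * deriv W.H p))) := by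
        field_simp
        norm_num
      rw [e5]
      have e6 : (2 + B / ν ^ 2) / L ^ 2 = 2 / L ^ 2 + 1 / (ν ^ 2 * L ^ 2) * B := by field_simp
      rw [e6]
      linarith
    have cQ := (h.continuousOn_mul cH).continuousOn_intervalIntegral (-L) L
    have cG := (h.continuousOn_mul (continuous_cutoffGen (ν := ν) (W := W) 0 (2 * L))).continuousOn_intervalIntegral
      (0 - 2 * L) (0 + 2 * L)
    have hmono := intervalIntegral.integral_mono_on hst
      (((cQ.intervalIntegrable_Ioi hs ht).const_mul (3 / (4 * ν ^ 2 * L ^ 2))).sub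
        (intervalIntegrable_const (c := (2 + B / ν ^ 2) / L ^ 2)))
      (cG.intervalIntegrable_Ioi hs ht) hr
    rw [← hbal, intervalIntegral.integral_sub ((cQ.intervalIntegrable_Ioi hs ht).const_mul _)
      intervalIntegrable_const, intervalIntegral.integral_const_mul,
      intervalIntegral.integral_const, smul_eq_mul] at hmono
    set Q := ∫ r in s..t, ∫ p in (-L)..L, |p * deriv W.H p| * ρ r p with hQ
    have e7 : Q / L ^ 2 = 4 * ν ^ 2 / 3 * (3 / (4 * ν ^ 2 * L ^ 2) * Q) := by field_simp
    rw [e7]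
    gcongr
    have e8 : (t - s) * (2 + B / ν ^ 2) / L ^ 2 = (t - s) * ((2 + B / ν ^ 2) / L ^ 2) := by ring
    rw [e8]
    linarith

end IsSolution

end DoubleWell

namespace DoubleWell

variable {W : DoubleWell} {ν z : ℝ} {ρ : ℝ → ℝ → ℝ}

namespace IsSolution

/-- The error terms of the cutoffs disappear in the limit. -/
theorem tendsto_cutoff_error (h : W.IsSolution ν ρ) (hν : 0 < ν) {s t : ℝ} (hs : 0 < s)
    (hst : s ≤ t) {Ψ : ℝ → ℝ → ℝ} {A : ℝ} (hA : 0 ≤ A)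
    (hΨ : ∀ r, 0 < r → ∀ p, |Ψ r p| ≤ A * ρ r p) {c : ℝ} (hc : 0 ≤ c) {a : ℝ → ℝ}
    (ha : ∀ M, 0 < M → a M ∈ Icc (c - M) (c + M))
    (hac : ∀ M, 0 < M → ∀ p, a M ≤ p → |p - c| ≤ |p|) :
    Tendsto (fun M => ∫ r in s..t, ∫ p in (a M)..(c + M), W.cutoffGen ν c M p * Ψ r p)
      atTop (𝓝 0) := by
  have ht : 0 < t := hs.trans_le hst
  have cH : Continuous fun p => |p * deriv W.H p| := (continuous_id.mul W.continuous_deriv_H).abs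
  have h2M : Tendsto (fun M : ℝ => 2 * M) atTop atTop := tendsto_id.const_mul_atTop two_pos
  -- The first term comes from the second derivative of the cutoff and the second from the drift;
  -- `16 / (2M)² = 4 / M²` matches the bulk flux at radius `2M`.
  have hlim : Tendsto (fun M : ℝ => 8 * A * (t - s) / M ^ 2 + 16 * A / ν ^ 2 *
      ((∫ r in s..t, ∫ p in (-(2 * M))..(2 * M), |p * deriv W.H p| * ρ r p) / (2 * M) ^ 2))
      atTop (𝓝 0) := by
    have h1 : Tendsto (fun M : ℝ => 8 * A * (t - s) / M ^ 2) atTop (𝓝 0) :=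
      (tendsto_pow_atTop two_ne_zero).const_div_atTop _
    simpa using h1.add (((h.tendsto_bulk_flux hν hs hst).comp h2M).const_mul (16 * A / ν ^ 2))
  refine squeeze_zero_norm' ?_ hlim
  -- For `M ≥ c ≥ 0` the interval `[c - M, c + M]` lies in `[-2M, 2M]`.
  filter_upwards [eventually_gt_atTop 0, eventually_ge_atTop c] with M hM hcM
  obtain ⟨ha1, ha2⟩ := ha M hM
  have cQ := (h.continuousOn_mul cH).continuousOn_intervalIntegral (-(2 * M)) (2 * M)
  have hr : ∀ r ∈ Ioc s t, ‖∫ p in (a M)..(c + M), W.cutoffGen ν c M p * Ψ r p‖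
      ≤ 8 * A / M ^ 2 + 4 * A / (M ^ 2 * ν ^ 2)
        * ∫ p in (-(2 * M))..(2 * M), |p * deriv W.H p| * ρ r p := by
    intro r hr
    have hr0 : 0 < r := hs.trans hr.1
    have cρ : Continuous (ρ r) := h.continuousOn_uncurry.continuous_slice hr0
    have hρ := h.nonneg r hr0.le
    set B : ℝ → ℝ := fun p => 8 * A / M ^ 2 * ρ r p
      + 4 * A / (M ^ 2 * ν ^ 2) * (|p * deriv W.H p| * ρ r p) with hB
    have cB : Continuous B := by fun_prop
    have hB0 : ∀ p, 0 ≤ B p := fun p => by have := hρ p; simp only [hB]; positivity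
    calc ‖∫ p in (a M)..(c + M), W.cutoffGen ν c M p * Ψ r p‖
        ≤ ∫ p in (a M)..(c + M), B p := by
          refine intervalIntegral.norm_integral_le_of_norm_le ha2 (ae_of_all _ fun p hp => ?_)
            (cB.intervalIntegrable _ _)
          have hp' : p ∈ Icc (c - M) (c + M) := ⟨ha1.trans hp.1.le, hp.2⟩
          have h1 := abs_cutoffDeriv_le hM hp'
          have h2 := abs_cutoffDeriv₂_le hM hp'
          have h3 := hac M hM p hp.1.le
          have h4 : |W.cutoffGen ν c M p| ≤ 8 / M ^ 2 + 4 / M ^ 2 * |p| * (|deriv W.H p| / ν ^ 2) := by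
            refine (abs_sub _ _).trans (add_le_add h2 ?_)
            rw [abs_mul, abs_div, abs_of_pos (by positivity : 0 < ν ^ 2)]
            gcongr
            exact h1.trans (by gcongr)
          rw [norm_mul, Real.norm_eq_abs, Real.norm_eq_abs]
          calc _ ≤ (8 / M ^ 2 + 4 / M ^ 2 * |p| * (|deriv W.H p| / ν ^ 2)) * (A * ρ r p) := by
                gcongr; exact hΨ r hr0 p
            _ = B p := by simp only [hB, abs_mul]; field_simp
      _ ≤ ∫ p in (-(2 * M))..(2 * M), B p :=
          intervalIntegral.integral_mono_interval (by linarith) ha2 (by linarith)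
            (ae_of_all _ hB0) (cB.intervalIntegrable _ _)
      _ ≤ _ := by
          simp only [hB]
          rw [intervalIntegral.integral_add (Continuous.intervalIntegrable (by fun_prop) _ _)
            (Continuous.intervalIntegrable (by fun_prop) _ _), intervalIntegral.integral_const_mul,
            intervalIntegral.integral_const_mul]
          gcongr
          exact mul_le_of_le_one_right (by positivity) (h.intervalIntegral_le_one hr0.le (by linarith))
  have := intervalIntegral.norm_integral_le_of_norm_le hst (ae_of_all _ hr)
    ((intervalIntegrable_const).add ((cQ.intervalIntegrable_Ioi hs ht).const_mul _))
  refine this.trans (le_of_eq ?_)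
  rw [intervalIntegral.integral_add intervalIntegrable_const
    ((cQ.intervalIntegrable_Ioi hs ht).const_mul _), intervalIntegral.integral_const,
    intervalIntegral.integral_const_mul, smul_eq_mul]
  field_simp
  ring

/-! ### Effective dynamics -/

/-- The mass beyond `c` changes only by the flux through `c`: the contribution of the far end of the
cutoff vanishes in the limit. -/
lemma mass_right_balance (h : W.IsSolution ν ρ) (hν : 0 < ν) {s t : ℝ} (hs : 0 < s) (hst : s ≤ t)
    {c : ℝ} (hc : 0 ≤ c) :
    W.tau ν / ν ^ 2 * ((∫ p in Ioi c, ρ t p) - ∫ p in Ioi c, ρ s p)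
      = -∫ r in s..t, 1 * W.gibbs ν c * W.relDensitySpace ν 1 ρ r c := by
  have ht : 0 < t := hs.trans_le hst
  have hflow := h.gibbsFlow hν one_pos
  have cfl : ContinuousOn (fun r => 1 * W.gibbs ν c * W.relDensitySpace ν 1 ρ r c) (Ioi 0) :=
    continuousOn_const.mul (hflow.continuousOn_space.continuousOn_time c)
  have cfln : ContinuousOn (fun r => -(1 * W.gibbs ν c * W.relDensitySpace ν 1 ρ r c)) (Ioi 0) :=
    cfl.neg
  have hid : ∀ M, 0 < M → W.tau ν / ν ^ 2 * ((∫ p in c..(c + M), cutoff c M p * ρ t p)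
        - ∫ p in c..(c + M), cutoff c M p * ρ s p)
      = -(∫ r in s..t, 1 * W.gibbs ν c * W.relDensitySpace ν 1 ρ r c)
        + ∫ r in s..t, ∫ p in c..(c + M), W.cutoffGen ν c M p * ρ r p := by
    intro M hM
    have := hflow.cutoff_identity_right hs ht c hM
    simp only [cutoffGen_mul, mul_assoc (W.cutoffGen _ _ _ _), mul_assoc (cutoff _ _ _),
      mul_gibbs_mul_relDensity one_pos] at this
    rw [this, intervalIntegral.integral_add (cfln.intervalIntegrable_Ioi hs ht)
      (((h.continuousOn_mul (continuous_cutoffGen (ν := ν) (W := W) c M)).continuousOn_intervalIntegral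
        c (c + M)).intervalIntegrable_Ioi hs ht), intervalIntegral.integral_neg]
  have herr := h.tendsto_cutoff_error hν hs hst zero_le_one (Ψ := ρ)
    (fun r hr p => by rw [one_mul, abs_of_nonneg (h.nonneg r hr.le p)]) hc (a := fun _ => c)
    (fun M hM => ⟨by linarith, by linarith⟩)
    (fun M hM p hp => by rw [abs_of_nonneg (by linarith), abs_of_nonneg (by linarith)]; linarith)
  have hl := ((tendsto_intervalIntegral_cutoff_mul_Ioi (h.integrable t ht.le).integrableOn (c := c)).sub
    (tendsto_intervalIntegral_cutoff_mul_Ioi (h.integrable s hs.le).integrableOn (c := c))).const_mul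
      (W.tau ν / ν ^ 2)
  have hr := (herr.const_add (-(∫ r in s..t, 1 * W.gibbs ν c * W.relDensitySpace ν 1 ρ r c)))
  rw [add_zero] at hr
  refine tendsto_nhds_unique (hl.congr' ?_) hr
  filter_upwards [eventually_gt_atTop 0] with M hM using hid M hM

end IsSolution

/-! ### The moment weight -/

variable (W ν) in
/-- The smooth function that coincides with `ψ` on `[P₋, P₊]`. -/
noncomputable def psiInner (p : ℝ) : ℝ := ∫ q in (W.P .minus)..p, 1 / (W.eta ν * W.gibbs ν q)

lemma continuous_inv_eta_gibbs : Continuous fun q => 1 / (W.eta ν * W.gibbs ν q) :=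
  continuous_const.div (continuous_const.mul (W.continuous_gibbs ν))
    fun p => (mul_pos (W.eta_pos ν) (W.gibbs_pos ν p)).ne'

lemma hasDerivAt_psiInner (p : ℝ) :
    HasDerivAt (W.psiInner ν) (1 / (W.eta ν * W.gibbs ν p)) p :=
  intervalIntegral.integral_hasDerivAt_right (continuous_inv_eta_gibbs.intervalIntegrable _ _)
    (continuous_inv_eta_gibbs.stronglyMeasurableAtFilter _ _) continuous_inv_eta_gibbs.continuousAt

lemma hasDerivAt_deriv_psiInner (p : ℝ) :
    HasDerivAt (fun q => 1 / (W.eta ν * W.gibbs ν q))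
      (deriv W.H p / ν ^ 2 * (1 / (W.eta ν * W.gibbs ν p))) p := by
  have h1 := (W.gibbs_pos ν p).ne'
  have h2 := (W.eta_pos ν).ne'
  have := (((hasDerivAt_gibbs (W := W) ν p).const_mul (W.eta ν)).inv (by positivity))
  convert! this using 1
  · ext q; simp
  · field_simp

lemma psiInner_P_plus : W.psiInner ν (W.P .plus) = 1 := by
  have h2 := (W.eta_pos ν).ne'
  have : ∀ q, 1 / (W.eta ν * W.gibbs ν q) = (W.eta ν)⁻¹ * (1 / W.gibbs ν q) := fun q => by
    rw [one_div, mul_inv, one_div]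
  rw [psiInner]
  simp_rw [this]
  rw [intervalIntegral.integral_const_mul, ← eta_eq, inv_mul_cancel₀ h2]

lemma psiInner_P_minus : W.psiInner ν (W.P .minus) = 0 := by simp [psiInner]

lemma psi_of_le {p : ℝ} (hp : p ≤ W.P .minus) : W.psi ν p = 0 := by
  rw [psi]
  refine intervalIntegral.integral_zero_ae (ae_of_all _ fun q hq => ?_)
  rw [uIoc_of_ge hp] at hq
  exact indicator_of_notMem (fun h => absurd h.1 (not_lt.2 hq.2)) _

lemma psi_of_mem {p : ℝ} (hp : p ∈ Icc (W.P .minus) (W.P .plus)) : W.psi ν p = W.psiInner ν p := by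
  rw [psi, psiInner, intervalIntegral.integral_of_le hp.1, intervalIntegral.integral_of_le hp.1,
    integral_Ioc_eq_integral_Ioo, integral_Ioc_eq_integral_Ioo]
  refine setIntegral_congr_fun measurableSet_Ioo fun q hq => ?_
  have hq' : q ∈ Ioo (W.P .minus) (W.P .plus) := ⟨hq.1, hq.2.trans_le hp.2⟩
  simp only [indicator_of_mem hq']

lemma intervalIntegrable_psi_deriv (a b : ℝ) : IntervalIntegrable
    ((Ioo (W.P .minus) (W.P .plus)).indicator (fun r => 1 / (W.eta ν * W.gibbs ν r))) volume a b := by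
  have h : IntegrableOn (fun r => 1 / (W.eta ν * W.gibbs ν r)) (Ioo (W.P .minus) (W.P .plus)) :=
    (continuous_inv_eta_gibbs.integrableOn_Icc).mono_set Ioo_subset_Icc_self
  exact (h.integrable_indicator measurableSet_Ioo).intervalIntegrable

lemma psi_of_ge {p : ℝ} (hp : W.P .plus ≤ p) : W.psi ν p = 1 := by
  rw [psi, ← intervalIntegral.integral_add_adjacent_intervals (intervalIntegrable_psi_deriv _ _)
    (intervalIntegrable_psi_deriv (W.P .plus) p)]
  have h1 : ∫ q in (W.P .plus)..p, (Ioo (W.P .minus) (W.P .plus)).indicator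
      (fun r => 1 / (W.eta ν * W.gibbs ν r)) q = 0 := by
    refine intervalIntegral.integral_zero_ae (ae_of_all _ fun q hq => ?_)
    rw [uIoc_of_le hp] at hq
    exact indicator_of_notMem (fun h => absurd h.2 (not_lt.2 hq.1.le)) _
  have h2 := psi_of_mem (W := W) (ν := ν) (right_mem_Icc.2 W.P_minus_lt_P_plus.le)
  rw [psi] at h2
  rw [h1, h2, psiInner_P_plus, add_zero]

lemma continuous_psi : Continuous (W.psi ν) :=
  intervalIntegral.continuous_primitive (fun a b => intervalIntegrable_psi_deriv a b) _

lemma monotone_psi : Monotone (W.psi ν) := by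
  intro p q hpq
  have : W.psi ν q - W.psi ν p = ∫ r in p..q, (Ioo (W.P .minus) (W.P .plus)).indicator
      (fun r => 1 / (W.eta ν * W.gibbs ν r)) r :=
    intervalIntegral.integral_interval_sub_left (intervalIntegrable_psi_deriv _ _)
      (intervalIntegrable_psi_deriv _ _)
  have h0 : 0 ≤ W.psi ν q - W.psi ν p := by
    rw [this]
    refine intervalIntegral.integral_nonneg hpq fun r _ => indicator_nonneg (fun r _ => ?_) _
    have := W.eta_pos ν
    have := W.gibbs_pos ν r
    positivity
  linarith

lemma psi_nonneg (p : ℝ) : 0 ≤ W.psi ν p := by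
  rw [← psi_of_le (W := W) (ν := ν) (min_le_right p (W.P .minus))]
  exact monotone_psi (min_le_left _ _)

lemma psi_le_one (p : ℝ) : W.psi ν p ≤ 1 := by
  rw [← psi_of_ge (W := W) (ν := ν) (le_max_right p (W.P .plus))]
  exact monotone_psi (le_max_left _ _)

lemma integrable_psi_mul {f : ℝ → ℝ} (hf : Integrable f) : Integrable fun p => W.psi ν p * f p := by
  refine hf.bdd_mul (c := 1) continuous_psi.aestronglyMeasurable (ae_of_all _ fun p => ?_)
  rw [Real.norm_eq_abs, abs_of_nonneg (psi_nonneg p)]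
  exact psi_le_one p

lemma integral_psi_mul {f : ℝ → ℝ} (hf : Integrable f) :
    ∫ p, W.psi ν p * f p
      = (∫ p in (W.P .minus)..(W.P .plus), W.psiInner ν p * f p) + ∫ p in Ioi (W.P .plus), f p := by
  have hi := integrable_psi_mul (W := W) (ν := ν) hf
  have h1 : ∫ p in Iic (W.P .minus), W.psi ν p * f p = 0 :=
    setIntegral_eq_zero_of_forall_eq_zero fun p hp => by rw [psi_of_le hp, zero_mul]
  have h2 : ∫ p in Ioi (W.P .plus), W.psi ν p * f p = ∫ p in Ioi (W.P .plus), f p :=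
    setIntegral_congr_fun measurableSet_Ioi fun p hp => by
      simp only [psi_of_ge (le_of_lt (mem_Ioi.1 hp)), one_mul]
  have h3 : ∫ p in (W.P .minus)..(W.P .plus), W.psi ν p * f p
      = ∫ p in (W.P .minus)..(W.P .plus), W.psiInner ν p * f p := by
    refine intervalIntegral.integral_congr fun p hp => ?_
    rw [uIcc_of_le W.P_minus_lt_P_plus.le] at hp
    simp only [psi_of_mem hp]
  rw [← intervalIntegral.integral_Iic_add_Ioi hi.integrableOn (b := W.P .minus) hi.integrableOn, h1,
    zero_add, ← h2, ← h3, ← intervalIntegral.integral_interval_add_Ioi hi.integrableOn hi.integrableOn]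

namespace IsSolution

/-- Since `γ ψ'` is constant between the minima, the generator term vanishes and only boundary
values are left: the flux at `P₊`, where `ψ = 1`, and the values of `u` at both ends with weight `γ
ψ' = 1 / η`. -/
lemma psiInner_balance (h : W.IsSolution ν ρ) (hν : 0 < ν) {s t : ℝ} (hs : 0 < s) (ht : 0 < t) :
    W.tau ν / ν ^ 2 * ((∫ p in (W.P .minus)..(W.P .plus), W.psiInner ν p * ρ t p)
        - ∫ p in (W.P .minus)..(W.P .plus), W.psiInner ν p * ρ s p)
      = ∫ r in s..t, (1 * W.gibbs ν (W.P .plus) * W.relDensitySpace ν 1 ρ r (W.P .plus)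
          + (W.relDensity ν 1 ρ r (W.P .minus) - W.relDensity ν 1 ρ r (W.P .plus)) / W.eta ν) := by
  have hη := (W.eta_pos ν).ne'
  have c2 : Continuous fun p => deriv W.H p / ν ^ 2 * (1 / (W.eta ν * W.gibbs ν p)) :=
    (W.continuous_deriv_H.div_const _).mul continuous_inv_eta_gibbs
  have := (h.gibbsFlow hν one_pos).local_identity .id (hasDerivAt_psiInner (W := W) (ν := ν))
    hasDerivAt_deriv_psiInner c2 hs ht (W.P .minus) (W.P .plus)
  simp only [mul_assoc (W.psiInner _ _), mul_gibbs_mul_relDensity one_pos] at this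
  rw [this]
  refine intervalIntegral.integral_congr fun r hr => ?_
  simp only [psiInner_P_plus, psiInner_P_minus, zero_mul, mul_zero,
    intervalIntegral.integral_zero, sub_zero, zero_sub]
  have h0 : ∀ p, (deriv W.H p / ν ^ 2 * (1 / (W.eta ν * W.gibbs ν p)) * (1 * W.gibbs ν p)
      + 1 / (W.eta ν * W.gibbs ν p) * (1 * (-(deriv W.H p / ν ^ 2) * W.gibbs ν p)))
        * W.relDensity ν 1 ρ r p = 0 := fun p => by ring
  simp only [h0, intervalIntegral.integral_zero, add_zero]
  have h1 := (W.gibbs_pos ν (W.P .minus)).ne'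
  have h2 := (W.gibbs_pos ν (W.P .plus)).ne'
  field_simp
  ring

/-- The flux through `P₊` leaves the inner interval and enters the outer one, so it cancels when the
two balances are added. -/
lemma massTilde_plus_balance (h : W.IsSolution ν ρ) (hν : 0 < ν) {s t : ℝ} (hs : 0 < s)
    (hst : s ≤ t) :
    W.tau ν / ν ^ 2 * (W.massTilde ν ρ .plus t - W.massTilde ν ρ .plus s)
      = ∫ r in s..t,
          (W.relDensity ν 1 ρ r (W.P .minus) - W.relDensity ν 1 ρ r (W.P .plus)) / W.eta ν := by
  have ht : 0 < t := hs.trans_le hst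
  have hflow := h.gibbsFlow hν one_pos
  have cfl : ContinuousOn (fun r => 1 * W.gibbs ν (W.P .plus) * W.relDensitySpace ν 1 ρ r (W.P .plus)) (Ioi 0) :=
    continuousOn_const.mul (hflow.continuousOn_space.continuousOn_time _)
  have cu : ContinuousOn (fun r => (W.relDensity ν 1 ρ r (W.P .minus)
      - W.relDensity ν 1 ρ r (W.P .plus)) / W.eta ν) (Ioi 0) :=
    ((hflow.continuousOn.continuousOn_time _).sub (hflow.continuousOn.continuousOn_time _)).div_const _
  have e1 := h.psiInner_balance hν hs ht
  have e2 := h.mass_right_balance hν hs hst W.P_plus_pos.le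
  rw [intervalIntegral.integral_add (cfl.intervalIntegrable_Ioi hs ht)
    (cu.intervalIntegrable_Ioi hs ht)] at e1
  simp only [massTilde, weight]
  rw [integral_psi_mul (h.integrable t ht.le), integral_psi_mul (h.integrable s hs.le)]
  linear_combination e1 + e2

lemma massTilde_minus (h : W.IsSolution ν ρ) {t : ℝ} (ht : 0 ≤ t) :
    W.massTilde ν ρ .minus t = 1 - W.massTilde ν ρ .plus t := by
  simp only [massTilde, weight, sub_mul, one_mul]
  rw [integral_sub (h.integrable t ht) (integrable_psi_mul (h.integrable t ht)), h.mass_one t ht]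

/-- The integrand of the integrated balance is continuous in time, so the fundamental theorem of
calculus yields differentiability. -/
lemma hasDerivAt_massTilde_plus (h : W.IsSolution ν ρ) (hν : 0 < ν) {t : ℝ} (ht : 0 < t) :
    HasDerivAt (W.massTilde ν ρ .plus) (ν ^ 2 / W.tau ν *
      ((W.relDensity ν 1 ρ t (W.P .minus) - W.relDensity ν 1 ρ t (W.P .plus)) / W.eta ν)) t := by
  have hτ := (W.tau_pos ν).ne'
  have hflow := h.gibbsFlow hν one_pos
  have cu : ContinuousOn (fun r => (W.relDensity ν 1 ρ r (W.P .minus)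
      - W.relDensity ν 1 ρ r (W.P .plus)) / W.eta ν) (Ioi 0) :=
    ((hflow.continuousOn.continuousOn_time _).sub (hflow.continuousOn.continuousOn_time _)).div_const _
  have hs : 0 < t / 2 := half_pos ht
  have hd := intervalIntegral.integral_hasDerivAt_right (cu.intervalIntegrable_Ioi hs ht)
    (cu.stronglyMeasurableAtFilter isOpen_Ioi t ht) (cu.continuousAt (Ioi_mem_nhds ht))
  refine ((hd.const_mul (ν ^ 2 / W.tau ν)).const_add (W.massTilde ν ρ .plus (t / 2))).congr_of_eventuallyEq ?_
  filter_upwards [Ioi_mem_nhds (half_lt_self ht)] with x hx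
  rw [← h.massTilde_plus_balance hν hs (le_of_lt hx)]
  field_simp
  ring

lemma massBar_eq (s : Well) (t : ℝ) :
    W.massBar ν ρ s t = W.mu ν s * W.relDensity ν 1 ρ t (W.P s) := by
  rw [massBar, wSq, gibbsLoc, indicator_of_mem (W.P_mem_phase s), relDensity, one_mul, div_mul_eq_div_div,
    div_inv_eq_mul]
  ring

/-- The substitute masses add up to `1`, which gives the minus case from the plus case. The factor
`1 + θ = τ μ₋ η / ν²` converts values of `ρ / γ` at the minima into `m̄₋` and `κ m̄₊`. -/
theorem effective_dynamics (h : W.IsSolution ν ρ) (hν : 0 < ν) (s : Well) {t : ℝ} (ht : 0 < t) :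
    DifferentiableAt ℝ (W.massTilde ν ρ s) t ∧
      s.sign * (1 + W.theta ν) * deriv (W.massTilde ν ρ s) t
        = W.massBar ν ρ .minus t - W.kappa ν * W.massBar ν ρ .plus t := by
  have hd := h.hasDerivAt_massTilde_plus hν ht
  have hτ := (W.tau_pos ν).ne'
  have hη := (W.eta_pos ν).ne'
  have hμ := (W.mu_pos hν .plus).ne'
  have key : (1 + W.theta ν) * (ν ^ 2 / W.tau ν *
      ((W.relDensity ν 1 ρ t (W.P .minus) - W.relDensity ν 1 ρ t (W.P .plus)) / W.eta ν))
      = W.massBar ν ρ .minus t - W.kappa ν * W.massBar ν ρ .plus t := by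
    rw [massBar_eq, massBar_eq, theta, kappa]
    field_simp
    ring
  cases s with
  | plus =>
    refine ⟨hd.differentiableAt, ?_⟩
    rw [hd.deriv, Well.sign, one_mul, key]
  | minus =>
    have hd' := (hd.const_sub 1).congr_of_eventuallyEq (f₁ := W.massTilde ν ρ .minus) (by
      filter_upwards [Ioi_mem_nhds ht] with x hx using h.massTilde_minus (le_of_lt hx))
    refine ⟨hd'.differentiableAt, ?_⟩
    rw [hd'.deriv, Well.sign, ← key]
    ring

end IsSolution

end DoubleWell

lemma integrable_exp_neg_mul_abs {c : ℝ} (hc : 0 < c) :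
    Integrable fun x : ℝ => Real.exp (-(c * |x|)) := by
  set m := min 1 (c ^ 2 / 2) with hm
  have hmpos : 0 < m := by positivity
  refine (integrable_inv_one_add_sq.const_mul m⁻¹).mono' (by fun_prop) (ae_of_all _ fun x => ?_)
  rw [Real.norm_eq_abs, abs_of_pos (Real.exp_pos _), Real.exp_neg, ← mul_inv]
  have h0 : 0 ≤ c * |x| := by positivity
  have h1 := Real.quadratic_le_exp_of_nonneg h0
  have hx : |x| ^ 2 = x ^ 2 := sq_abs x
  have h2 : m * (1 + x ^ 2) ≤ Real.exp (c * |x|) := by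
    have h3 : m ≤ 1 := min_le_left _ _
    have h4 : m * x ^ 2 ≤ c ^ 2 / 2 * x ^ 2 := by gcongr; exact min_le_right _ _
    have h5 : (c * |x|) ^ 2 / 2 = c ^ 2 / 2 * x ^ 2 := by rw [mul_pow, hx]; ring
    linarith
  gcongr

namespace DoubleWell

variable {W : DoubleWell} {ν z : ℝ} {ρ : ℝ → ℝ → ℝ}

/-! ### Tails of the Gibbs function -/

/-- Outside the minima `H` is monotone, and its slope is at least `c` in absolute value once `|p| ≥
R`. Moving outwards, a length of at most `R` is spent before this slope is available. -/
lemma exists_outer_growth (W : DoubleWell) : ∃ c > 0, ∃ R, 0 ≤ R ∧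
    (∀ q p, W.P .plus ≤ q → q ≤ p → c * (|p - q| - R) ≤ W.H p - W.H q) ∧
    (∀ q p, q ≤ W.P .minus → p ≤ q → c * (|p - q| - R) ≤ W.H p - W.H q) := by
  obtain ⟨c, hc, R₀, hR₀⟩ := W.growth
  set R := max R₀ 0 with hR
  have hRR : R₀ ≤ R := le_max_left _ _
  refine ⟨c, hc, R, le_max_right _ _, ?_, ?_⟩
  · intro q p hq hqp
    have hq0 : 0 < q := W.P_plus_pos.trans_le hq
    rw [abs_of_nonneg (by linarith)]
    rcases le_or_gt (p - q) R with h | h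
    · have := W.mono_right.monotoneOn (mem_Ici.2 hq) (mem_Ici.2 (hq.trans hqp)) hqp
      nlinarith
    · have hR0 : 0 ≤ R := le_max_right _ _
      set q' := max q R with hq'
      have h1 : q ≤ q' := le_max_left _ _
      have h2 : q' ≤ p := max_le hqp (by linarith)
      have h3 : q' ≤ q + R := max_le (by linarith) (by linarith)
      have hm := W.mono_right.monotoneOn (mem_Ici.2 hq) (mem_Ici.2 (hq.trans h1)) h1
      have hder : ∀ x ∈ interior (Icc q' p), c ≤ deriv W.H x := by
        intro x hx
        rw [interior_Icc] at hx
        have hx0 : q < x := h1.trans_lt hx.1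
        have h5 : 0 ≤ deriv W.H x := by
          have := W.mono_right.monotoneOn.derivWithin_nonneg (x := x)
          rwa [derivWithin_of_mem_nhds (Ici_mem_nhds (hq.trans_lt hx0))] at this
        have h6 := (hR₀ x (by
          rw [abs_of_pos (hq0.trans hx0)]
          exact hRR.trans ((le_max_right _ _).trans hx.1.le))).2
        rwa [abs_of_nonneg h5] at h6
      have := (convex_Icc q' p).mul_sub_le_image_sub_of_le_deriv W.differentiable_H.continuous.continuousOn
        W.differentiable_H.differentiableOn hder q' (left_mem_Icc.2 h2) p (right_mem_Icc.2 h2) h2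
      nlinarith
  · intro q p hq hqp
    have hq0 : q < 0 := hq.trans_lt W.P_minus_neg
    rw [abs_of_nonpos (by linarith)]
    rcases le_or_gt (q - p) R with h | h
    · have := W.anti_left.antitoneOn (mem_Iic.2 (hqp.trans hq)) (mem_Iic.2 hq) hqp
      nlinarith
    · have hR0 : 0 ≤ R := le_max_right _ _
      set q' := min q (-R) with hq'
      have h1 : q' ≤ q := min_le_left _ _
      have h2 : p ≤ q' := le_min hqp (by linarith)
      have h3 : q - R ≤ q' := le_min (by linarith) (by linarith)
      have hm := W.anti_left.antitoneOn (mem_Iic.2 (h1.trans hq)) (mem_Iic.2 hq) h1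
      have hder : ∀ x ∈ interior (Icc p q'), deriv W.H x ≤ -c := by
        intro x hx
        rw [interior_Icc] at hx
        have hx0 : x < q := hx.2.trans_le h1
        have h5 : deriv W.H x ≤ 0 := by
          have := W.anti_left.antitoneOn.derivWithin_nonpos (x := x)
          rwa [derivWithin_of_mem_nhds (Iic_mem_nhds (hx0.trans_le hq))] at this
        have h6 := (hR₀ x (by
          rw [abs_of_neg (hx0.trans hq0)]
          have : x ≤ -R := hx.2.le.trans (min_le_right _ _)
          linarith)).2
        rw [abs_of_nonpos h5] at h6
        linarith
      have := (convex_Icc p q').image_sub_le_mul_sub_of_deriv_le W.differentiable_H.continuous.continuousOn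
        W.differentiable_H.differentiableOn hder p (left_mem_Icc.2 h2) q' (right_mem_Icc.2 h2) h2
      nlinarith

lemma gibbs_le_gibbs_of_le {p q : ℝ} (h : W.H q ≤ W.H p) : W.gibbs ν p ≤ W.gibbs ν q := by
  unfold gibbs
  gcongr

/-- Between a minimum and the barrier, the potential increases towards the barrier. -/
lemma H_le_of_inner (s : Well) {q p : ℝ} (hp : p ∈ uIcc (W.P s) 0) (hq : q ∈ uIcc (W.P s) p) :
    W.H q ≤ W.H p := by
  cases s with
  | minus =>
    rw [uIcc_of_le W.P_minus_neg.le] at hp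
    rw [uIcc_of_le hp.1] at hq
    exact W.mono_left.monotoneOn ⟨hq.1, hq.2.trans hp.2⟩ hp hq.2
  | plus =>
    rw [uIcc_of_ge W.P_plus_pos.le] at hp
    rw [uIcc_of_ge hp.2] at hq
    exact W.anti_right.antitoneOn hp ⟨hp.1.trans hq.1, hq.2⟩ hq.1

/-- The mass of the Gibbs function beyond a point, as seen from the minimum, is controlled by
its value there. -/
lemma exists_tail_bound (W : DoubleWell) : ∃ K > 0, ∀ ν : ℝ, 0 < ν → ν ≤ 1 → ∀ s : Well,
    ∀ b ∈ closure s.phase, ∀ q ∈ uIcc (W.P s) b, |∫ p in q..b, W.gibbs ν p| ≤ K * W.gibbs ν q := by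
  obtain ⟨c, hc, R, hR, hplus, hminus⟩ := W.exists_outer_growth
  have hI := integrable_exp_neg_mul_abs hc
  set I := ∫ x : ℝ, Real.exp (-(c * |x|)) with hIdef
  have hI0 : 0 ≤ I := integral_nonneg fun x => (Real.exp_pos _).le
  -- The distances handle the inner side, where `γ` decreases away from the minimum; the exponential
  -- integral handles the outer side.
  set K := |W.P .minus| + |W.P .plus| + Real.exp (c * R) * I with hK
  have hexp := Real.exp_pos (c * R)
  have hKpos : 0 < K := by
    have := abs_pos.2 W.P_minus_neg.ne
    positivity
  refine ⟨K, hKpos, fun ν hν hν1 s b hb q hq => ?_⟩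
  have hinner : b ∈ uIcc (W.P s) 0 → |∫ p in q..b, W.gibbs ν p| ≤ K * W.gibbs ν q := by
    intro hb0
    have h1 : |b - q| ≤ |W.P s| := by
      cases s with
      | minus =>
        rw [uIcc_of_le W.P_minus_neg.le] at hb0
        rw [uIcc_of_le hb0.1] at hq
        rw [abs_of_neg W.P_minus_neg, abs_of_nonneg (by linarith [hq.2])]
        linarith [hq.1, hb0.2]
      | plus =>
        rw [uIcc_of_ge W.P_plus_pos.le] at hb0
        rw [uIcc_of_ge hb0.2] at hq
        rw [abs_of_pos W.P_plus_pos, abs_of_nonpos (by linarith [hq.1])]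
        linarith [hq.2, hb0.1]
    have h2 : ∀ p ∈ uIoc q b, ‖W.gibbs ν p‖ ≤ W.gibbs ν q := by
      intro p hp
      have hp' : p ∈ uIcc q b := uIoc_subset_uIcc hp
      rw [Real.norm_eq_abs, abs_of_pos (W.gibbs_pos ν p)]
      refine gibbs_le_gibbs_of_le ?_
      cases s with
      | minus =>
        rw [uIcc_of_le W.P_minus_neg.le] at hb0
        rw [uIcc_of_le hb0.1] at hq
        rw [uIcc_of_le hq.2] at hp'
        refine H_le_of_inner .minus ?_ ?_
        · rw [uIcc_of_le W.P_minus_neg.le]; exact ⟨hq.1.trans hp'.1, hp'.2.trans hb0.2⟩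
        · rw [uIcc_of_le (hq.1.trans hp'.1)]; exact ⟨hq.1, hp'.1⟩
      | plus =>
        rw [uIcc_of_ge W.P_plus_pos.le] at hb0
        rw [uIcc_of_ge hb0.2] at hq
        rw [uIcc_of_ge hq.1] at hp'
        refine H_le_of_inner .plus ?_ ?_
        · rw [uIcc_of_ge W.P_plus_pos.le]; exact ⟨hb0.1.trans hp'.1, hp'.2.trans hq.2⟩
        · rw [uIcc_of_ge (hp'.2.trans hq.2)]; exact ⟨hp'.2, hq.2⟩
    have h3 := intervalIntegral.norm_integral_le_of_norm_le_const h2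
    have hγ := W.gibbs_pos ν q
    calc |∫ p in q..b, W.gibbs ν p| ≤ W.gibbs ν q * |b - q| := h3
      _ ≤ W.gibbs ν q * K := by
          gcongr
          refine h1.trans ?_
          have : 0 ≤ Real.exp (c * R) * I := by positivity
          have := abs_nonneg (W.P .minus)
          have := abs_nonneg (W.P .plus)
          cases s <;> linarith
      _ = _ := mul_comm _ _
  have houter : (∀ p ∈ uIcc q b, c * (|p - q| - R) ≤ W.H p - W.H q ∧ W.H q ≤ W.H p) →
      |∫ p in q..b, W.gibbs ν p| ≤ K * W.gibbs ν q := by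
    intro hgr
    have hγ := W.gibbs_pos ν q
    have hshift : Integrable fun p : ℝ => W.gibbs ν q * Real.exp (c * R) * Real.exp (-(c * |p - q|)) :=
      (hI.comp_sub_right q).const_mul _
    have hpt : ∀ p ∈ uIoc q b, ‖W.gibbs ν p‖ ≤ W.gibbs ν q * Real.exp (c * R) * Real.exp (-(c * |p - q|)) := by
      intro p hp
      obtain ⟨h1, h2⟩ := hgr p (uIoc_subset_uIcc hp)
      rw [Real.norm_eq_abs, abs_of_pos (W.gibbs_pos ν p), gibbs, gibbs, ← Real.exp_add, ← Real.exp_add]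
      refine Real.exp_le_exp.2 ?_
      -- The restriction `ν ≤ 1` makes the exponential bound uniform in `ν`.
      have h3 : W.H p - W.H q ≤ (W.H p - W.H q) / ν ^ 2 :=
        le_div_self (by linarith) (by positivity) (pow_le_one₀ hν.le hν1)
      have h4 : -W.H p / ν ^ 2 = -W.H q / ν ^ 2 - (W.H p - W.H q) / ν ^ 2 := by ring
      linarith
    calc |∫ p in q..b, W.gibbs ν p| ≤ ∫ p in uIoc q b, ‖W.gibbs ν p‖ :=
          by
          simpa only [Real.norm_eq_abs] using
            intervalIntegral.norm_integral_le_integral_norm_uIoc (f := W.gibbs ν) (μ := volume)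
      _ ≤ ∫ p in uIoc q b, W.gibbs ν q * Real.exp (c * R) * Real.exp (-(c * |p - q|)) := by
          refine setIntegral_mono_on ?_ hshift.integrableOn measurableSet_uIoc hpt
          exact ((W.continuous_gibbs ν).norm.integrableOn_uIcc).mono_set uIoc_subset_uIcc
      _ ≤ ∫ p, W.gibbs ν q * Real.exp (c * R) * Real.exp (-(c * |p - q|)) :=
          setIntegral_le_integral hshift (ae_of_all _ fun p => by simp only [Pi.zero_apply]; positivity)
      _ = W.gibbs ν q * Real.exp (c * R) * I := by
          rw [integral_const_mul, integral_sub_right_eq_self (fun x : ℝ => Real.exp (-(c * |x|)))]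
      _ = Real.exp (c * R) * I * W.gibbs ν q := by ring
      _ ≤ K * W.gibbs ν q := by
          gcongr
          have := abs_nonneg (W.P .minus)
          have := abs_nonneg (W.P .plus)
          linarith
  cases s with
  | minus =>
    have hb' : b ≤ 0 := by simpa [Well.phase] using hb
    rcases le_total b (W.P .minus) with h | h
    · refine houter fun p hp => ?_
      rw [uIcc_of_ge h] at hq
      rw [uIcc_of_ge hq.1] at hp
      exact ⟨hminus q p hq.2 hp.2,
        W.anti_left.antitoneOn (mem_Iic.2 (hp.2.trans hq.2)) (mem_Iic.2 hq.2) hp.2⟩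
    · exact hinner (by rw [uIcc_of_le W.P_minus_neg.le]; exact ⟨h, hb'⟩)
  | plus =>
    have hb' : 0 ≤ b := by simpa [Well.phase] using hb
    rcases le_total (W.P .plus) b with h | h
    · refine houter fun p hp => ?_
      rw [uIcc_of_le h] at hq
      rw [uIcc_of_le hq.2] at hp
      exact ⟨hplus q p hq.1 hp.1,
        W.mono_right.monotoneOn (mem_Ici.2 hq.1) (mem_Ici.2 (hq.1.trans hp.1)) hp.1⟩
    · exact hinner (by rw [uIcc_of_ge W.P_plus_pos.le]; exact ⟨hb', h⟩)

/-! ### Densities of finite dissipation -/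

variable (W ν) in
/-- The integrand of the dissipation. -/
noncomputable def dissipationDensity (f : ℝ → ℝ) (p : ℝ) : ℝ :=
  (deriv f p + deriv W.H p * f p / ν ^ 2) ^ 2 / f p

variable (W ν) in
/-- A continuously differentiable probability density with finite dissipation. -/
structure FiniteDissipation (f : ℝ → ℝ) : Prop where
  contDiff : ContDiff ℝ 1 f
  nonneg : ∀ p, 0 ≤ f p
  integrable : Integrable f
  mass_one : ∫ p, f p = 1
  integrable_dissipation : Integrable (W.dissipationDensity ν f)

namespace FiniteDissipation

variable {f : ℝ → ℝ}

lemma dissipationDensity_nonneg (h : W.FiniteDissipation ν f) (p : ℝ) :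
    0 ≤ W.dissipationDensity ν f p :=
  div_nonneg (sq_nonneg _) (h.nonneg p)

lemma continuous (h : W.FiniteDissipation ν f) : Continuous f := h.contDiff.continuous

lemma hasDerivAt (h : W.FiniteDissipation ν f) (p : ℝ) : HasDerivAt (fun q => f q / W.gibbs ν q)
    ((deriv f p + deriv W.H p * f p / ν ^ 2) / W.gibbs ν p) p := by
  have := hasDerivAt_div_gibbs (W := W) (ν := ν) one_pos
    (h.contDiff.differentiable (by norm_num) p)
  simpa only [one_mul] using this

lemma continuous_rel (h : W.FiniteDissipation ν f) : Continuous fun q => f q / W.gibbs ν q :=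
  h.continuous.div (W.continuous_gibbs ν) fun p => (W.gibbs_pos ν p).ne'

lemma continuous_deriv_rel (h : W.FiniteDissipation ν f) :
    Continuous fun p => (deriv f p + deriv W.H p * f p / ν ^ 2) / W.gibbs ν p := by
  have h1 := h.contDiff.continuous_deriv (by norm_num)
  have h2 := h.continuous
  have h3 := W.continuous_deriv_H
  exact (by fun_prop : Continuous fun p => deriv f p + deriv W.H p * f p / ν ^ 2).div
    (W.continuous_gibbs ν) fun p => (W.gibbs_pos ν p).ne'

/-- Young's inequality for the flux. At a zero of `f` the flux vanishes as well, because a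
nonnegative differentiable function has zero derivative at its zeros. -/
lemma abs_flux_mul_le (h : W.FiniteDissipation ν f) {k : ℝ} (hk : 0 < k) (g p : ℝ) :
    |deriv f p + deriv W.H p * f p / ν ^ 2| * |g|
      ≤ W.dissipationDensity ν f p / (2 * k) + k / 2 * (f p * g ^ 2) := by
  rcases (h.nonneg p).eq_or_lt with h0 | h0
  · have hd : deriv f p = 0 := by
      refine IsLocalMin.deriv_eq_zero (Eventually.of_forall fun q => ?_)
      rw [← h0]; exact h.nonneg q
    rw [dissipationDensity, ← h0, hd]; simp
  · set w := deriv f p + deriv W.H p * f p / ν ^ 2 with hw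
    have e : W.dissipationDensity ν f p = w ^ 2 / f p := rfl
    rw [e, ← sq_abs w, ← sq_abs g]
    have key : |w| ^ 2 / f p / (2 * k) + k / 2 * (f p * |g| ^ 2) - |w| * |g|
        = (|w| - k * f p * |g|) ^ 2 / (2 * k * f p) := by
      field_simp; ring
    have : 0 ≤ (|w| - k * f p * |g|) ^ 2 / (2 * k * f p) := by positivity
    linarith

/-- Deviation of the mass between the minimum and `b` from its local equilibrium value. -/
lemma abs_integral_sub_le (h : W.FiniteDissipation ν f) {K k b P : ℝ} (hk : 0 < k)
    (hK : ∀ q ∈ uIcc P b, |∫ p in q..b, W.gibbs ν p| ≤ K * W.gibbs ν q) :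
    |∫ p in P..b, (f p - W.gibbs ν p * (f P / W.gibbs ν P))|
      ≤ (∫ p, W.dissipationDensity ν f p) / (2 * k) + k / 2 * K ^ 2 := by
  have cγ := W.continuous_gibbs ν
  have cf := h.continuous
  set u : ℝ → ℝ := fun q => f q / W.gibbs ν q with hu
  set u' : ℝ → ℝ := fun p => (deriv f p + deriv W.H p * f p / ν ^ 2) / W.gibbs ν p with hu'
  -- Integration by parts with this primitive of `-γ` has no boundary terms: `Γ b = 0`, and `u - u
  -- P` vanishes at `P`. Then `|Γ| ≤ K γ` reduces the integrand to `K` times the flux.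
  set Γ : ℝ → ℝ := fun q => ∫ p in q..b, W.gibbs ν p with hΓ
  have cu : Continuous u := h.continuous_rel
  have cu' : Continuous u' := h.continuous_deriv_rel
  have dΓ : ∀ q, HasDerivAt Γ (-W.gibbs ν q) q := fun q =>
    intervalIntegral.integral_hasDerivAt_left (cγ.intervalIntegrable _ _)
      (cγ.stronglyMeasurableAtFilter _ _) cγ.continuousAt
  have cΓ : Continuous Γ := continuous_iff_continuousAt.2 fun q => (dΓ q).continuousAt
  have hftc := intervalIntegral.integral_eq_sub_of_hasDerivAt (a := P) (b := b)
    (f := fun q => Γ q * (u q - u P)) (f' := fun q => -W.gibbs ν q * (u q - u P) + Γ q * u' q)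
    (fun q _ => (dΓ q).mul ((h.hasDerivAt q).sub_const _))
    (Continuous.intervalIntegrable (by fun_prop) _ _)
  have hΓb : Γ b = 0 := by simp [hΓ]
  rw [hΓb, sub_self, mul_zero, zero_mul, sub_zero, intervalIntegral.integral_add
    (Continuous.intervalIntegrable (by fun_prop) _ _)
    (Continuous.intervalIntegrable (by fun_prop) _ _)] at hftc
  have e : ∫ p in P..b, (f p - W.gibbs ν p * (f P / W.gibbs ν P)) = ∫ q in P..b, Γ q * u' q := by
    have : (∫ p in P..b, (f p - W.gibbs ν p * (f P / W.gibbs ν P)))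
        = -∫ q in P..b, -W.gibbs ν q * (u q - u P) := by
      rw [← intervalIntegral.integral_neg]
      refine intervalIntegral.integral_congr fun p _ => ?_
      have := (W.gibbs_pos ν p).ne'
      simp only [hu]; field_simp
    rw [this]; linarith
  have hmaj : Integrable fun p => W.dissipationDensity ν f p / (2 * k) + k / 2 * (f p * K ^ 2) :=
    (h.integrable_dissipation.div_const _).add ((h.integrable.mul_const _).const_mul _)
  rw [e]
  calc |∫ q in P..b, Γ q * u' q| ≤ ∫ q in uIoc P b, ‖Γ q * u' q‖ :=
        by
          simpa only [Real.norm_eq_abs] using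
            intervalIntegral.norm_integral_le_integral_norm_uIoc (f := fun q => Γ q * u' q) (μ := volume)
    _ ≤ ∫ q in uIoc P b, (W.dissipationDensity ν f q / (2 * k) + k / 2 * (f q * K ^ 2)) := by
        refine setIntegral_mono_on ?_ hmaj.integrableOn measurableSet_uIoc fun q hq => ?_
        · exact ((cΓ.mul cu').norm.integrableOn_uIcc).mono_set uIoc_subset_uIcc
        · have hγ := W.gibbs_pos ν q
          refine le_trans ?_ (h.abs_flux_mul_le hk K q)
          rw [norm_mul, Real.norm_eq_abs, Real.norm_eq_abs, hu', abs_div, abs_of_pos hγ]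
          have h1 : |Γ q| ≤ |K| * W.gibbs ν q :=
            (hK q (uIoc_subset_uIcc hq)).trans (by gcongr; exact le_abs_self K)
          calc |Γ q| * (|deriv f q + deriv W.H q * f q / ν ^ 2| / W.gibbs ν q)
              ≤ |K| * W.gibbs ν q * (|deriv f q + deriv W.H q * f q / ν ^ 2| / W.gibbs ν q) := by
                gcongr
            _ = _ := by field_simp
    _ ≤ ∫ q, (W.dissipationDensity ν f q / (2 * k) + k / 2 * (f q * K ^ 2)) := by
        refine setIntegral_le_integral hmaj (ae_of_all _ fun q => ?_)
        have h1 := h.dissipationDensity_nonneg q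
        have h2 := h.nonneg q
        simp only [Pi.zero_apply]; positivity
    _ = _ := by
        rw [integral_add (h.integrable_dissipation.div_const _)
          ((h.integrable.mul_const _).const_mul _), integral_div, integral_const_mul,
          integral_mul_const, h.mass_one, one_mul]

/-- The minimum cuts the phase into a bounded inner and an unbounded outer piece, each contributing
one deviation; the outer one is a limit of bounded intervals with the same `K`. -/
lemma abs_mass_sub_le (h : W.FiniteDissipation ν f) (hν : 0 < ν) {K k : ℝ} (hk : 0 < k) (s : Well)
    (hK : ∀ b ∈ closure s.phase, ∀ q ∈ uIcc (W.P s) b,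
      |∫ p in q..b, W.gibbs ν p| ≤ K * W.gibbs ν q) :
    |(∫ p in s.phase, f p) - W.mu ν s * (f (W.P s) / W.gibbs ν (W.P s))|
      ≤ (∫ p, W.dissipationDensity ν f p) / k + k * K ^ 2 := by
  set G : ℝ → ℝ := fun p => f p - W.gibbs ν p * (f (W.P s) / W.gibbs ν (W.P s)) with hG
  set B := (∫ p, W.dissipationDensity ν f p) / (2 * k) + k / 2 * K ^ 2 with hB
  have hγ := (W.integrable_gibbs hν).mul_const (f (W.P s) / W.gibbs ν (W.P s))
  have hGi : Integrable G := h.integrable.sub hγ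
  have e1 : (∫ p in s.phase, f p) - W.mu ν s * (f (W.P s) / W.gibbs ν (W.P s))
      = ∫ p in s.phase, G p := by
    rw [hG, integral_sub h.integrable.integrableOn hγ.integrableOn, integral_mul_const, mu]
  have hb : ∀ b ∈ closure s.phase, |∫ p in (W.P s)..b, G p| ≤ B := fun b hb =>
    h.abs_integral_sub_le hk (hK b hb)
  have e2 : (∫ p, W.dissipationDensity ν f p) / k + k * K ^ 2 = B + B := by
    rw [hB]; field_simp; ring
  rw [e1, e2]
  cases s with
  | minus =>
    have hlim := (intervalIntegral_tendsto_integral_Iic (W.P .minus) hGi.integrableOn tendsto_id).abs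
    have h1 : |∫ p in Iic (W.P .minus), G p| ≤ B := by
      refine le_of_tendsto hlim ?_
      filter_upwards [eventually_le_atBot 0] with b hb0
      rw [id, intervalIntegral.integral_symm, abs_neg]
      exact hb b (by simpa [Well.phase] using hb0)
    have h2 := hb 0 (by simp [Well.phase])
    have e3 : ∫ p in Well.minus.phase, G p
        = (∫ p in Iic (W.P .minus), G p) + ∫ p in (W.P .minus)..0, G p := by
      rw [Well.phase, ← integral_Iic_eq_integral_Iio,
        intervalIntegral.integral_Iic_sub_Iic hGi.integrableOn hGi.integrableOn |>.symm]
      ring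
    rw [e3]
    exact (abs_add_le _ _).trans (add_le_add h1 h2)
  | plus =>
    have hlim := (intervalIntegral_tendsto_integral_Ioi (W.P .plus) hGi.integrableOn tendsto_id).abs
    have h1 : |∫ p in Ioi (W.P .plus), G p| ≤ B := by
      refine le_of_tendsto hlim ?_
      filter_upwards [eventually_ge_atTop 0] with b hb0
      exact hb b (by simpa [Well.phase] using hb0)
    have h2 := hb 0 (by simp [Well.phase])
    have e3 : ∫ p in Well.plus.phase, G p
        = -(∫ p in (W.P .plus)..0, G p) + ∫ p in Ioi (W.P .plus), G p := by
      rw [Well.phase, ← intervalIntegral.integral_symm,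
        intervalIntegral.integral_interval_add_Ioi hGi.integrableOn hGi.integrableOn]
    rw [e3]
    refine (abs_add_le _ _).trans (add_le_add ?_ h1)
    rw [abs_neg]; exact h2

lemma integral_inv_gibbs_le (s : Well) :
    ∫ p in uIoc (W.P s) 0, 1 / W.gibbs ν p ≤ W.eta ν := by
  rw [eta_eq, intervalIntegral.integral_of_le W.P_minus_lt_P_plus.le]
  refine setIntegral_mono_set ?_ (ae_of_all _ fun p => by
    have := W.gibbs_pos ν p
    simp only [Pi.zero_apply]; positivity) (LE.le.eventuallyLE ?_)
  · exact (W.continuous_inv_gibbs ν).integrableOn_Ioc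
  · have h1 := W.P_minus_neg.le
    have h2 := W.P_plus_pos.le
    cases s with
    | minus => rw [uIoc_of_le h1]; exact Ioc_subset_Ioc_right h2
    | plus => rw [uIoc_of_ge h2]; exact Ioc_subset_Ioc_left h1

/-- Between a minimum and the barrier, the relative density is controlled by its value at the
minimum and by the dissipation. -/
lemma rel_le (h : W.FiniteDissipation ν f) (s : Well) {p : ℝ} (hp : p ∈ uIcc (W.P s) 0) :
    f p / W.gibbs ν p ≤ 2 * (f (W.P s) / W.gibbs ν (W.P s))
      + W.eta ν * ∫ p, W.dissipationDensity ν f p := by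
  set u : ℝ → ℝ := fun q => f q / W.gibbs ν q with hu
  set u' : ℝ → ℝ := fun p => (deriv f p + deriv W.H p * f p / ν ^ 2) / W.gibbs ν p with hu'
  have cu : Continuous u := h.continuous_rel
  have cu' : Continuous u' := h.continuous_deriv_rel
  have hη := W.eta_pos ν
  have hu0 : ∀ q, 0 ≤ u q := fun q => div_nonneg (h.nonneg q) (W.gibbs_pos ν q).le
  -- The increment of `u` up to its maximum point `x` will be bounded by a dissipation term plus `u
  -- x / 2`, and the latter is absorbed.
  obtain ⟨x, hx, hmax⟩ := (isCompact_uIcc (a := W.P s) (b := 0)).exists_isMaxOn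
    nonempty_uIcc cu.continuousOn
  have hftc := intervalIntegral.integral_eq_sub_of_hasDerivAt (a := W.P s) (b := x)
    (f := u) (f' := u') (fun q _ => h.hasDerivAt q) (cu'.intervalIntegrable _ _)
  have hsub : uIoc (W.P s) x ⊆ uIoc (W.P s) 0 := by
    have h1 := W.P_minus_neg.le
    have h2 := W.P_plus_pos.le
    cases s with
    | minus =>
      rw [uIcc_of_le h1] at hx
      rw [uIoc_of_le h1, uIoc_of_le hx.1]
      exact Ioc_subset_Ioc_right hx.2
    | plus =>
      rw [uIcc_of_ge h2] at hx
      rw [uIoc_of_ge h2, uIoc_of_ge hx.2]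
      exact Ioc_subset_Ioc_left hx.1
  have hinv : IntegrableOn (fun q => 1 / W.gibbs ν q) (uIoc (W.P s) 0) :=
    ((W.continuous_inv_gibbs ν).integrableOn_uIcc).mono_set uIoc_subset_uIcc
  have hmajD : IntegrableOn (fun q => W.eta ν / 2 * W.dissipationDensity ν f q) (uIoc (W.P s) 0) :=
    (h.integrable_dissipation.const_mul _).integrableOn
  have hmajI : IntegrableOn (fun q => u x / (2 * W.eta ν) * (1 / W.gibbs ν q)) (uIoc (W.P s) 0) :=
    hinv.const_mul _
  have hpt : ∀ q ∈ uIoc (W.P s) 0, ‖u' q‖ ≤ W.eta ν / 2 * W.dissipationDensity ν f q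
      + u x / (2 * W.eta ν) * (1 / W.gibbs ν q) := by
    intro q hq
    have hγ := W.gibbs_pos ν q
    -- With `k = 1 / η` the second Young term integrates to at most half the maximum of `u`, because
    -- `∫ 1 / γ ≤ η` on the segment.
    have h1 := h.abs_flux_mul_le (k := 1 / W.eta ν) (by positivity) (1 / W.gibbs ν q) q
    rw [abs_of_pos (by positivity : 0 < 1 / W.gibbs ν q), mul_one_div] at h1
    rw [Real.norm_eq_abs, hu', abs_div, abs_of_pos hγ]
    refine h1.trans (add_le_add (le_of_eq (by field_simp)) ?_)
    have h2 : u q ≤ u x := hmax (uIoc_subset_uIcc hq)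
    calc 1 / W.eta ν / 2 * (f q * (1 / W.gibbs ν q) ^ 2)
        = u q / (2 * W.eta ν) * (1 / W.gibbs ν q) := by simp only [hu]; field_simp
      _ ≤ _ := by gcongr
  have hbound : |u x - u (W.P s)| ≤ W.eta ν / 2 * (∫ p, W.dissipationDensity ν f p) + u x / 2 := by
    rw [← hftc]
    calc |∫ q in (W.P s)..x, u' q| ≤ ∫ q in uIoc (W.P s) x, ‖u' q‖ :=
          by
          simpa only [Real.norm_eq_abs] using
            intervalIntegral.norm_integral_le_integral_norm_uIoc (f := u') (μ := volume)
      _ ≤ ∫ q in uIoc (W.P s) 0, ‖u' q‖ :=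
          setIntegral_mono_set (cu'.norm.integrableOn_uIcc.mono_set uIoc_subset_uIcc)
            (ae_of_all _ fun q => norm_nonneg _) (LE.le.eventuallyLE hsub)
      _ ≤ ∫ q in uIoc (W.P s) 0, (W.eta ν / 2 * W.dissipationDensity ν f q
            + u x / (2 * W.eta ν) * (1 / W.gibbs ν q)) :=
          setIntegral_mono_on (cu'.norm.integrableOn_uIcc.mono_set uIoc_subset_uIcc)
            (hmajD.add hmajI) measurableSet_uIoc hpt
      _ = W.eta ν / 2 * (∫ q in uIoc (W.P s) 0, W.dissipationDensity ν f q)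
            + u x / (2 * W.eta ν) * ∫ q in uIoc (W.P s) 0, 1 / W.gibbs ν q := by
          rw [integral_add hmajD hmajI, integral_const_mul, integral_const_mul]
      _ ≤ W.eta ν / 2 * (∫ p, W.dissipationDensity ν f p) + u x / (2 * W.eta ν) * W.eta ν := by
          have := hu0 x
          exact add_le_add (mul_le_mul_of_nonneg_left (setIntegral_le_integral
            h.integrable_dissipation (ae_of_all _ h.dissipationDensity_nonneg)) (by positivity))
            (mul_le_mul_of_nonneg_left (integral_inv_gibbs_le s) (by positivity))
      _ = _ := by field_simp
  have h1 := (abs_le.1 hbound).2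
  have h2 : u p ≤ u x := hmax hp
  change u p ≤ 2 * u (W.P s) + _
  linarith

end FiniteDissipation

end DoubleWell

namespace DoubleWell

variable {W : DoubleWell} {ν : ℝ} {ρ : ℝ → ℝ → ℝ} {f : ℝ → ℝ}

/-! ### The moment weight in the wrong phase -/

lemma weight_le_one (s : Well) (p : ℝ) : W.weight ν s p ≤ 1 := by
  cases s with
  | minus => simpa [weight] using psi_nonneg p
  | plus => exact psi_le_one p

lemma weight_nonneg (s : Well) (p : ℝ) : 0 ≤ W.weight ν s p := by
  cases s with
  | minus => simpa [weight] using psi_le_one p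
  | plus => exact psi_nonneg p

lemma continuous_weight (s : Well) : Continuous (W.weight ν s) := by
  cases s with
  | minus => exact continuous_const.sub continuous_psi
  | plus => exact continuous_psi

lemma integrable_weight_mul (hf : Integrable f) (s : Well) :
    Integrable fun p => W.weight ν s p * f p := by
  refine hf.bdd_mul (c := 1) (continuous_weight s).aestronglyMeasurable (ae_of_all _ fun p => ?_)
  rw [Real.norm_eq_abs, abs_of_nonneg (weight_nonneg s p)]
  exact weight_le_one s p

lemma one_sub_weight_eq_zero (s : Well) {p : ℝ} (hp : p ∈ s.phase) (hp' : p ∉ uIoc (W.P s) 0) :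
    1 - W.weight ν s p = 0 := by
  cases s with
  | minus =>
    rw [uIoc_of_le W.P_minus_neg.le] at hp'
    have h1 : p ≤ W.P .minus := by
      by_contra h
      exact hp' ⟨not_le.1 h, le_of_lt hp⟩
    simp [weight, psi_of_le h1]
  | plus =>
    rw [uIoc_of_ge W.P_plus_pos.le] at hp'
    have h1 : W.P .plus ≤ p := by
      by_contra h
      exact hp' ⟨hp, (not_le.1 h).le⟩
    simp [weight, psi_of_ge h1]

/-- The defect of the weight is the integral of `1 / (η γ)` from the minimum to `p`, and `1 / γ`
increases towards the barrier, so its value at `p` dominates. -/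
lemma one_sub_weight_mul_gibbs_le (s : Well) {p : ℝ} (hp : p ∈ uIcc (W.P s) 0) :
    (1 - W.weight ν s p) * W.gibbs ν p ≤ |W.P s| / W.eta ν := by
  have hη := W.eta_pos ν
  have hγ := W.gibbs_pos ν p
  have h1 : 1 - W.weight ν s p = |∫ q in (W.P s)..p, 1 / (W.eta ν * W.gibbs ν q)| := by
    have h0 : 0 ≤ 1 - W.weight ν s p := sub_nonneg.2 (weight_le_one s p)
    rw [← abs_of_nonneg h0]
    cases s with
    | minus =>
      rw [uIcc_of_le W.P_minus_neg.le] at hp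
      have hm : p ∈ Icc (W.P .minus) (W.P .plus) := ⟨hp.1, hp.2.trans W.P_plus_pos.le⟩
      simp only [weight, psi_of_mem hm, sub_sub_cancel, psiInner]
    | plus =>
      rw [uIcc_of_ge W.P_plus_pos.le] at hp
      have hm : p ∈ Icc (W.P .minus) (W.P .plus) := ⟨W.P_minus_neg.le.trans hp.1, hp.2⟩
      have h2 := psiInner_P_plus (W := W) (ν := ν)
      have h3 : W.psiInner ν p - W.psiInner ν (W.P .plus)
          = ∫ q in (W.P .plus)..p, 1 / (W.eta ν * W.gibbs ν q) :=
        intervalIntegral.integral_interval_sub_left (continuous_inv_eta_gibbs.intervalIntegrable _ _)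
          (continuous_inv_eta_gibbs.intervalIntegrable _ _)
      rw [← h3, h2]
      simp only [weight, psi_of_mem hm]
      rw [abs_sub_comm]
  have h2 : ∀ q ∈ uIoc (W.P s) p, ‖1 / (W.eta ν * W.gibbs ν q)‖ ≤ 1 / (W.eta ν * W.gibbs ν p) := by
    intro q hq
    have hγq := W.gibbs_pos ν q
    rw [Real.norm_eq_abs, abs_of_pos (by positivity)]
    have := gibbs_le_gibbs_of_le (ν := ν) (H_le_of_inner s hp (uIoc_subset_uIcc hq))
    gcongr
  have h3 : |∫ q in (W.P s)..p, 1 / (W.eta ν * W.gibbs ν q)|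
      ≤ 1 / (W.eta ν * W.gibbs ν p) * |p - W.P s| :=
    intervalIntegral.norm_integral_le_of_norm_le_const h2
  have h4 : |p - W.P s| ≤ |W.P s| := by
    have := abs_sub_left_of_mem_uIcc hp
    rwa [zero_sub, abs_neg] at this
  rw [h1]
  calc _ ≤ 1 / (W.eta ν * W.gibbs ν p) * |W.P s| * W.gibbs ν p := by
        gcongr
        exact h3.trans (by gcongr)
    _ = _ := by field_simp

namespace FiniteDissipation

lemma rel_nonneg (h : W.FiniteDissipation ν f) (p : ℝ) : 0 ≤ f p / W.gibbs ν p :=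
  div_nonneg (h.nonneg p) (W.gibbs_pos ν p).le

lemma dissipation_nonneg (h : W.FiniteDissipation ν f) : 0 ≤ ∫ p, W.dissipationDensity ν f p :=
  integral_nonneg h.dissipationDensity_nonneg

lemma integral_one_sub_weight_nonneg (h : W.FiniteDissipation ν f) (s : Well) :
    0 ≤ ∫ p in s.phase, (1 - W.weight ν s p) * f p :=
  integral_nonneg fun p => mul_nonneg (sub_nonneg.2 (weight_le_one s p)) (h.nonneg p)

/-- Writing the integrand as `(1 - weight) γ · (f / γ)`, each factor is bounded between minimum and
barrier, while the defect vanishes on the rest of the phase. The two factors `|P s|` are the length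
of this interval and the bound for the defect. -/
lemma integral_one_sub_weight_le (h : W.FiniteDissipation ν f) (s : Well) :
    ∫ p in s.phase, (1 - W.weight ν s p) * f p
      ≤ W.P s ^ 2 * (2 * (f (W.P s) / W.gibbs ν (W.P s)) / W.eta ν
        + ∫ p, W.dissipationDensity ν f p) := by
  have hη := W.eta_pos ν
  set D := ∫ p, W.dissipationDensity ν f p with hD
  have hD0 : 0 ≤ D := h.dissipation_nonneg
  have hu0 := h.rel_nonneg (W.P s)
  set U := 2 * (f (W.P s) / W.gibbs ν (W.P s)) + W.eta ν * D with hU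
  have hU0 : 0 ≤ U := by positivity
  set C := |W.P s| / W.eta ν * U with hC
  have hC0 : 0 ≤ C := by positivity
  have hi : Integrable fun p => (1 - W.weight ν s p) * f p := by
    have := h.integrable.sub (integrable_weight_mul (W := W) (ν := ν) h.integrable s)
    refine this.congr (ae_of_all _ fun p => ?_)
    simp only [Pi.sub_apply]; ring
  have hci : Integrable ((uIoc (W.P s) 0).indicator fun _ => C) := by
    rw [integrable_indicator_iff measurableSet_uIoc]
    exact integrableOn_const (by simp [uIoc])
  calc ∫ p in s.phase, (1 - W.weight ν s p) * f p
      ≤ ∫ p in s.phase, (uIoc (W.P s) 0).indicator (fun _ => C) p := by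
        refine setIntegral_mono_on hi.integrableOn hci.integrableOn (measurableSet_phase s)
          fun p hp => ?_
        by_cases hp' : p ∈ uIoc (W.P s) 0
        · rw [indicator_of_mem hp']
          have h1 := h.rel_le s (uIoc_subset_uIcc hp')
          have h2 := one_sub_weight_mul_gibbs_le (ν := ν) s (uIoc_subset_uIcc hp')
          have h3 := h.rel_nonneg p
          have hγ := W.gibbs_pos ν p
          calc (1 - W.weight ν s p) * f p
              = (1 - W.weight ν s p) * W.gibbs ν p * (f p / W.gibbs ν p) := by field_simp
            _ ≤ |W.P s| / W.eta ν * U := by gcongr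
        · rw [indicator_of_notMem hp', one_sub_weight_eq_zero s hp hp', zero_mul]
    _ ≤ ∫ p, (uIoc (W.P s) 0).indicator (fun _ => C) p :=
        setIntegral_le_integral hci (ae_of_all _ fun p => indicator_nonneg (fun _ _ => hC0) p)
    _ = |W.P s| * C := by
        rw [integral_indicator measurableSet_uIoc, setIntegral_const, smul_eq_mul]
        congr 1
        rw [uIoc, Real.volume_real_Ioc_of_le inf_le_sup, max_sub_min_eq_abs, zero_sub, abs_neg]
    _ = _ := by
        rw [hC, hU, ← sq_abs (W.P s)]; field_simp

/-- In each phase the two weights add up to `1`, so the weight of the opposite well is the own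
defect. The difference is therefore one defect integral minus the other. -/
lemma abs_massTilde_sub_mass_le {t : ℝ} (h : W.FiniteDissipation ν (ρ t)) (s : Well) :
    |W.massTilde ν ρ s t - mass ρ s t|
      ≤ (∫ p in Well.minus.phase, (1 - W.weight ν .minus p) * ρ t p)
        + ∫ p in Well.plus.phase, (1 - W.weight ν .plus p) * ρ t p := by
  have h1 := h.integral_one_sub_weight_nonneg .minus
  have h2 := h.integral_one_sub_weight_nonneg .plus
  have hi := fun s => integrable_weight_mul (W := W) (ν := ν) h.integrable s
  have hsplit : ∀ s' : Well, ∫ p in s'.phase, (1 - W.weight ν s' p) * ρ t p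
      = (∫ p in s'.phase, ρ t p) - ∫ p in s'.phase, W.weight ν s' p * ρ t p := by
    intro s'
    simp_rw [sub_mul, one_mul]
    exact integral_sub h.integrable.integrableOn (hi s').integrableOn
  have htot : ∀ g : ℝ → ℝ, Integrable g → ∫ p, g p
      = (∫ p in Well.minus.phase, g p) + ∫ p in Well.plus.phase, g p := by
    intro g hg
    rw [Well.phase, Well.phase, ← integral_Iic_eq_integral_Iio,
      intervalIntegral.integral_Iic_add_Ioi hg.integrableOn hg.integrableOn]
  have hw : ∀ s' : Well, ∫ p in s'.phase, W.weight ν .minus p * ρ t p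
      = (∫ p in s'.phase, ρ t p) - ∫ p in s'.phase, W.weight ν .plus p * ρ t p := by
    intro s'
    simp only [weight, sub_mul, one_mul]
    exact integral_sub h.integrable.integrableOn (hi .plus).integrableOn
  rw [massTilde, mass, htot _ (hi s)]
  cases s with
  | minus =>
    have e1 := hsplit .minus
    have e2 := hsplit .plus
    have e3 := hw .plus
    rw [abs_le]
    constructor <;> linarith
  | plus =>
    have e1 := hsplit .minus
    have e2 := hsplit .plus
    have e3 := hw .minus
    rw [abs_le]
    constructor <;> linarith

end FiniteDissipation

/-! ### The dissipation bounds the error -/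

/-- Exponential smallness of `τ` beats powers of `ν`; the bound `exp (-x) ≤ 2 / x²` is sufficient
here. -/
lemma exists_sqrt_tau_le (W : DoubleWell) :
    ∃ B > 0, ∀ ν : ℝ, 0 < ν → Real.sqrt (W.tau ν) ≤ B * ν ^ 2 := by
  have h0 := W.omegaZero_pos
  have h1 := W.omega_pos .minus
  have h2 := W.h_pos .minus
  refine ⟨Real.sqrt (W.omegaZero * W.omega .minus * (2 / W.h .minus ^ 2)), by positivity,
    fun ν hν => ?_⟩
  have e : Real.sqrt (W.omegaZero * W.omega .minus * (2 / W.h .minus ^ 2)) * ν ^ 2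
      = Real.sqrt (W.omegaZero * W.omega .minus * (2 / W.h .minus ^ 2) * (ν ^ 2) ^ 2) := by
    rw [Real.sqrt_mul' _ (sq_nonneg (ν ^ 2)), Real.sqrt_sq (by positivity)]
  rw [e]
  refine Real.sqrt_le_sqrt ?_
  rw [tau]
  have h3 : Real.exp (-W.h .minus / ν ^ 2) ≤ 2 / W.h .minus ^ 2 * (ν ^ 2) ^ 2 := by
    have h4 : 0 < W.h .minus / ν ^ 2 := by positivity
    have h5 := Real.quadratic_le_exp_of_nonneg h4.le
    rw [neg_div, Real.exp_neg, inv_le_comm₀ (Real.exp_pos _) (by positivity)]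
    have e2 : (2 / W.h .minus ^ 2 * (ν ^ 2) ^ 2)⁻¹ = (W.h .minus / ν ^ 2) ^ 2 / 2 := by
      field_simp
    rw [e2]; linarith
  calc _ ≤ W.omegaZero * W.omega .minus * (2 / W.h .minus ^ 2 * (ν ^ 2) ^ 2) := by gcongr
    _ = _ := by ring

/-- For the minus well this is the lower bound on `1 + θ`. The plus well costs the factor `κ`, which
stays bounded because `h₋ ≤ h₊`. -/
lemma exists_inv_eta_mu_le (W : DoubleWell) : ∃ A > 0, ∃ ν₀ > 0, ν₀ ≤ 1 ∧
    ∀ ν : ℝ, 0 < ν → ν < ν₀ → ∀ s : Well, 1 / (W.eta ν * W.mu ν s) ≤ A * (W.tau ν / ν ^ 2) := by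
  obtain ⟨C, hC, ν₀, hν₀, hν₀1, hCν₀, hall⟩ := W.exists_elementary_asymptotics
  have hw := W.omega_pos .minus
  have hw' := W.omega_pos .plus
  refine ⟨2 + 4 * (W.omega .plus / W.omega .minus), by positivity, ν₀, hν₀, hν₀1, ?_⟩
  intro ν hν hνν s
  have h := hall ν hν hνν s
  have hCν : C * ν ^ 2 ≤ 1 / 2 := by
    refine le_trans ?_ hCν₀; gcongr
  set a1 := |W.theta ν|
  have hη := W.eta_pos ν
  have hτ := W.tau_pos ν
  have hμ := W.mu_pos hν .minus
  have hμ' := W.mu_pos hν .plus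
  have n1 := abs_nonneg (W.theta ν)
  have n2 := abs_nonneg (W.eta ν * (W.omegaZero / ν) - 1)
  have n3 := abs_nonneg (W.mu ν s * (W.omega s / ν) * Real.exp (-W.h s / ν ^ 2) - 1)
  have n4 := abs_nonneg (W.kappa ν * (W.omega .minus / W.omega .plus)
              * Real.exp ((W.h .plus - W.h .minus) / ν ^ 2) - 1)
  have hθ : |W.theta ν| ≤ 1 / 2 := by linarith
  have hκ : |W.kappa ν * (W.omega .minus / W.omega .plus)
              * Real.exp ((W.h .plus - W.h .minus) / ν ^ 2) - 1| ≤ 1 / 2 := by linarith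
  have h1 : 1 / 2 ≤ W.tau ν * W.mu ν .minus * W.eta ν / ν ^ 2 := by
    have := (abs_le.1 hθ).1
    rw [theta] at this
    linarith
  have hm : 1 / (W.eta ν * W.mu ν .minus) ≤ 2 * (W.tau ν / ν ^ 2) := by
    rw [div_le_iff₀ (by positivity)]
    have e : 2 * (W.tau ν / ν ^ 2) * (W.eta ν * W.mu ν .minus)
        = 2 * (W.tau ν * W.mu ν .minus * W.eta ν / ν ^ 2) := by ring
    rw [e]; linarith
  have hκ2 : W.kappa ν ≤ 2 * (W.omega .plus / W.omega .minus) := by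
    have h2 := (abs_le.1 hκ).2
    have hκ0 : 0 < W.kappa ν := div_pos hμ hμ'
    have h3 : 1 ≤ Real.exp ((W.h .plus - W.h .minus) / ν ^ 2) := by
      refine Real.one_le_exp (div_nonneg ?_ (by positivity))
      have := W.barrier_le
      simp only [DoubleWell.h]; linarith
    have h4 : W.kappa ν * (W.omega .minus / W.omega .plus) ≤ 2 := by
      have h5 : W.kappa ν * (W.omega .minus / W.omega .plus) * 1
          ≤ W.kappa ν * (W.omega .minus / W.omega .plus)
              * Real.exp ((W.h .plus - W.h .minus) / ν ^ 2) := by gcongr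
      linarith
    have e : W.kappa ν = W.kappa ν * (W.omega .minus / W.omega .plus) * (W.omega .plus / W.omega .minus) := by
      field_simp
    rw [e]
    gcongr
  have hτν : 0 < W.tau ν / ν ^ 2 := by positivity
  have hq : 0 < W.omega .plus / W.omega .minus := by positivity
  cases s with
  | minus =>
    refine hm.trans ?_
    gcongr
    linarith
  | plus =>
    have e : 1 / (W.eta ν * W.mu ν .plus) = W.kappa ν * (1 / (W.eta ν * W.mu ν .minus)) := by
      rw [kappa]; field_simp
    rw [e]
    calc _ ≤ 2 * (W.omega .plus / W.omega .minus) * (2 * (W.tau ν / ν ^ 2)) := by gcongr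
      _ = 4 * (W.omega .plus / W.omega .minus) * (W.tau ν / ν ^ 2) := by ring
      _ ≤ _ := by gcongr; linarith

/-- With `T = τ^(1/2) / ν²` and `Y = D / T` the target is a multiple of `Y + T`. The Young parameter
is `T`, and products such as `T Y` and `T²` are reduced to linear terms by `T ≤ B`. -/
theorem exists_error_bound (W : DoubleWell) : ∃ C > 0, ∃ ν₀ > 0, ∀ ν : ℝ, 0 < ν → ν < ν₀ →
    ∀ (ρ : ℝ → ℝ → ℝ) (t : ℝ), W.FiniteDissipation ν (ρ t) → ∀ s : Well,
      |W.massTilde ν ρ s t - mass ρ s t| + |W.massBar ν ρ s t - mass ρ s t|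
        ≤ C * (W.tau ν ^ (-(1 / 2) : ℝ) * ν ^ 2 * (∫ p, W.dissipationDensity ν (ρ t) p)
            + W.tau ν ^ ((1 / 2) : ℝ) / ν ^ 2) := by
  obtain ⟨K, hK, hKb⟩ := W.exists_tail_bound
  obtain ⟨B, hB, hBb⟩ := W.exists_sqrt_tau_le
  obtain ⟨A, hA, ν₀, hν₀, hν₀1, hAb⟩ := W.exists_inv_eta_mu_le
  -- The coefficients that arise when `2 m̄ / (η μ) + D` is expanded with `m̄ ≤ 1 + Y + T K²`, `1 /
  -- (η μ) ≤ A B T` and `D ≤ B Y`.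
  set Q := 2 * A * B + 2 * A * B ^ 2 + 2 * A * B ^ 2 * K ^ 2 + B with hQ
  have hQ0 : 0 < Q := by positivity
  refine ⟨(W.P .minus ^ 2 + W.P .plus ^ 2) * Q + (1 + K ^ 2), by positivity, ν₀, hν₀, ?_⟩
  intro ν hν hνν ρ t h s
  have hν1 : ν ≤ 1 := hνν.le.trans hν₀1
  have hτ := W.tau_pos ν
  have hη := W.eta_pos ν
  set S := Real.sqrt (W.tau ν) with hS
  have hS0 : 0 < S := Real.sqrt_pos.2 hτ
  have hSB := hBb ν hν
  have hSsq : W.tau ν = S ^ 2 := (Real.sq_sqrt hτ.le).symm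
  set T := S / ν ^ 2 with hT
  have hT0 : 0 < T := by positivity
  have hTB : T ≤ B := by rw [hT, div_le_iff₀ (by positivity)]; exact hSB
  have hSB' : S ≤ B := hSB.trans (mul_le_of_le_one_right hB.le (pow_le_one₀ hν.le hν1))
  set D := ∫ p, W.dissipationDensity ν (ρ t) p with hD
  have hD0 : 0 ≤ D := h.dissipation_nonneg
  set Y := D / T with hY
  have hY0 : 0 ≤ Y := by positivity
  have hDY : D ≤ B * Y := by
    have : D = T * Y := by rw [hY]; field_simp
    rw [this]; gcongr
  have e1 : W.tau ν ^ ((1 / 2) : ℝ) = S := (Real.sqrt_eq_rpow _).symm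
  have e2 : W.tau ν ^ (-(1 / 2) : ℝ) = S⁻¹ := by rw [Real.rpow_neg hτ.le, e1]
  have hrhs : W.tau ν ^ (-(1 / 2) : ℝ) * ν ^ 2 * D + W.tau ν ^ ((1 / 2) : ℝ) / ν ^ 2 = Y + T := by
    rw [e1, e2, hY, hT]; field_simp
  rw [hrhs]
  have hbar : ∀ s : Well, |W.massBar ν ρ s t - mass ρ s t| ≤ Y + T * K ^ 2 := by
    intro s
    have := h.abs_mass_sub_le hν hT0 s (hKb ν hν hν1 s)
    rw [IsSolution.massBar_eq, relDensity, one_mul, abs_sub_comm]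
    exact this
  have hbar1 : ∀ s : Well, W.massBar ν ρ s t ≤ 1 + Y + T * K ^ 2 := by
    intro s
    have h1 := (abs_le.1 (hbar s)).2
    have h2 : mass ρ s t ≤ 1 := by
      rw [mass, ← h.mass_one]
      exact setIntegral_le_integral h.integrable (ae_of_all _ h.nonneg)
    linarith
  have hX : ∀ s : Well, ∫ p in s.phase, (1 - W.weight ν s p) * ρ t p
      ≤ W.P s ^ 2 * (Q * (Y + T)) := by
    intro s
    refine (h.integral_one_sub_weight_le s).trans ?_
    have hμ := W.mu_pos hν s
    have e3 : 2 * (ρ t (W.P s) / W.gibbs ν (W.P s)) / W.eta ν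
        = 2 * W.massBar ν ρ s t * (1 / (W.eta ν * W.mu ν s)) := by
      rw [IsSolution.massBar_eq, relDensity, one_mul]; field_simp
    rw [e3]
    have ha : 1 / (W.eta ν * W.mu ν s) ≤ A * B * T := by
      refine (hAb ν hν hνν s).trans ?_
      have : W.tau ν / ν ^ 2 = S * T := by rw [hSsq, hT]; ring
      rw [this, mul_assoc]
      gcongr
    have hm0 : 0 ≤ 1 + Y + T * K ^ 2 := by positivity
    gcongr
    calc 2 * W.massBar ν ρ s t * (1 / (W.eta ν * W.mu ν s)) + D
        ≤ 2 * (1 + Y + T * K ^ 2) * (A * B * T) + B * Y := by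
          have := hbar1 s
          gcongr
      _ = 2 * A * B * T + 2 * A * B * T * Y + 2 * A * B * K ^ 2 * T * T + B * Y := by ring
      _ ≤ 2 * A * B * T + 2 * A * B * B * Y + 2 * A * B * K ^ 2 * B * T + B * Y := by gcongr
      _ ≤ Q * (Y + T) := by
          rw [hQ]
          have p1 : 0 ≤ A * B * Y := by positivity
          have p2 : 0 ≤ A * B ^ 2 * T := by positivity
          have p3 : 0 ≤ A * B ^ 2 * K ^ 2 * Y := by positivity
          have p4 : 0 ≤ B * T := by positivity
          nlinarith
  have h1 := h.abs_massTilde_sub_mass_le s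
  have h2 := hX .minus
  have h3 := hX .plus
  have h4 := hbar s
  have h5 : Y + T * K ^ 2 ≤ (1 + K ^ 2) * (Y + T) := by nlinarith [mul_nonneg hY0 (sq_nonneg K)]
  calc _ ≤ (W.P .minus ^ 2 * (Q * (Y + T)) + W.P .plus ^ 2 * (Q * (Y + T))) + (1 + K ^ 2) * (Y + T) := by
        linarith
    _ = _ := by ring

/-- Infinite dissipation makes the right-hand side infinite, as its coefficient is positive;
otherwise the slice `ρ t` is a density of finite dissipation. -/
theorem exists_dissipation_bounds_error (W : DoubleWell) :
    ∃ C > 0, ∃ ν₀ > 0, ∀ ν : ℝ, 0 < ν → ν < ν₀ → ∀ ρ : ℝ → ℝ → ℝ, W.IsSolution ν ρ →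
      ∀ s : Well, ∀ t : ℝ, (0 < t ∨ t = 0 ∧ ContDiff ℝ 1 (ρ 0)) →
        ENNReal.ofReal (|W.massTilde ν ρ s t - mass ρ s t| + |W.massBar ν ρ s t - mass ρ s t|)
          ≤ ENNReal.ofReal C *
            (ENNReal.ofReal (W.tau ν ^ (-(1 / 2) : ℝ) * ν ^ 2) * W.dissipation ν ρ t
              + ENNReal.ofReal (W.tau ν ^ ((1 / 2) : ℝ) / ν ^ 2)) := by
  obtain ⟨C, hC, ν₀, hν₀, hall⟩ := W.exists_error_bound
  refine ⟨C, hC, ν₀, hν₀, fun ν hν hνν ρ h s t ht => ?_⟩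
  have hτ := W.tau_pos ν
  have ht0 : 0 ≤ t := by rcases ht with ht | ⟨rfl, -⟩ <;> linarith
  have hc1 : ContDiff ℝ 1 (ρ t) := by
    rcases ht with ht | ⟨rfl, h1⟩
    · exact (h.contDiff_slice ht).of_le (by norm_num)
    · exact h1
  have hpos : 0 < W.tau ν ^ (-(1 / 2) : ℝ) * ν ^ 2 := by positivity
  by_cases htop : W.dissipation ν ρ t = ⊤
  · have : ENNReal.ofReal C * (ENNReal.ofReal (W.tau ν ^ (-(1 / 2) : ℝ) * ν ^ 2) * W.dissipation ν ρ t
              + ENNReal.ofReal (W.tau ν ^ ((1 / 2) : ℝ) / ν ^ 2)) = ⊤ := by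
      rw [htop, ENNReal.mul_top (by simpa using hpos), top_add, ENNReal.mul_top (by simpa using hC)]
    rw [this]; exact le_top
  · have hmeas : Measurable (W.dissipationDensity ν (ρ t)) := by
      have h1 := (hc1.continuous_deriv (by norm_num)).measurable
      have h2 := hc1.continuous.measurable
      have h3 := W.continuous_deriv_H.measurable
      unfold dissipationDensity; fun_prop
    have hd0 : ∀ p, 0 ≤ W.dissipationDensity ν (ρ t) p :=
      fun p => div_nonneg (sq_nonneg _) (h.nonneg t ht0 p)
    have hint : Integrable (W.dissipationDensity ν (ρ t)) := by
      refine ⟨hmeas.aestronglyMeasurable, ?_⟩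
      rw [hasFiniteIntegral_iff_ofReal (ae_of_all _ hd0)]
      exact lt_top_iff_ne_top.2 htop
    have hFD : W.FiniteDissipation ν (ρ t) :=
      ⟨hc1, h.nonneg t ht0, h.integrable t ht0, h.mass_one t ht0, hint⟩
    have hD : W.dissipation ν ρ t = ENNReal.ofReal (∫ p, W.dissipationDensity ν (ρ t) p) :=
      (ofReal_integral_eq_lintegral_ofReal hint (ae_of_all _ hd0)).symm
    have hDn := hFD.dissipation_nonneg
    rw [hD, ← ENNReal.ofReal_mul hpos.le, ← ENNReal.ofReal_add (by positivity) (by positivity),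
      ← ENNReal.ofReal_mul hC.le]
    exact ENNReal.ofReal_le_ofReal (hall ν hν hνν ρ t hFD s)

end DoubleWell

/-! ### A regularization of the Boltzmann entropy -/

/-- A regularization of `v log v - v` with bounded derivative. -/
noncomputable def regEntropy (ε v : ℝ) : ℝ :=
  (v + ε) * Real.log (v + ε) - ε * Real.log ε - 1 / ε * ((1 + ε * v) * Real.log (1 + ε * v))

/-- The first derivative of `regEntropy`. -/
noncomputable def regEntropyDeriv (ε v : ℝ) : ℝ := Real.log (v + ε) - Real.log (1 + ε * v)

/-- The second derivative of `regEntropy`. -/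
noncomputable def regEntropyDeriv₂ (ε v : ℝ) : ℝ := 1 / (v + ε) - ε / (1 + ε * v)

section RegEntropy

variable {ε v : ℝ}

lemma renormalization_regEntropy (hε : 0 < ε) :
    Renormalization (regEntropy ε) (regEntropyDeriv ε) (regEntropyDeriv₂ ε) := by
  refine ⟨fun v hv => ?_, fun v hv => ?_, ?_⟩
  · have h1 : v + ε ≠ 0 := by positivity
    have h2 : 1 + ε * v ≠ 0 := by positivity
    have d1 : HasDerivAt (fun v => v + ε) 1 v := (hasDerivAt_id v).add_const ε
    have d2 : HasDerivAt (fun v => 1 + ε * v) (ε * 1) v := ((hasDerivAt_id v).const_mul ε).const_add 1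
    have := ((d1.mul (d1.log h1)).sub_const (ε * Real.log ε)).sub
      ((d2.mul (d2.log h2)).const_mul (1 / ε))
    convert! this using 1
    simp only [regEntropyDeriv]
    field_simp
    ring
  · have h1 : v + ε ≠ 0 := by positivity
    have h2 : 1 + ε * v ≠ 0 := by positivity
    have d1 : HasDerivAt (fun v => v + ε) 1 v := (hasDerivAt_id v).add_const ε
    have d2 : HasDerivAt (fun v => 1 + ε * v) (ε * 1) v := ((hasDerivAt_id v).const_mul ε).const_add 1
    have := (d1.log h1).sub (d2.log h2)
    convert! this using 1
    simp only [regEntropyDeriv₂, mul_one]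
  · unfold regEntropyDeriv₂
    refine ContinuousOn.sub (continuousOn_const.div (by fun_prop) fun v hv => ?_)
      (continuousOn_const.div (by fun_prop) fun v hv => ?_)
    · have : 0 ≤ v := hv
      positivity
    · have : 0 ≤ v := hv
      positivity

lemma regEntropy_zero (ε : ℝ) : regEntropy ε 0 = 0 := by simp [regEntropy]

lemma regEntropyDeriv₂_nonneg (hε : 0 < ε) (hε1 : ε ≤ 1) (hv : 0 ≤ v) :
    0 ≤ regEntropyDeriv₂ ε v := by
  have h : regEntropyDeriv₂ ε v = (1 - ε ^ 2) / ((v + ε) * (1 + ε * v)) := by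
    have h1 : v + ε ≠ 0 := by positivity
    have h2 : 1 + ε * v ≠ 0 := by positivity
    rw [regEntropyDeriv₂]; field_simp; ring
  rw [h]
  have : 0 ≤ 1 - ε ^ 2 := by nlinarith
  positivity

/-- The quotient `(v + ε) / (1 + ε v)` stays between `ε` and `1 / ε`. Hence the regularized entropy
is Lipschitz and dominated by a multiple of the density, which justifies cutoffs and the `L¹` limit
at the initial time. -/
lemma abs_regEntropyDeriv_le (hε : 0 < ε) (hε1 : ε ≤ 1) (hv : 0 ≤ v) :
    |regEntropyDeriv ε v| ≤ -Real.log ε := by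
  have h1 : 0 < v + ε := by positivity
  have h2 : 0 < 1 + ε * v := by positivity
  have hεε : ε * ε ≤ 1 := by nlinarith
  have e1 : Real.log ε + Real.log (1 + ε * v) ≤ Real.log (v + ε) := by
    rw [← Real.log_mul hε.ne' h2.ne']
    exact Real.log_le_log (by positivity) (by nlinarith)
  have e2 : Real.log ε + Real.log (v + ε) ≤ Real.log (1 + ε * v) := by
    rw [← Real.log_mul hε.ne' h1.ne']
    exact Real.log_le_log (by positivity) (by nlinarith)
  rw [regEntropyDeriv, abs_le]
  constructor <;> linarith

lemma abs_regEntropy_sub_le (hε : 0 < ε) (hε1 : ε ≤ 1) {v w : ℝ} (hv : 0 ≤ v) (hw : 0 ≤ w) :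
    |regEntropy ε v - regEntropy ε w| ≤ -Real.log ε * |v - w| :=
  (convex_Ici (0 : ℝ)).norm_image_sub_le_of_norm_hasDerivWithin_le
    (fun x hx => ((renormalization_regEntropy hε).hasDerivAt x hx).hasDerivWithinAt)
    (fun _ hx => abs_regEntropyDeriv_le hε hε1 hx) hw hv

lemma abs_regEntropy_le (hε : 0 < ε) (hε1 : ε ≤ 1) (hv : 0 ≤ v) :
    |regEntropy ε v| ≤ -Real.log ε * v := by
  simpa [regEntropy_zero, abs_of_nonneg hv] using abs_regEntropy_sub_le hε hε1 hv le_rfl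

lemma continuousOn_regEntropy (hε : 0 < ε) : ContinuousOn (regEntropy ε) (Ici 0) :=
  fun v hv => ((renormalization_regEntropy hε).hasDerivAt v hv).continuousAt.continuousWithinAt

/-- A function on `[0, ∞)` that decreases up to `1` and increases afterwards is minimal at `1`. -/
lemma min_at_one {f f' : ℝ → ℝ} (hc : ContinuousOn f (Ici 0))
    (hd : ∀ v, 0 < v → HasDerivAt f (f' v) v) (h1 : ∀ v, 0 < v → v < 1 → f' v ≤ 0)
    (h2 : ∀ v, 1 < v → 0 ≤ f' v) (hv : 0 ≤ v) : f 1 ≤ f v := by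
  rcases le_total v 1 with h | h
  · have : AntitoneOn f (Icc 0 1) := by
      refine antitoneOn_of_deriv_nonpos (convex_Icc 0 1) (hc.mono fun x hx => hx.1) ?_ ?_
      · intro x hx
        rw [interior_Icc] at hx
        exact (hd x hx.1).differentiableAt.differentiableWithinAt
      · intro x hx
        rw [interior_Icc] at hx
        rw [(hd x hx.1).deriv]; exact h1 x hx.1 hx.2
    exact this ⟨hv, h⟩ (right_mem_Icc.2 zero_le_one) h
  · have : MonotoneOn f (Ici 1) := by
      refine monotoneOn_of_deriv_nonneg (convex_Ici 1)
        (hc.mono fun x hx => zero_le_one.trans (mem_Ici.1 hx)) ?_ ?_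
      · intro x hx
        rw [interior_Ici] at hx
        exact (hd x (zero_lt_one.trans hx)).differentiableAt.differentiableWithinAt
      · intro x hx
        rw [interior_Ici] at hx
        rw [(hd x (zero_lt_one.trans hx)).deriv]; exact h2 x hx
    exact this self_mem_Ici h h

lemma regEntropy_one_le (hε : 0 < ε) (hε1 : ε ≤ 1) (hv : 0 ≤ v) :
    regEntropy ε 1 ≤ regEntropy ε v := by
  refine min_at_one (continuousOn_regEntropy hε)
    (fun v hv => (renormalization_regEntropy hε).hasDerivAt v hv.le) ?_ ?_ hv
  · intro v hv hv1
    rw [regEntropyDeriv, sub_nonpos]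
    exact Real.log_le_log (by positivity) (by nlinarith)
  · intro v hv1
    rw [regEntropyDeriv, sub_nonneg]
    exact Real.log_le_log (by positivity) (by nlinarith)

/-- The difference of `v log v - v` and its regularization is minimal at `1`, because `v (1 + ε v) -
(v + ε) = ε (v² - 1)` changes sign there. Thus the regularized relative entropy never exceeds the
true one. -/
lemma regEntropy_sub_le (hε : 0 < ε) (hv : 0 ≤ v) :
    regEntropy ε v - regEntropy ε 1 ≤ v * Real.log v - v + 1 := by
  have := min_at_one (v := v) (f := fun v => v * Real.log v - v - regEntropy ε v)
    (f' := fun v => Real.log v - regEntropyDeriv ε v) ?_ ?_ ?_ ?_ hv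
  · simp only [Real.log_one] at this
    linarith
  · exact ((Real.continuous_mul_log.continuousOn).sub continuousOn_id).sub (continuousOn_regEntropy hε)
  · intro v hv
    have := ((Real.hasDerivAt_mul_log hv.ne').sub (hasDerivAt_id v)).sub
      ((renormalization_regEntropy hε).hasDerivAt v hv.le)
    convert! this using 1
    ring
  · intro v hv hv1
    have h2 : 0 < 1 + ε * v := by positivity
    have : Real.log v + Real.log (1 + ε * v) ≤ Real.log (v + ε) := by
      rw [← Real.log_mul hv.ne' h2.ne']
      exact Real.log_le_log (by positivity) (by nlinarith [mul_pos hε hv])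
    rw [regEntropyDeriv]; linarith
  · intro v hv1
    have hv : 0 < v := zero_lt_one.trans hv1
    have h2 : 0 < 1 + ε * v := by positivity
    have : Real.log (v + ε) ≤ Real.log v + Real.log (1 + ε * v) := by
      rw [← Real.log_mul hv.ne' h2.ne']
      exact Real.log_le_log (by positivity) (by nlinarith [mul_pos hε hv])
    rw [regEntropyDeriv]; linarith

lemma mul_log_sub_add_one_nonneg (hv : 0 ≤ v) : 0 ≤ v * Real.log v - v + 1 := by
  have h1 := regEntropy_one_le one_pos le_rfl hv
  have h2 := regEntropy_sub_le one_pos hv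
  linarith

lemma tendsto_regEntropyDeriv₂ (hv : 0 < v) {e : ℕ → ℝ} (he : Tendsto e atTop (𝓝 0)) :
    Tendsto (fun n => regEntropyDeriv₂ (e n) v) atTop (𝓝 (1 / v)) := by
  have h1 : Tendsto (fun n => 1 / (v + e n)) atTop (𝓝 (1 / (v + 0))) :=
    (tendsto_const_nhds (x := (1 : ℝ))).div (he.const_add v) (by rw [add_zero]; exact hv.ne')
  have h2 : Tendsto (fun n => e n / (1 + e n * v)) atTop (𝓝 (0 / (1 + 0 * v))) :=
    he.div ((he.mul_const v).const_add 1) (by simp)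
  simpa [regEntropyDeriv₂] using h1.sub h2

end RegEntropy

namespace DoubleWell

variable {W : DoubleWell} {ν z ε : ℝ} {ρ : ℝ → ℝ → ℝ}

/-! ### Energy balance -/

variable (W ν z ε) in
/-- The regularized dissipation density. -/
noncomputable def regDissipation (ρ : ℝ → ℝ → ℝ) (t p : ℝ) : ℝ :=
  regEntropyDeriv₂ ε (W.relDensity ν z ρ t p)
    * (z * W.gibbs ν p * W.relDensitySpace ν z ρ t p ^ 2)

namespace IsSolution

lemma relDensity_nonneg (h : W.IsSolution ν ρ) (hz : 0 < z) {t : ℝ} (ht : 0 ≤ t) (p : ℝ) :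
    0 ≤ W.relDensity ν z ρ t p := by
  have := h.nonneg t ht p
  have := W.gibbs_pos ν p
  unfold relDensity; positivity

lemma regDissipation_nonneg (h : W.IsSolution ν ρ) (hz : 0 < z) (hε : 0 < ε) (hε1 : ε ≤ 1)
    {t : ℝ} (ht : 0 ≤ t) (p : ℝ) : 0 ≤ W.regDissipation ν z ε ρ t p := by
  have := regEntropyDeriv₂_nonneg hε hε1 (h.relDensity_nonneg hz ht p)
  have := W.gibbs_pos ν p
  unfold regDissipation; positivity

lemma continuousOn_regDissipation (h : W.IsSolution ν ρ) (hν : 0 < ν) (hz : 0 < z) (hε : 0 < ε) :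
    ContinuousOn (Function.uncurry (W.regDissipation ν z ε ρ)) positiveTimes := by
  have hfl := h.gibbsFlow hν hz
  exact (hfl.continuousOn_comp (renormalization_regEntropy hε).continuousOn).uncurry_mul
    (GibbsFlow.continuousOn_weighted (v := fun r p => W.relDensitySpace ν z ρ r p ^ 2)
      hfl.continuous_weight (hfl.continuousOn_space.uncurry_pow 2))

lemma integrable_regEntropy (h : W.IsSolution ν ρ) (hz : 0 < z) (hε : 0 < ε) (hε1 : ε ≤ 1)
    {t : ℝ} (ht : 0 ≤ t) :
    Integrable fun p => z * W.gibbs ν p * regEntropy ε (W.relDensity ν z ρ t p) := by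
  have hm : AEStronglyMeasurable (fun p => z * W.gibbs ν p * regEntropy ε (W.relDensity ν z ρ t p)) := by
    have h1 : AEMeasurable (ρ t) := (h.integrable t ht).1.aemeasurable
    have h2 : Measurable (W.gibbs ν) := (W.continuous_gibbs ν).measurable
    have h3 : Measurable (regEntropy ε) := by unfold regEntropy; fun_prop
    have h4 : AEMeasurable (W.relDensity ν z ρ t) := by
      unfold relDensity
      exact h1.div (h2.const_mul z).aemeasurable
    exact (((h2.const_mul z).aemeasurable).mul (h3.comp_aemeasurable h4)).aestronglyMeasurable
  refine ((h.integrable t ht).const_mul (-Real.log ε)).mono' hm (ae_of_all _ fun p => ?_)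
  have h1 := abs_regEntropy_le hε hε1 (h.relDensity_nonneg hz ht p)
  have hγ := W.gibbs_pos ν p
  rw [norm_mul, Real.norm_eq_abs, Real.norm_eq_abs, abs_of_pos (by positivity)]
  calc _ ≤ z * W.gibbs ν p * (-Real.log ε * W.relDensity ν z ρ t p) := by gcongr
    _ = -Real.log ε * (z * W.gibbs ν p * W.relDensity ν z ρ t p) := by ring
    _ = _ := by rw [mul_gibbs_mul_relDensity hz]

/-- Dissipation of the regularized entropy between two positive times. -/
lemma regDissipation_le (h : W.IsSolution ν ρ) (hν : 0 < ν) (hz : 0 < z) (hε : 0 < ε)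
    (hε1 : ε ≤ 1) {s t : ℝ} (hs : 0 < s) (hst : s ≤ t) {K : ℝ} (hK : 0 < K) :
    ∫ r in s..t, ∫ p in (-K)..K, W.regDissipation ν z ε ρ r p
      ≤ W.tau ν / ν ^ 2 * ((∫ p, z * W.gibbs ν p * regEntropy ε (W.relDensity ν z ρ s p))
        - ∫ p, z * W.gibbs ν p * regEntropy ε (W.relDensity ν z ρ t p)) := by
  have ht : 0 < t := hs.trans_le hst
  have hfl := h.gibbsFlow hν hz
  have hL : 0 ≤ -Real.log ε := by have := Real.log_nonpos hε.le hε1; linarith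
  have cR := h.continuousOn_regDissipation hν hz hε
  set Ψ : ℝ → ℝ → ℝ := fun r p => z * W.gibbs ν p * regEntropy ε (W.relDensity ν z ρ r p) with hΨ
  have cΨ : ContinuousOn (Function.uncurry Ψ) positiveTimes :=
    GibbsFlow.continuousOn_weighted hfl.continuous_weight
      (hfl.continuousOn_comp (continuousOn_regEntropy hε))
  have hΨb : ∀ r, 0 < r → ∀ p, |Ψ r p| ≤ -Real.log ε * ρ r p := by
    intro r hr p
    have h1 := abs_regEntropy_le hε hε1 (h.relDensity_nonneg hz hr.le p)
    have hγ := W.gibbs_pos ν p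
    rw [hΨ, abs_mul, abs_of_pos (by positivity)]
    calc _ ≤ z * W.gibbs ν p * (-Real.log ε * W.relDensity ν z ρ r p) := by gcongr
      _ = -Real.log ε * (z * W.gibbs ν p * W.relDensity ν z ρ r p) := by ring
      _ = _ := by rw [mul_gibbs_mul_relDensity hz]
  set I := ∫ r in s..t, ∫ p in (-K)..K, W.regDissipation ν z ε ρ r p with hI
  have herr := h.tendsto_cutoff_error hν hs hst hL hΨb le_rfl (a := fun M => 0 - M)
    (fun M hM => ⟨by linarith, by linarith⟩) (fun M _ p _ => by rw [sub_zero])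
  have hsl := tendsto_intervalIntegral_cutoff_mul (h.integrable_regEntropy hz hε hε1 hs.le) 0
  have htl := tendsto_intervalIntegral_cutoff_mul (h.integrable_regEntropy hz hε hε1 ht.le) 0
  have hrhs := herr.sub ((htl.sub hsl).const_mul (W.tau ν / ν ^ 2))
  -- On `[-K, K]` the cutoff is smallest at the endpoints, so its value at `K` times `I` is a lower
  -- bound for the cut-off dissipation, and this value tends to `1`.
  have hlhs : Tendsto (fun M => cutoff 0 M K * I) atTop (𝓝 (1 * I)) :=
    (tendsto_cutoff 0 K).mul_const I
  have hle := le_of_tendsto_of_tendsto hlhs hrhs ?_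
  · rw [one_mul] at hle
    linarith
  filter_upwards [eventually_gt_atTop K] with M hMK
  have hM : 0 < M := hK.trans hMK
  have hid := hfl.cutoff_identity (renormalization_regEntropy hε) hs ht 0 hM
  have cA := (GibbsFlow.continuousOn_weighted (continuous_cutoffGen (W := W) (ν := ν) 0 M)
    cΨ).continuousOn_intervalIntegral (0 - M) (0 + M)
  have cB := (GibbsFlow.continuousOn_weighted (continuous_cutoff 0 M)
    cR).continuousOn_intervalIntegral (0 - M) (0 + M)
  have cI := cR.continuousOn_intervalIntegral (-K) K
  simp only [cutoffGen_mul, mul_assoc (W.cutoffGen _ _ _ _), mul_assoc (cutoff _ _ _)] at hid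
  have hid' : W.tau ν / ν ^ 2 * ((∫ p in (0 - M)..(0 + M), cutoff 0 M p * Ψ t p)
        - ∫ p in (0 - M)..(0 + M), cutoff 0 M p * Ψ s p)
      = (∫ r in s..t, ∫ p in (0 - M)..(0 + M), W.cutoffGen ν 0 M p * Ψ r p)
        - ∫ r in s..t, ∫ p in (0 - M)..(0 + M), cutoff 0 M p * W.regDissipation ν z ε ρ r p := by
    rw [← intervalIntegral.integral_sub (cA.intervalIntegrable_Ioi hs ht)
      (cB.intervalIntegrable_Ioi hs ht)]
    simpa only [hΨ, regDissipation, mul_assoc] using hid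
  have hmono : cutoff 0 M K * I
      ≤ ∫ r in s..t, ∫ p in (0 - M)..(0 + M), cutoff 0 M p * W.regDissipation ν z ε ρ r p := by
    rw [hI, ← intervalIntegral.integral_const_mul]
    refine intervalIntegral.integral_mono_on hst ((cI.intervalIntegrable_Ioi hs ht).const_mul _)
      (cB.intervalIntegrable_Ioi hs ht) fun r hr => ?_
    have hr0 : 0 < r := hs.trans_le hr.1
    have cRr : Continuous (W.regDissipation ν z ε ρ r) := cR.continuous_slice hr0
    have hnn := h.regDissipation_nonneg hz hε hε1 hr0.le
    have ccut := continuous_cutoff 0 M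
    rw [← intervalIntegral.integral_const_mul]
    calc ∫ p in (-K)..K, cutoff 0 M K * W.regDissipation ν z ε ρ r p
        ≤ ∫ p in (-K)..K, cutoff 0 M p * W.regDissipation ν z ε ρ r p := by
          refine intervalIntegral.integral_mono_on (by linarith)
            ((continuous_const.mul cRr).intervalIntegrable _ _)
            ((ccut.mul cRr).intervalIntegrable _ _) fun p hp => ?_
          refine mul_le_mul_of_nonneg_right ?_ (hnn p)
          simp only [cutoff, sub_zero]
          have h1 : (K / M) ^ 2 ≤ 1 := by
            rw [div_pow, div_le_one (by positivity)]; gcongr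
          have h2 : (p / M) ^ 2 ≤ (K / M) ^ 2 := by
            rw [div_pow, div_pow]
            have : p ^ 2 ≤ K ^ 2 := sq_le_sq' hp.1 hp.2
            gcongr
          have h3 : 0 ≤ 1 - (K / M) ^ 2 := by linarith
          gcongr
      _ ≤ _ := by
          refine intervalIntegral.integral_mono_interval (by linarith) (by linarith) (by linarith)
            (ae_of_all _ fun p => mul_nonneg cutoff_nonneg (hnn p))
            ((ccut.mul cRr).intervalIntegrable _ _)
  linarith

/-- The regularized entropy is continuous at the initial time. -/
lemma tendsto_regEntropy_initial (h : W.IsSolution ν ρ) (hz : 0 < z) (hε : 0 < ε) (hε1 : ε ≤ 1) :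
    Tendsto (fun s => ∫ p, z * W.gibbs ν p * regEntropy ε (W.relDensity ν z ρ s p)) (𝓝[>] 0)
      (𝓝 (∫ p, z * W.gibbs ν p * regEntropy ε (W.relDensity ν z ρ 0 p))) := by
  rw [tendsto_iff_norm_sub_tendsto_zero]
  have hlim := h.initial.const_mul (-Real.log ε)
  rw [mul_zero] at hlim
  refine squeeze_zero' (Eventually.of_forall fun _ => norm_nonneg _) ?_ hlim
  filter_upwards [self_mem_nhdsWithin] with s hs
  have hs0 : 0 ≤ s := le_of_lt hs
  rw [← integral_sub (h.integrable_regEntropy hz hε hε1 hs0)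
    (h.integrable_regEntropy hz hε hε1 le_rfl), ← integral_const_mul]
  refine norm_integral_le_of_norm_le
    (((h.integrable s hs0).sub (h.integrable 0 le_rfl)).abs.const_mul _) (ae_of_all _ fun p => ?_)
  have h1 := abs_regEntropy_sub_le hε hε1 (h.relDensity_nonneg hz hs0 p)
    (h.relDensity_nonneg hz le_rfl p)
  have hγ : 0 < z * W.gibbs ν p := mul_pos hz (W.gibbs_pos ν p)
  rw [← mul_sub, norm_mul, Real.norm_eq_abs, Real.norm_eq_abs, abs_of_pos hγ]
  calc _ ≤ z * W.gibbs ν p * (-Real.log ε * |W.relDensity ν z ρ s p - W.relDensity ν z ρ 0 p|) := by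
        gcongr
    _ = -Real.log ε * |z * W.gibbs ν p * W.relDensity ν z ρ s p
          - z * W.gibbs ν p * W.relDensity ν z ρ 0 p| := by
        rw [← mul_sub (z * W.gibbs ν p), abs_mul, abs_of_pos hγ]; ring
    _ = _ := by
        rw [mul_gibbs_mul_relDensity hz, mul_gibbs_mul_relDensity hz]

end IsSolution

variable (W ν) in
/-- The partition function. -/
noncomputable def partition : ℝ := ∫ p, W.gibbs ν p

lemma partition_eq (hν : 0 < ν) : W.partition ν = W.mu ν .minus + W.mu ν .plus := by
  have hi := W.integrable_gibbs hν
  rw [partition, mu, mu, Well.phase, Well.phase, ← integral_Iic_eq_integral_Iio,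
    intervalIntegral.integral_Iic_add_Ioi hi.integrableOn hi.integrableOn]

lemma partition_pos (hν : 0 < ν) : 0 < W.partition ν := by
  rw [partition_eq hν]
  exact add_pos (W.mu_pos hν _) (W.mu_pos hν _)

namespace IsSolution

/-- This links the energy to the entropy relative to the normalized Gibbs measure: `ν² log γ = -H`,
and the normalization contributes `log Z`. -/
lemma relEntropy_eq (h : W.IsSolution ν ρ) (hν : 0 < ν) (p : ℝ) :
    (W.partition ν)⁻¹ * W.gibbs ν p * (W.relDensity ν (W.partition ν)⁻¹ ρ 0 p
        * Real.log (W.relDensity ν (W.partition ν)⁻¹ ρ 0 p)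
        - W.relDensity ν (W.partition ν)⁻¹ ρ 0 p + 1)
      = W.energyDensity ν ρ 0 p / ν ^ 2 + (Real.log (W.partition ν) - 1) * ρ 0 p
        + (W.partition ν)⁻¹ * W.gibbs ν p := by
  have hZ := W.partition_pos hν
  have hz : 0 < (W.partition ν)⁻¹ := by positivity
  have e := mul_gibbs_mul_relDensity (W := W) (ν := ν) (ρ := ρ) hz 0 p
  have e2 : (W.partition ν)⁻¹ * W.gibbs ν p * (W.relDensity ν (W.partition ν)⁻¹ ρ 0 p
        * Real.log (W.relDensity ν (W.partition ν)⁻¹ ρ 0 p)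
        - W.relDensity ν (W.partition ν)⁻¹ ρ 0 p + 1)
      = ρ 0 p * Real.log (W.relDensity ν (W.partition ν)⁻¹ ρ 0 p) - ρ 0 p
        + (W.partition ν)⁻¹ * W.gibbs ν p := by
    linear_combination (Real.log (W.relDensity ν (W.partition ν)⁻¹ ρ 0 p) - 1) * e
  rw [e2, energyDensity]
  rcases (h.nonneg 0 le_rfl p).eq_or_lt with h0 | h0
  · rw [← h0]; simp
  · have hγ := W.gibbs_pos ν p
    have e3 : Real.log (W.relDensity ν (W.partition ν)⁻¹ ρ 0 p)
        = Real.log (ρ 0 p) + Real.log (W.partition ν) + W.H p / ν ^ 2 := by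
      have e4 : Real.log (W.gibbs ν p) = -W.H p / ν ^ 2 := Real.log_exp _
      rw [relDensity, Real.log_div h0.ne' (by positivity), Real.log_mul (by positivity) hγ.ne',
        Real.log_inv, e4]
      ring
    rw [e3]
    field_simp
    ring

lemma integrable_relEntropy (h : W.IsSolution ν ρ) (hν : 0 < ν)
    (hE : Integrable (W.energyDensity ν ρ 0)) :
    Integrable fun p => (W.partition ν)⁻¹ * W.gibbs ν p * (W.relDensity ν (W.partition ν)⁻¹ ρ 0 p
        * Real.log (W.relDensity ν (W.partition ν)⁻¹ ρ 0 p)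
        - W.relDensity ν (W.partition ν)⁻¹ ρ 0 p + 1) := by
  simp_rw [h.relEntropy_eq hν]
  exact ((hE.div_const _).add ((h.integrable 0 le_rfl).const_mul _)).add
    ((W.integrable_gibbs hν).const_mul _)

lemma integral_relEntropy (h : W.IsSolution ν ρ) (hν : 0 < ν)
    (hE : Integrable (W.energyDensity ν ρ 0)) :
    ∫ p, (W.partition ν)⁻¹ * W.gibbs ν p * (W.relDensity ν (W.partition ν)⁻¹ ρ 0 p
        * Real.log (W.relDensity ν (W.partition ν)⁻¹ ρ 0 p)
        - W.relDensity ν (W.partition ν)⁻¹ ρ 0 p + 1)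
      = W.energy ν ρ 0 / ν ^ 2 + Real.log (W.partition ν) := by
  have hZ := W.partition_pos hν
  simp_rw [h.relEntropy_eq hν]
  have i1 := hE.div_const (ν ^ 2)
  have i2 := (h.integrable 0 le_rfl).const_mul (Real.log (W.partition ν) - 1)
  have i3 := (W.integrable_gibbs hν).const_mul (W.partition ν)⁻¹
  have i12 : Integrable fun p => W.energyDensity ν ρ 0 p / ν ^ 2
      + (Real.log (W.partition ν) - 1) * ρ 0 p := i1.add i2
  rw [integral_add i12 i3, integral_add i1 i2, integral_div, integral_const_mul,
    integral_const_mul, h.mass_one 0 le_rfl, ← partition, inv_mul_cancel₀ hZ.ne', energy]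
  ring

/-- The regularized dissipation is bounded by the initial energy. -/
lemma regDissipation_le_energy (h : W.IsSolution ν ρ) (hν : 0 < ν)
    (hE : Integrable (W.energyDensity ν ρ 0)) (hε : 0 < ε) (hε1 : ε ≤ 1) {s t : ℝ}
    (hs : 0 < s) (hst : s ≤ t) {K : ℝ} (hK : 0 < K) :
    ∫ r in s..t, ∫ p in (-K)..K, W.regDissipation ν (W.partition ν)⁻¹ ε ρ r p
      ≤ W.tau ν / ν ^ 2 * (W.energy ν ρ 0 / ν ^ 2 + Real.log (W.partition ν)) := by
  have hZ := W.partition_pos hν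
  set z := (W.partition ν)⁻¹ with hzdef
  have hz : 0 < z := by positivity
  have ht : 0 < t := hs.trans_le hst
  have hτ := W.tau_pos ν
  have cR := h.continuousOn_regDissipation hν hz hε
  have cI := cR.continuousOn_intervalIntegral (-K) K
  have hinit : ∫ r in s..t, ∫ p in (-K)..K, W.regDissipation ν z ε ρ r p
      ≤ W.tau ν / ν ^ 2 * ((∫ p, z * W.gibbs ν p * regEntropy ε (W.relDensity ν z ρ 0 p))
        - ∫ p, z * W.gibbs ν p * regEntropy ε (W.relDensity ν z ρ t p)) := by
    -- The entropy at an earlier time `s'` also controls the dissipation on the shorter interval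
    -- from `s`; then `s'` tends to `0`.
    refine ge_of_tendsto (((h.tendsto_regEntropy_initial hz hε hε1).sub_const _).const_mul _) ?_
    filter_upwards [Ioo_mem_nhdsGT hs] with s' hs'
    refine le_trans ?_ (h.regDissipation_le hν hz hε hε1 hs'.1 (hs'.2.le.trans hst) hK)
    refine intervalIntegral.integral_mono_interval hs'.2.le hst le_rfl ?_
      (cI.intervalIntegrable_Ioi hs'.1 ht)
    refine (ae_restrict_iff' measurableSet_Ioc).2 (ae_of_all _ fun r hr => ?_)
    exact intervalIntegral.integral_nonneg (by linarith) fun p _ =>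
      h.regDissipation_nonneg hz hε hε1 (hs'.1.le.trans hr.1.le) p
  refine hinit.trans ?_
  rw [← h.integral_relEntropy hν hE]
  have i0 := h.integrable_regEntropy hz hε hε1 (t := 0) le_rfl
  have it := h.integrable_regEntropy hz hε hε1 ht.le
  have iγ : Integrable fun p => z * W.gibbs ν p * regEntropy ε 1 :=
    ((W.integrable_gibbs hν).const_mul z).mul_const _
  -- The final entropy is discarded against its minimum, attained at relative density `1`.
  have e1 : ∫ p, z * W.gibbs ν p * regEntropy ε 1
      ≤ ∫ p, z * W.gibbs ν p * regEntropy ε (W.relDensity ν z ρ t p) := by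
    refine integral_mono iγ it fun p => ?_
    have := W.gibbs_pos ν p
    have := regEntropy_one_le hε hε1 (h.relDensity_nonneg hz ht.le p)
    dsimp only
    gcongr
  have e2 : (∫ p, z * W.gibbs ν p * regEntropy ε (W.relDensity ν z ρ 0 p))
      - (∫ p, z * W.gibbs ν p * regEntropy ε 1)
      ≤ ∫ p, z * W.gibbs ν p * (W.relDensity ν z ρ 0 p * Real.log (W.relDensity ν z ρ 0 p)
        - W.relDensity ν z ρ 0 p + 1) := by
    rw [← integral_sub i0 iγ]
    refine integral_mono (i0.sub iγ) (h.integrable_relEntropy hν hE) fun p => ?_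
    have := W.gibbs_pos ν p
    have := regEntropy_sub_le hε (h.relDensity_nonneg hz le_rfl p)
    dsimp only
    rw [← mul_sub]
    gcongr
  gcongr
  linarith

lemma relEntropy_nonneg (h : W.IsSolution ν ρ) (hν : 0 < ν)
    (hE : Integrable (W.energyDensity ν ρ 0)) :
    0 ≤ W.energy ν ρ 0 / ν ^ 2 + Real.log (W.partition ν) := by
  have hZ := W.partition_pos hν
  rw [← h.integral_relEntropy hν hE]
  refine integral_nonneg fun p => mul_nonneg (mul_nonneg (by positivity) (W.gibbs_pos ν p).le) ?_
  exact mul_log_sub_add_one_nonneg (h.relDensity_nonneg (by positivity) le_rfl p)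

lemma tendsto_regDissipation (h : W.IsSolution ν ρ) (hz : 0 < z) {t : ℝ} (ht : 0 ≤ t) (p : ℝ)
    (hρ : ρ t p ≠ 0) {e : ℕ → ℝ} (he : Tendsto e atTop (𝓝 0)) :
    Tendsto (fun n => W.regDissipation ν z (e n) ρ t p) atTop
      (𝓝 ((deriv (ρ t) p + deriv W.H p * ρ t p / ν ^ 2) ^ 2 / ρ t p)) := by
  have hγ := W.gibbs_pos ν p
  have hρ0 : 0 < ρ t p := lt_of_le_of_ne (h.nonneg t ht p) hρ.symm
  have hv : 0 < W.relDensity ν z ρ t p := by unfold relDensity; positivity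
  have := (tendsto_regEntropyDeriv₂ hv he).mul_const
    (z * W.gibbs ν p * W.relDensitySpace ν z ρ t p ^ 2)
  have e1 : 1 / W.relDensity ν z ρ t p * (z * W.gibbs ν p * W.relDensitySpace ν z ρ t p ^ 2)
      = (deriv (ρ t) p + deriv W.H p * ρ t p / ν ^ 2) ^ 2 / ρ t p := by
    rw [relDensity, relDensitySpace, one_div_div, div_pow]
    field_simp
  rwa [e1] at this

/-- **Energy balance** with the sharp constants. -/
theorem lintegral_dissipation_le (h : W.IsSolution ν ρ) (hν : 0 < ν)
    (hE : Integrable (W.energyDensity ν ρ 0)) :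
    ∫⁻ t in Ioi (0 : ℝ), W.dissipation ν ρ t
      ≤ ENNReal.ofReal (W.tau ν / ν ^ 2 * (W.energy ν ρ 0 / ν ^ 2 + Real.log (W.partition ν))) := by
  have hZ := W.partition_pos hν
  set z := (W.partition ν)⁻¹ with hzdef
  have hz : 0 < z := by positivity
  -- A single index drives the regularization and the lower time to `0`, and the upper time and the
  -- spatial radius to infinity. Fatou's lemma is applied in `p` at each time and then in time.
  set e : ℕ → ℝ := fun n => 1 / ((n : ℝ) + 1) with he
  have he0 : ∀ n, 0 < e n := fun n => by simp only [he]; positivity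
  have he1 : ∀ n, e n ≤ 1 := fun n => by
    simp only [he]
    rw [div_le_one (by positivity)]
    have : (0 : ℝ) ≤ n := n.cast_nonneg
    linarith
  have helim : Tendsto e atTop (𝓝 0) := tendsto_one_div_add_atTop_nhds_zero_nat
  set T : ℕ → ℝ := fun n => (n : ℝ) + 1 with hT
  have hT1 : ∀ n, 1 ≤ T n := fun n => by
    simp only [hT]
    have : (0 : ℝ) ≤ n := n.cast_nonneg
    linarith
  have hTlim : Tendsto T atTop atTop :=
    tendsto_atTop_add_const_right _ _ tendsto_natCast_atTop_atTop
  have cR := fun n => h.continuousOn_regDissipation hν hz (he0 n)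
  set I : ℕ → ℝ → ℝ := fun n r => ∫ p in (-T n)..(T n), W.regDissipation ν z (e n) ρ r p with hI
  have cI : ∀ n, ContinuousOn (I n) (Ioi 0) := fun n =>
    (cR n).continuousOn_intervalIntegral (-T n) (T n)
  have hI0 : ∀ n r, 0 < r → 0 ≤ I n r := fun n r hr =>
    intervalIntegral.integral_nonneg (by linarith [hT1 n]) fun p _ =>
      h.regDissipation_nonneg hz (he0 n) (he1 n) hr.le p
  set F : ℕ → ℝ → ℝ≥0∞ := fun n => (Ioc (e n) (T n)).indicator fun r => ENNReal.ofReal (I n r) with hF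
  have hsub : ∀ n, Ioc (e n) (T n) ⊆ Ioi 0 := fun n r hr => (he0 n).trans hr.1
  have hFm : ∀ n, AEMeasurable (F n) (volume.restrict (Ioi 0)) := fun n =>
    AEMeasurable.indicator
      (((cI n).aemeasurable measurableSet_Ioi).ennreal_ofReal) measurableSet_Ioc
  have hFint : ∀ n, ∫⁻ r in Ioi (0 : ℝ), F n r
      ≤ ENNReal.ofReal (W.tau ν / ν ^ 2 * (W.energy ν ρ 0 / ν ^ 2 + Real.log (W.partition ν))) := by
    intro n
    have hle : e n ≤ T n := (he1 n).trans (hT1 n)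
    rw [hF, setLIntegral_indicator measurableSet_Ioc, inter_eq_left.2 (hsub n),
      ← ofReal_integral_eq_lintegral_ofReal, ← intervalIntegral.integral_of_le hle]
    · exact ENNReal.ofReal_le_ofReal (h.regDissipation_le_energy hν hE (he0 n) (he1 n) (he0 n) hle
        (by linarith [hT1 n]))
    · have := (cI n).intervalIntegrable_Ioi (he0 n) ((he0 n).trans_le hle)
      rwa [intervalIntegrable_iff_integrableOn_Ioc_of_le hle] at this
    · exact (ae_restrict_iff' measurableSet_Ioc).2 (ae_of_all _ fun r hr => hI0 n r (hsub n hr))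
  have hpt : ∀ r ∈ Ioi (0 : ℝ), W.dissipation ν ρ r ≤ liminf (fun n => F n r) atTop := by
    intro r hr
    have hr0 : 0 < r := hr
    set g : ℕ → ℝ → ℝ≥0∞ := fun n => (Ioc (-T n) (T n)).indicator
      fun p => ENNReal.ofReal (W.regDissipation ν z (e n) ρ r p) with hg
    have hgm : ∀ n, Measurable (g n) := fun n =>
      (((cR n).continuous_slice hr0).measurable.ennreal_ofReal).indicator measurableSet_Ioc
    have hFg : ∀ᶠ n in atTop, ∫⁻ p, g n p = F n r := by
      filter_upwards [hTlim.eventually_ge_atTop r, helim.eventually_lt_const hr0] with n h1 h2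
      have cs : Continuous (W.regDissipation ν z (e n) ρ r) := (cR n).continuous_slice hr0
      have hle : -T n ≤ T n := by linarith [hT1 n]
      have hrm : r ∈ Ioc (e n) (T n) := ⟨h2, h1⟩
      have eF : F n r = ENNReal.ofReal (∫ p in (-T n)..(T n), W.regDissipation ν z (e n) ρ r p) :=
        indicator_of_mem hrm _
      have eg : ∫⁻ p, g n p = ∫⁻ p, (Ioc (-T n) (T n)).indicator
        (fun p => ENNReal.ofReal (W.regDissipation ν z (e n) ρ r p)) p := rfl
      rw [eF, eg, lintegral_indicator measurableSet_Ioc, intervalIntegral.integral_of_le hle,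
        ofReal_integral_eq_lintegral_ofReal]
      · exact cs.integrableOn_Ioc
      · exact ae_of_all _ (h.regDissipation_nonneg hz (he0 n) (he1 n) hr0.le)
    rw [← liminf_congr hFg]
    refine le_trans ?_ (lintegral_liminf_le hgm)
    refine lintegral_mono fun p => ?_
    by_cases hp : ρ r p = 0
    -- Where `ρ` vanishes, the integrand is `0` by the convention for division, so no convergence is
    -- needed.
    · simp [hp]
    · have hlim : Tendsto (fun n => g n p) atTop (𝓝 (ENNReal.ofReal
          ((deriv (ρ r) p + deriv W.H p * ρ r p / ν ^ 2) ^ 2 / ρ r p))) := by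
        refine (ENNReal.tendsto_ofReal (h.tendsto_regDissipation hz hr0.le p hp helim)).congr' ?_
        filter_upwards [hTlim.eventually_gt_atTop |p|] with n hn
        have := abs_lt.1 hn
        have hpm : p ∈ Ioc (-T n) (T n) := ⟨this.1, this.2.le⟩
        exact (indicator_of_mem hpm
          fun p => ENNReal.ofReal (W.regDissipation ν z (e n) ρ r p)).symm
      rw [hlim.liminf_eq]
  calc ∫⁻ t in Ioi (0 : ℝ), W.dissipation ν ρ t
      ≤ ∫⁻ r in Ioi (0 : ℝ), liminf (fun n => F n r) atTop :=
        setLIntegral_mono' measurableSet_Ioi hpt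
    _ ≤ liminf (fun n => ∫⁻ r in Ioi (0 : ℝ), F n r) atTop := lintegral_liminf_le' hFm
    _ ≤ _ := by
        refine (liminf_le_liminf (Eventually.of_forall hFint)).trans ?_
        simp

end IsSolution

/-- The partition function grows like the exponential of a barrier over `ν²`, so its logarithm is
`O(ν⁻²)`; the algebraic prefactors are harmless. -/
lemma exists_log_partition_le (W : DoubleWell) : ∃ C > 0, ∃ ν₀ > 0, ∀ ν : ℝ, 0 < ν → ν < ν₀ →
    ν ^ 2 * Real.log (W.partition ν) ≤ C := by
  obtain ⟨C, hC, ν₀, hν₀, hν₀1, hCν₀, hall⟩ := W.exists_elementary_asymptotics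
  have hw := W.omega_pos .minus
  have hw' := W.omega_pos .plus
  have hh := W.h_pos .minus
  have hh' := W.h_pos .plus
  set a := 2 / W.omega .minus + 2 / W.omega .plus with ha
  have ha0 : 0 < a := by positivity
  refine ⟨|Real.log a| + (W.h .minus + W.h .plus), by positivity, ν₀, hν₀, fun ν hν hνν => ?_⟩
  have hν1 : ν ≤ 1 := hνν.le.trans hν₀1
  have hCν : C * ν ^ 2 ≤ 1 / 2 := by
    refine le_trans ?_ hCν₀; gcongr
  -- The sum of the barriers serves both wells at once.
  set E := Real.exp ((W.h .minus + W.h .plus) / ν ^ 2) with hE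
  have hμ : ∀ s : Well, W.mu ν s ≤ 2 / W.omega s * E := by
    intro s
    have h := hall ν hν hνν s
    have n1 := abs_nonneg (W.theta ν)
    have n2 := abs_nonneg (W.eta ν * (W.omegaZero / ν) - 1)
    have n4 := abs_nonneg (W.kappa ν * (W.omega .minus / W.omega .plus)
              * Real.exp ((W.h .plus - W.h .minus) / ν ^ 2) - 1)
    have h1 : W.mu ν s * (W.omega s / ν) * Real.exp (-W.h s / ν ^ 2) ≤ 2 := by
      have := le_abs_self (W.mu ν s * (W.omega s / ν) * Real.exp (-W.h s / ν ^ 2) - 1)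
      linarith
    have hws := W.omega_pos s
    have hle : Real.exp (W.h s / ν ^ 2) ≤ E := by
      rw [hE]
      gcongr
      cases s <;> linarith
    have e1 : Real.exp (-W.h s / ν ^ 2) * Real.exp (W.h s / ν ^ 2) = 1 := by
      rw [← Real.exp_add, ← add_div]; simp
    calc W.mu ν s = W.mu ν s * (W.omega s / ν) * (Real.exp (-W.h s / ν ^ 2) * Real.exp (W.h s / ν ^ 2))
          * (ν / W.omega s) := by rw [e1]; field_simp
      _ = (W.mu ν s * (W.omega s / ν) * Real.exp (-W.h s / ν ^ 2)) * Real.exp (W.h s / ν ^ 2)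
          * (ν / W.omega s) := by ring
      _ ≤ 2 * E * (1 / W.omega s) := by gcongr
      _ = _ := by ring
  have hZ : W.partition ν ≤ a * E := by
    rw [partition_eq hν, ha, add_mul]
    exact add_le_add (hμ _) (hμ _)
  have hlog : Real.log (W.partition ν) ≤ Real.log a + (W.h .minus + W.h .plus) / ν ^ 2 := by
    refine (Real.log_le_log (partition_pos hν) hZ).trans (le_of_eq ?_)
    rw [Real.log_mul ha0.ne' (Real.exp_pos _).ne', Real.log_exp]
  calc ν ^ 2 * Real.log (W.partition ν)
      ≤ ν ^ 2 * (Real.log a + (W.h .minus + W.h .plus) / ν ^ 2) := by gcongr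
    _ = ν ^ 2 * Real.log a + (W.h .minus + W.h .plus) := by field_simp
    _ ≤ _ := by
        gcongr
        calc ν ^ 2 * Real.log a ≤ ν ^ 2 * |Real.log a| := by gcongr; exact le_abs_self _
          _ ≤ 1 * |Real.log a| := by gcongr; exact pow_le_one₀ hν.le hν1
          _ = _ := one_mul _

/-- The quantification over all `C' ≥ C` allows the constant to be merged with the others.
Nonnegativity of the relative entropy forces `C' + 𝓔(0) ≥ 0`, so the factor `C' ≥ 1` can be
inserted. -/
theorem exists_energy_balance (W : DoubleWell) : ∃ C > 0, ∃ ν₀ > 0, ∀ C' ≥ C, ∀ ν : ℝ, 0 < ν → ν < ν₀ →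
    ∀ ρ : ℝ → ℝ → ℝ, W.IsSolution ν ρ → Integrable (W.energyDensity ν ρ 0) →
      ∫⁻ t in Ioi (0 : ℝ), W.dissipation ν ρ t
        ≤ ENNReal.ofReal (C' * W.tau ν / ν ^ 4 * (C' + W.energy ν ρ 0)) := by
  obtain ⟨C, hC, ν₀, hν₀, hall⟩ := W.exists_log_partition_le
  refine ⟨max C 1, by positivity, ν₀, hν₀, fun C' hC' ν hν hνν ρ h hE => ?_⟩
  refine (h.lintegral_dissipation_le hν hE).trans (ENNReal.ofReal_le_ofReal ?_)
  have hτ := W.tau_pos ν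
  have h1 := h.relEntropy_nonneg hν hE
  have hC1 : C ≤ C' := (le_max_left _ _).trans hC'
  have hC2 : 1 ≤ C' := (le_max_right _ _).trans hC'
  have h2 := hall ν hν hνν
  have e1 : ν ^ 2 * (W.energy ν ρ 0 / ν ^ 2 + Real.log (W.partition ν))
      = W.energy ν ρ 0 + ν ^ 2 * Real.log (W.partition ν) := by field_simp
  have h3 : 0 ≤ W.energy ν ρ 0 + ν ^ 2 * Real.log (W.partition ν) := by
    rw [← e1]; positivity
  have h4 : 0 ≤ C' + W.energy ν ρ 0 := by linarith
  have h5 : 0 < W.tau ν / ν ^ 4 := by positivity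
  calc W.tau ν / ν ^ 2 * (W.energy ν ρ 0 / ν ^ 2 + Real.log (W.partition ν))
      = W.tau ν / ν ^ 4 * (W.energy ν ρ 0 + ν ^ 2 * Real.log (W.partition ν)) := by
        rw [← e1]; field_simp
    _ ≤ W.tau ν / ν ^ 4 * (C' + W.energy ν ρ 0) :=
        mul_le_mul_of_nonneg_left (by linarith) h5.le
    _ = 1 * (W.tau ν / ν ^ 4 * (C' + W.energy ν ρ 0)) := (one_mul _).symm
    _ ≤ C' * (W.tau ν / ν ^ 4 * (C' + W.energy ν ρ 0)) := by gcongr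
    _ = _ := by ring

end DoubleWell

/-! ### Assembly with common constants. -/

theorem propositionB1 (W : DoubleWell) :
    ∃ C > (0 : ℝ), ∃ ν₀ > (0 : ℝ), ∀ ν : ℝ, 0 < ν → ν < ν₀ →
      -- elementary asymptotics
      (∀ s : Well,
        |W.theta ν| + |W.eta ν * (W.omegaZero / ν) - 1|
          + |W.mu ν s * (W.omega s / ν) * Real.exp (-W.h s / ν ^ 2) - 1|
          + |W.kappa ν * (W.omega .minus / W.omega .plus)
              * Real.exp ((W.h .plus - W.h .minus) / ν ^ 2) - 1|
          ≤ C * ν ^ 2) ∧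
      ∀ ρ : ℝ → ℝ → ℝ, W.IsSolution ν ρ →
        -- effective dynamics of the substitute masses
        (∀ s : Well, ∀ t : ℝ, 0 < t →
          DifferentiableAt ℝ (W.massTilde ν ρ s) t ∧
          s.sign * (1 + W.theta ν) * deriv (W.massTilde ν ρ s) t
            = W.massBar ν ρ .minus t - W.kappa ν * W.massBar ν ρ .plus t) ∧
        -- the dissipation bounds the error, also at the initial time if the datum is `C¹`
        (∀ s : Well, ∀ t : ℝ, (0 < t ∨ t = 0 ∧ ContDiff ℝ 1 (ρ 0)) →
          ENNReal.ofReal (|W.massTilde ν ρ s t - DoubleWell.mass ρ s t|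
              + |W.massBar ν ρ s t - DoubleWell.mass ρ s t|)
            ≤ ENNReal.ofReal C *
              (ENNReal.ofReal (W.tau ν ^ (-(1 / 2) : ℝ) * ν ^ 2) * W.dissipation ν ρ t
                + ENNReal.ofReal (W.tau ν ^ ((1 / 2) : ℝ) / ν ^ 2))) ∧
        -- energy balance, for finite initial energy
        (Integrable (W.energyDensity ν ρ 0) →
          ∫⁻ t in Ioi (0 : ℝ), W.dissipation ν ρ t
            ≤ ENNReal.ofReal (C * W.tau ν / ν ^ 4 * (C + W.energy ν ρ 0))) := by
  obtain ⟨C₁, hC₁, ν₁, hν₁, -, -, asymptotics⟩ := W.exists_elementary_asymptotics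
  obtain ⟨C₂, hC₂, ν₂, hν₂, error⟩ := W.exists_dissipation_bounds_error
  obtain ⟨C₃, hC₃, ν₃, hν₃, balance⟩ := W.exists_energy_balance
  refine ⟨max C₁ (max C₂ C₃), lt_max_of_lt_left hC₁, min ν₁ (min ν₂ ν₃),
    lt_min hν₁ (lt_min hν₂ hν₃), fun ν hν hlt => ?_⟩
  obtain ⟨h₁, h₂, h₃⟩ : ν < ν₁ ∧ ν < ν₂ ∧ ν < ν₃ := by simpa only [lt_min_iff] using hlt
  refine ⟨fun s => (asymptotics ν hν h₁ s).trans ?_, fun ρ h => ⟨fun s t ht =>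
    h.effective_dynamics hν s ht, fun s t ht => (error ν hν h₂ ρ h s t ht).trans ?_,
    balance _ ((le_max_right _ _).trans (le_max_right _ _)) ν hν h₃ ρ h⟩⟩
  · gcongr
    exact le_max_left _ _
  · gcongr
    exact (le_max_left _ _).trans (le_max_right _ _)
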